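/- Let $\beta\in\mathbb R$, $\gamma>2$, and let $\theta\colon[0,\infty)\to[0,\infty)$ be of class $C^2$ with $\theta,\theta',\theta''$ bounded and $\theta(0)=1$. Write $\hat\xi(p)=(2\pi)^{-3/2}\int_{\mathbb R^3}e^{-ip\cdot y}\xi(y)\,dy$ for the unitary Fourier transform on $L^2(\mathbb R^3)$ and $\|\xi\|_{H^s}^2=\int_{\mathbb R^3}(1+|p|^2)^s|\hat\xi(p)|^2\,dp$. For $\lambda>0$ and $\eta,\xi\in H^{1/2}(\mathbb R^3)$ let $$\Phi^\lambda(\eta,\xi)=\int\overline{\hat\eta(p)}\Big(\sqrt{\tfrac34|p|^2+\lambda}\;\hat\xi(p)-\frac1{\pi^2}\int\frac{\hat\xi(q)}{|p|^2+|q|^2+p\cdot q+\lambda}\,dq\Big)dp+\int\overline{\eta(y)}\Big(\beta+\frac{\gamma}{|y|}\theta(|y|)\Big)\xi(y)\,dy .$$ The form $\Phi^\lambda$ is called coercive if there is $c_0>0$ with $\Phi^\lambda(\xi,\xi)\ge c_0\|\xi\|_{H^{1/2}}^2$ for all $\xi\in H^{1/2}(\mathbb R^3)$. Let $\Gamma^\lambda$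 be the operator in $L^2(\mathbb R^3)$ associated with $\Phi^\lambda$: $\xi\in\mathcal D(\Gamma^\lambda)$ and $\Gamma^\lambda\xi=g$ mean that $\xi\in H^{1/2}(\mathbb R^3)$, $g\in L^2(\mathbb R^3)$ and $\Phi^\lambda(\eta,\xi)=(\eta,g)_{L^2}$ for all $\eta\in H^{1/2}(\mathbb R^3)$. There is $\lambda_0>0$ such that $\Phi^\lambda$ is coercive for every $\lambda>\lambda_0$. For every $\lambda>0$ for which $\Phi^\lambda$ is coercive there is a constant $c>0$ (depending only on $\beta,\gamma,\theta,\lambda$) such that, whenever $f\in H^{1/2}(\mathbb R^3)$, $\xi\in\mathcal D(\Gamma^\lambda)$ and $\Gamma^\lambda\xi=f$, one has $\xi\in H^{3/2}(\mathbb R^3)$ and $$\|\xi\|_{H^{3/2}}\le c\,\|f\|_{H^{1/2}} .$$ -/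

import Mathlib

open scoped FourierTransform ComplexConjugate
open MeasureTheory

noncomputable section

namespace ThreeBoson

/-- The physical space `ℝ³` with its Euclidean norm and Lebesgue measure. -/
abbrev E3 : Type := EuclideanSpace ℝ (Fin 3)

/-- The complex Hilbert space `L²(ℝ³)`. -/
abbrev L2 : Type := Lp ℂ 2 (volume : Measure E3)

/-- The unitary Fourier transform
`ξ̂(p) = (2π)^(-3/2) ∫ exp(-i p·y) ξ(y) dy` of `ξ ∈ L²(ℝ³)`.
Mathlib's `𝓕` has the kernel `exp(-2πi w·y)`, hence the dilation by `2π`. -/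
def fhat (ξ : L2) (p : E3) : ℂ :=
  (((2 * Real.pi) ^ (-(3 / 2) : ℝ) : ℝ) : ℂ) *
    ((𝓕 ξ : L2) : E3 → ℂ) ((2 * Real.pi)⁻¹ • p)

/-- `ξ ∈ L²(ℝ³)` belongs to the Sobolev space `H^s(ℝ³)` (used for `s ≥ 0`):
`∫ (1 + p²)^s |ξ̂(p)|² dp < ∞`. -/
def MemH (s : ℝ) (ξ : L2) : Prop :=
  Integrable (fun p : E3 => (1 + ‖p‖ ^ 2) ^ s * ‖fhat ξ p‖ ^ 2)

/-- The norm of `H^s(ℝ³)`: `‖ξ‖² = ∫ (1 + p²)^s |ξ̂(p)|² dp`. -/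
def normH (s : ℝ) (ξ : L2) : ℝ :=
  Real.sqrt (∫ p : E3, (1 + ‖p‖ ^ 2) ^ s * ‖fhat ξ p‖ ^ 2)

/-- The cut-off hypothesis: `θ : [0, ∞) → [0, ∞)` is of class `C²`, the functions `θ`, `θ'`, `θ''`
are bounded, and `θ(0) = 1`.  At the endpoint `0` only continuity of `θ` is demanded; this
is implied by one-sided `C²`-smoothness there. -/
structure SmoothCutoff (θ : ℝ → ℝ) : Prop where
  nonneg : ∀ r, 0 ≤ r → 0 ≤ θ r
  continuousOn : ContinuousOn θ (Set.Ici 0)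
  contDiffOn : ContDiffOn ℝ 2 θ (Set.Ioi 0)
  bounded : ∃ M : ℝ, ∀ r, 0 < r →
    |θ r| ≤ M ∧ |deriv θ r| ≤ M ∧ |deriv (deriv θ) r| ≤ M
  zero : θ 0 = 1

/-- The multiplication function `β + (γ / y) θ(y)`, `y = |𝐲|`, of the regularizing three-body term. -/
def gammaReg (β γ : ℝ) (θ : ℝ → ℝ) (y : E3) : ℝ :=
  β + γ / ‖y‖ * θ ‖y‖

/-- The diagonal part of the form:
`∫ conj (η̂(p)) √(3p²/4 + lam) ξ̂(p) dp`. -/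
def formDiag (lam : ℝ) (η ξ : L2) : ℂ :=
  ∫ p : E3, conj (fhat η p) * ((Real.sqrt (3 / 4 * ‖p‖ ^ 2 + lam) : ℂ) * fhat ξ p)

/-- The off-diagonal part of the form:
`-π⁻² ∫ conj (η̂(p)) ∫ ξ̂(q) / (p² + q² + p·q + lam) dq dp`. -/
def formOff (lam : ℝ) (η ξ : L2) : ℂ :=
  ∫ p : E3, conj (fhat η p) *
    (-(1 / (Real.pi : ℂ) ^ 2) *
      ∫ q : E3, fhat ξ q / ((‖p‖ ^ 2 + ‖q‖ ^ 2 + inner ℝ p q + lam : ℝ) : ℂ))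

/-- The regularizing part of the form, written in position space:
`∫ conj (η(y)) (β + γ θ(y) / y) ξ(y) dy`. -/
def formReg (β γ : ℝ) (θ : ℝ → ℝ) (η ξ : L2) : ℂ :=
  ∫ y : E3, conj (η y) * ((gammaReg β γ θ y : ℂ) * ξ y)

/-- The sesquilinear form `Φ^lam(η, ξ)` on `H^{1/2}(ℝ³)` (antilinear in `η`). -/
def form (β γ : ℝ) (θ : ℝ → ℝ) (lam : ℝ) (η ξ : L2) : ℂ :=
  formDiag lam η ξ + formOff lam η ξ + formReg β γ θ η ξ

/-- `Φ^lam` is coercive on its domain `H^{1/2}(ℝ³)`. -/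
def FormCoercive (β γ : ℝ) (θ : ℝ → ℝ) (lam : ℝ) : Prop :=
  ∃ c₀ : ℝ, 0 < c₀ ∧ ∀ ξ : L2, MemH (1 / 2) ξ →
    c₀ * normH (1 / 2) ξ ^ 2 ≤ (form β γ θ lam ξ ξ).re

/-- The graph of the operator `Γ^lam` in `L²(ℝ³)` associated to the form `Φ^lam` with domain
`H^{1/2}(ℝ³)`: `ξ ∈ 𝒟(Γ^lam)` and `Γ^lam ξ = g` mean that `ξ ∈ H^{1/2}(ℝ³)` and
`Φ^lam(η, ξ) = (η, g)` for every `η ∈ H^{1/2}(ℝ³)`. -/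
def GammaEq (β γ : ℝ) (θ : ℝ → ℝ) (lam : ℝ) (ξ g : L2) : Prop :=
  MemH (1 / 2) ξ ∧
    ∀ η : L2, MemH (1 / 2) η → form β γ θ lam η ξ = inner ℂ η g

end ThreeBoson

end

/-!
Write `u = φ̂` and `Q_k(u) = ∬ conj (u p) u(q) k(p, q) dp dq`. In momentum space multiplication by
`|y|⁻¹` is the kernel `(2π²)⁻¹ |p - q|⁻²` (`integral_invFourier_div_norm`), so that, up to the
diagonal part and the bounded Lipschitz potential `β + γ (θ(y) - 1) / |y|`, the form is
`π⁻² (γ / 2 · Q_C - Q_off)` with `C(p, q) = |p - q|⁻²` and `off(p, q) = (p² + q² + p·q + lam)⁻¹`.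

*The threshold `γ = 2`.* Both kernels are superpositions over `t > 0` of Gaussians,
`exp(-t |p - q|²)` and `exp(-t (p² + q² + p·q + lam))`. After removing the factors `exp(-t p²)`
and `exp(-t q²)` one compares the power series of `exp(2 t p·q)` and `exp(-t p·q)` in the positive
definite kernels `(p·q)^k`, and `2^k ≥ |(-1)^k|` gives `|Q_off| ≤ Q_C` (`norm_offDiag_le`). Hence
for `γ > 2` the form is bounded below by the diagonal part minus a bounded perturbation, which a
large `lam` absorbs (`exists_formCoercive`).

*The a priori estimate.* Test the form with `η = -Δφ` (`exists_form_laplacian_bound`).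
Symmetrizing `p²` to `(p² + q²) / 2` and using `p² + q² = |p - q|² + 2 p·q`, respectively
`p² + q² = (p² + q² + p·q + lam) - p·q - lam`, the nonlocal terms become
`(2π²)⁻¹ ((γ - 2) / 2 · |∫ u|² + ∑ᵢ (γ Q_C + Q_off)(pᵢ u) + lam Q_off(u))`. The first term, a
multiple of `|φ(0)|²`, and the sum are nonnegative; the last term and the contribution of the
Lipschitz potential, which is integrated by parts once through second differences
(`norm_integral_norm_sq_le`), are of order `‖φ‖²` in `H¹`. Together with coercivity in `H^(1/2)`
this gives a bound from below by `‖φ‖²` in `H^(3/2)` for the test functions `(M - Δ)φ` with `M`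
large (`exists_shifted_coercive`).

*Existence and uniqueness.* The a priori estimate is known only for `φ` with compactly supported
`φ̂`, whereas the solution `ξ` is not known to be regular. Lions' representation theorem
(`exists_inner_eq_of_norm_le`) turns it into the existence of some solution in `H^(3/2)` of the
weak equation, with a bound by the `H^(1/2)` norm of the right-hand side
(`exists_regular_solution`). By coercivity the weak solution in `H^(1/2)` is unique, so it is `ξ`.
-/

open scoped FourierTransform ComplexConjugate
open MeasureTheory

noncomputable section

namespace ThreeBoson

/-! ### The Schur test for the Coulomb kernel -/

/-- The surface area `4π` of the unit sphere, written as three times the volume of the ball. -/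
def sphereArea : ℝ := 3 * (volume : Measure E3).real (Metric.ball 0 1)

lemma sphereArea_nonneg : 0 ≤ sphereArea := by unfold sphereArea; positivity

lemma lintegral_fun_norm {f : ℝ → ℝ} (hf0 : ∀ r, 0 ≤ f r)
    (hf : IntegrableOn (fun r => r ^ 2 * f r) (Set.Ioi 0)) :
    ∫⁻ q : E3, ENNReal.ofReal (f ‖q‖)
      = ENNReal.ofReal (sphereArea * ∫ r in Set.Ioi (0 : ℝ), r ^ 2 * f r) := by
  have h1 : Integrable (fun q : E3 => f ‖q‖) := by
    rw [integrable_fun_norm_addHaar]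
    simpa using hf
  rw [← ofReal_integral_eq_lintegral_ofReal h1 (Filter.Eventually.of_forall fun q => hf0 _),
    integral_fun_norm_addHaar]
  simp [sphereArea, mul_assoc]

lemma lintegral_ball_inv_sq {a : ℝ} (ha : 0 < a) :
    ∫⁻ q : E3, ENNReal.ofReal ((Set.Iic a).indicator (fun s => (s ^ 2)⁻¹) ‖q‖)
      = ENNReal.ofReal (sphereArea * a) := by
  have key : Set.EqOn (fun r : ℝ => r ^ 2 * (Set.Iic a).indicator (fun s => (s ^ 2)⁻¹) r)
      ((Set.Iic a).indicator fun _ => 1) (Set.Ioi 0) := by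
    intro r hr
    have : r ≠ 0 := ne_of_gt hr
    by_cases h : r ∈ Set.Iic a
    · simp [Set.indicator_of_mem h, this]
    · simp [Set.indicator_of_notMem h]
  have h0 : IntegrableOn ((Set.Iic a).indicator fun _ => (1 : ℝ)) (Set.Ioi 0) := by
    rw [IntegrableOn, integrable_indicator_iff measurableSet_Iic, IntegrableOn,
      Measure.restrict_restrict measurableSet_Iic]
    apply integrableOn_const
    · rw [Set.Iic_inter_Ioi]; simp
    · simp
  rw [lintegral_fun_norm]
  · rw [setIntegral_congr_fun measurableSet_Ioi key, integral_indicator measurableSet_Iic,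
      Measure.restrict_restrict measurableSet_Iic, Set.Iic_inter_Ioi]
    simp [ha.le]
  · intro r
    exact Set.indicator_nonneg (fun s _ => by positivity) r
  · exact h0.congr_fun key.symm measurableSet_Ioi

lemma lintegral_compl_ball_inv_pow_four {a : ℝ} (ha : 0 < a) :
    ∫⁻ q : E3, ENNReal.ofReal ((Set.Ioi a).indicator (fun s => (s ^ 4)⁻¹) ‖q‖)
      = ENNReal.ofReal (sphereArea * a⁻¹) := by
  have key : Set.EqOn (fun r : ℝ => r ^ 2 * (Set.Ioi a).indicator (fun s => (s ^ 4)⁻¹) r)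
      ((Set.Ioi a).indicator fun r => r ^ (-2 : ℝ)) (Set.Ioi 0) := by
    intro r hr
    have h0 : 0 < r := hr
    by_cases h : r ∈ Set.Ioi a
    · simp only [Set.indicator_of_mem h]
      rw [Real.rpow_neg h0.le]
      norm_cast
      field_simp
    · simp [Set.indicator_of_notMem h]
  have hI : Set.Ioi a ∩ Set.Ioi 0 = Set.Ioi a := by
    rw [Set.Ioi_inter_Ioi, max_eq_left ha.le]
  have h0 : IntegrableOn ((Set.Ioi a).indicator fun r => r ^ (-2 : ℝ)) (Set.Ioi 0) := by
    rw [IntegrableOn, integrable_indicator_iff measurableSet_Ioi, IntegrableOn,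
      Measure.restrict_restrict measurableSet_Ioi, hI]
    exact integrableOn_Ioi_rpow_of_lt (by norm_num) ha
  rw [lintegral_fun_norm]
  · rw [setIntegral_congr_fun measurableSet_Ioi key, integral_indicator measurableSet_Ioi,
      Measure.restrict_restrict measurableSet_Ioi, hI, integral_Ioi_rpow_of_lt (by norm_num) ha]
    norm_num [Real.rpow_neg_one]
  · intro r
    exact Set.indicator_nonneg (fun s _ => by positivity) r
  · exact h0.congr_fun key.symm measurableSet_Ioi

/-- The convolution `|·|⁻² * |·|⁻²` on `ℝ³` is bounded by a multiple of `|·|⁻¹`. -/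
lemma lintegral_inv_sq_mul_inv_sq_le (p : E3) (hp : p ≠ 0) :
    ∫⁻ q : E3, ENNReal.ofReal ((‖p - q‖ ^ 2)⁻¹ * (‖q‖ ^ 2)⁻¹)
      ≤ ENNReal.ofReal (22 * sphereArea * ‖p‖⁻¹) := by
  have hr : 0 < ‖p‖ := norm_pos_iff.2 hp
  set r := ‖p‖ with hrdef
  -- far from the origin the kernel is at most `4 |q|⁻⁴`; otherwise one of the two factors is at
  -- most `4 / r²` and the other one is integrated over a ball
  set f₁ : ℝ → ℝ := (Set.Ioi (2 * r)).indicator fun s => (s ^ 4)⁻¹ with hf₁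
  set f₂ : ℝ → ℝ := (Set.Iic (3 * r)).indicator fun s => (s ^ 2)⁻¹ with hf₂
  set f₃ : ℝ → ℝ := (Set.Iic (2 * r)).indicator fun s => (s ^ 2)⁻¹ with hf₃
  have n₁ : ∀ s, 0 ≤ f₁ s := fun s => Set.indicator_nonneg (fun s _ => by positivity) s
  have n₂ : ∀ s, 0 ≤ f₂ s := fun s => Set.indicator_nonneg (fun s _ => by positivity) s
  have n₃ : ∀ s, 0 ≤ f₃ s := fun s => Set.indicator_nonneg (fun s _ => by positivity) s
  have m₁ : Measurable f₁ := Measurable.indicator (by fun_prop) measurableSet_Ioi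
  have m₂ : Measurable f₂ := Measurable.indicator (by fun_prop) measurableSet_Iic
  have m₃ : Measurable f₃ := Measurable.indicator (by fun_prop) measurableSet_Iic
  have pw : ∀ q : E3, (‖p - q‖ ^ 2)⁻¹ * (‖q‖ ^ 2)⁻¹
      ≤ 4 * f₁ ‖q‖ + ((4 / r ^ 2) * f₂ ‖p - q‖ + (4 / r ^ 2) * f₃ ‖q‖) := by
    intro q
    have t1 : r ≤ ‖p - q‖ + ‖q‖ := by
      have := norm_add_le (p - q) q
      simpa [hrdef] using this
    have t2 : ‖p - q‖ ≤ r + ‖q‖ := norm_sub_le _ _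
    have t3 : ‖q‖ ≤ r + ‖p - q‖ := by
      have := norm_sub_le p (p - q)
      simpa [hrdef] using this
    have hq0 := norm_nonneg q
    have hpq0 := norm_nonneg (p - q)
    by_cases h : 2 * r < ‖q‖
    · have e1 : f₁ ‖q‖ = (‖q‖ ^ 4)⁻¹ := Set.indicator_of_mem (s := Set.Ioi (2 * r)) h _
      have : (‖p - q‖ ^ 2)⁻¹ ≤ 4 * (‖q‖ ^ 2)⁻¹ := by
        have h2 : ‖q‖ / 2 ≤ ‖p - q‖ := by linarith
        have h3 : 0 < ‖q‖ / 2 := by linarith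
        calc (‖p - q‖ ^ 2)⁻¹ ≤ ((‖q‖ / 2) ^ 2)⁻¹ := by gcongr
          _ = 4 * (‖q‖ ^ 2)⁻¹ := by field_simp; norm_num
      have h4 : (‖p - q‖ ^ 2)⁻¹ * (‖q‖ ^ 2)⁻¹ ≤ 4 * f₁ ‖q‖ := by
        rw [e1]
        calc (‖p - q‖ ^ 2)⁻¹ * (‖q‖ ^ 2)⁻¹ ≤ (4 * (‖q‖ ^ 2)⁻¹) * (‖q‖ ^ 2)⁻¹ := by gcongr
          _ = 4 * (‖q‖ ^ 4)⁻¹ := by rw [mul_assoc, ← mul_inv]; ring_nf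
      have := n₂ ‖p - q‖
      have := n₃ ‖q‖
      have : 0 ≤ (4 / r ^ 2) * f₂ ‖p - q‖ + (4 / r ^ 2) * f₃ ‖q‖ := by positivity
      linarith
    · have e2 : f₂ ‖p - q‖ = (‖p - q‖ ^ 2)⁻¹ :=
        Set.indicator_of_mem (s := Set.Iic (3 * r)) (show ‖p - q‖ ≤ 3 * r by linarith) _
      have e3 : f₃ ‖q‖ = (‖q‖ ^ 2)⁻¹ :=
        Set.indicator_of_mem (s := Set.Iic (2 * r)) (show ‖q‖ ≤ 2 * r by linarith) _
      have e4 : ((r / 2) ^ 2)⁻¹ = 4 / r ^ 2 := by field_simp; norm_num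
      have hA : 0 ≤ (‖p - q‖ ^ 2)⁻¹ := by positivity
      have hB : 0 ≤ (‖q‖ ^ 2)⁻¹ := by positivity
      have hc : 0 ≤ 4 / r ^ 2 := by positivity
      have := n₁ ‖q‖
      rw [e2, e3]
      rcases le_total (r / 2) ‖q‖ with h2 | h2
      · have : (‖q‖ ^ 2)⁻¹ ≤ 4 / r ^ 2 := by rw [← e4]; gcongr
        nlinarith [mul_le_mul_of_nonneg_left this hA, mul_nonneg hc hB]
      · have : (‖p - q‖ ^ 2)⁻¹ ≤ 4 / r ^ 2 := by
          rw [← e4]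
          have : r / 2 ≤ ‖p - q‖ := by linarith
          gcongr
        nlinarith [mul_le_mul_of_nonneg_right this hB, mul_nonneg hc hA]
  calc ∫⁻ q : E3, ENNReal.ofReal ((‖p - q‖ ^ 2)⁻¹ * (‖q‖ ^ 2)⁻¹)
      ≤ ∫⁻ q : E3, (ENNReal.ofReal 4 * ENNReal.ofReal (f₁ ‖q‖) +
          (ENNReal.ofReal (4 / r ^ 2) * ENNReal.ofReal (f₂ ‖p - q‖)
            + ENNReal.ofReal (4 / r ^ 2) * ENNReal.ofReal (f₃ ‖q‖))) := by
        refine lintegral_mono fun q => ?_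
        refine (ENNReal.ofReal_le_ofReal (pw q)).trans ?_
        refine ENNReal.ofReal_add_le.trans (add_le_add ?_ (ENNReal.ofReal_add_le.trans ?_))
        · rw [ENNReal.ofReal_mul (by norm_num)]
        · rw [ENNReal.ofReal_mul (by positivity), ENNReal.ofReal_mul (by positivity)]
    _ = ENNReal.ofReal 4 * ENNReal.ofReal (sphereArea * (2 * r)⁻¹) +
          (ENNReal.ofReal (4 / r ^ 2) * ENNReal.ofReal (sphereArea * (3 * r))
            + ENNReal.ofReal (4 / r ^ 2) * ENNReal.ofReal (sphereArea * (2 * r))) := by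
        rw [lintegral_add_left (by fun_prop), lintegral_add_left (by fun_prop),
          lintegral_const_mul _ (by fun_prop), lintegral_const_mul _ (by fun_prop),
          lintegral_const_mul _ (by fun_prop),
          lintegral_sub_left_eq_self (fun q => ENNReal.ofReal (f₂ ‖q‖)) p,
          lintegral_compl_ball_inv_pow_four (by positivity),
          lintegral_ball_inv_sq (by positivity), lintegral_ball_inv_sq (by positivity)]
    _ = ENNReal.ofReal (22 * sphereArea * ‖p‖⁻¹) := by
        have := sphereArea_nonneg
        rw [← ENNReal.ofReal_mul (by norm_num), ← ENNReal.ofReal_mul (by positivity),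
          ← ENNReal.ofReal_mul (by positivity), ← ENNReal.ofReal_add (by positivity) (by positivity),
          ← ENNReal.ofReal_add (by positivity) (by positivity)]
        congr 1
        field_simp
        ring

/-- A Schur test for the kernel `|p - q|⁻²` of multiplication by `|y|⁻¹`: it is bounded on the
space with weight `|p|`. -/
lemma lintegral_schur {u v : E3 → ℝ} (hu : AEMeasurable u) (hv : AEMeasurable v) :
    ∫⁻ z : E3 × E3, ENNReal.ofReal (|u z.1| * |v z.2| * (‖z.1 - z.2‖ ^ 2)⁻¹)
      ≤ ENNReal.ofReal (11 * sphereArea) *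
        ((∫⁻ p, ENNReal.ofReal (‖p‖ * u p ^ 2)) + ∫⁻ p, ENNReal.ofReal (‖p‖ * v p ^ 2)) := by
  have hae : ∀ᵐ p : E3, p ≠ 0 := by
    simp [ae_iff, measure_singleton]
  have hae1 : ∀ᵐ z : E3 × E3, z.1 ≠ 0 := Measure.quasiMeasurePreserving_fst.ae hae
  have hae2 : ∀ᵐ z : E3 × E3, z.2 ≠ 0 := Measure.quasiMeasurePreserving_snd.ae hae
  have mu : AEMeasurable (fun z : E3 × E3 => u z.1) :=
    hu.comp_quasiMeasurePreserving Measure.quasiMeasurePreserving_fst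
  have mv : AEMeasurable (fun z : E3 × E3 => v z.2) :=
    hv.comp_quasiMeasurePreserving Measure.quasiMeasurePreserving_snd
  -- the weight `|p| / |q|` in the arithmetic-geometric mean inequality
  set F : E3 × E3 → ℝ := fun z =>
    2⁻¹ * ((‖z.1‖ * u z.1) ^ 2 * ((‖z.1 - z.2‖ ^ 2)⁻¹ * (‖z.2‖ ^ 2)⁻¹)) with hF
  set G : E3 × E3 → ℝ := fun z =>
    2⁻¹ * ((‖z.2‖ * v z.2) ^ 2 * ((‖z.2 - z.1‖ ^ 2)⁻¹ * (‖z.1‖ ^ 2)⁻¹)) with hG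
  have half : ∀ w : E3 → ℝ, AEMeasurable w →
      ∫⁻ p, ∫⁻ q, ENNReal.ofReal
        (2⁻¹ * ((‖p‖ * w p) ^ 2 * ((‖p - q‖ ^ 2)⁻¹ * (‖q‖ ^ 2)⁻¹)))
      ≤ ENNReal.ofReal (11 * sphereArea) * ∫⁻ p, ENNReal.ofReal (‖p‖ * w p ^ 2) := by
    intro w hw
    rw [← lintegral_const_mul' _ _ ENNReal.ofReal_ne_top]
    refine lintegral_mono_ae ?_
    filter_upwards [hae] with p hp
    have hp' : 0 < ‖p‖ := norm_pos_iff.2 hp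
    calc ∫⁻ q, ENNReal.ofReal (2⁻¹ * ((‖p‖ * w p) ^ 2 * ((‖p - q‖ ^ 2)⁻¹ * (‖q‖ ^ 2)⁻¹)))
        = ∫⁻ q, ENNReal.ofReal (2⁻¹ * (‖p‖ * w p) ^ 2) *
            ENNReal.ofReal ((‖p - q‖ ^ 2)⁻¹ * (‖q‖ ^ 2)⁻¹) := by
          refine lintegral_congr fun q => ?_
          rw [← ENNReal.ofReal_mul (by positivity), mul_assoc]
      _ ≤ ENNReal.ofReal (2⁻¹ * (‖p‖ * w p) ^ 2) * ENNReal.ofReal (22 * sphereArea * ‖p‖⁻¹) := by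
          rw [lintegral_const_mul' _ _ ENNReal.ofReal_ne_top]
          gcongr
          exact lintegral_inv_sq_mul_inv_sq_le p hp
      _ = ENNReal.ofReal (11 * sphereArea) * ENNReal.ofReal (‖p‖ * w p ^ 2) := by
          have := sphereArea_nonneg
          rw [← ENNReal.ofReal_mul (by positivity), ← ENNReal.ofReal_mul (by positivity)]
          congr 1
          field_simp
          ring
  calc ∫⁻ z : E3 × E3, ENNReal.ofReal (|u z.1| * |v z.2| * (‖z.1 - z.2‖ ^ 2)⁻¹)
      ≤ ∫⁻ z, (ENNReal.ofReal (F z) + ENNReal.ofReal (G z)) := by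
        refine lintegral_mono_ae ?_
        filter_upwards [hae1, hae2] with z h1 h2
        rw [← ENNReal.ofReal_add (by positivity) (by positivity)]
        refine ENNReal.ofReal_le_ofReal ?_
        have h1' : 0 < ‖z.1‖ := norm_pos_iff.2 h1
        have h2' : 0 < ‖z.2‖ := norm_pos_iff.2 h2
        have hk : 0 ≤ (‖z.1 - z.2‖ ^ 2)⁻¹ := by positivity
        have amgm : |u z.1| * |v z.2| ≤
            2⁻¹ * ((‖z.1‖ * u z.1) ^ 2 * (‖z.2‖ ^ 2)⁻¹)
              + 2⁻¹ * ((‖z.2‖ * v z.2) ^ 2 * (‖z.1‖ ^ 2)⁻¹) := by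
          have := two_mul_le_add_sq (‖z.1‖ * |u z.1| * ‖z.2‖⁻¹) (‖z.2‖ * |v z.2| * ‖z.1‖⁻¹)
          have e : 2 * (‖z.1‖ * |u z.1| * ‖z.2‖⁻¹) * (‖z.2‖ * |v z.2| * ‖z.1‖⁻¹)
              = 2 * (|u z.1| * |v z.2|) := by field_simp
          rw [e] at this
          simp only [mul_pow, sq_abs, inv_pow] at this ⊢
          linarith
        have := mul_le_mul_of_nonneg_right amgm hk
        simp only [hF, hG]
        rw [norm_sub_rev z.2 z.1]
        linarith
    _ = (∫⁻ z, ENNReal.ofReal (F z)) + ∫⁻ z, ENNReal.ofReal (G z) :=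
        lintegral_add_left' (by fun_prop) _
    _ ≤ ENNReal.ofReal (11 * sphereArea) * (∫⁻ p, ENNReal.ofReal (‖p‖ * u p ^ 2))
        + ENNReal.ofReal (11 * sphereArea) * ∫⁻ p, ENNReal.ofReal (‖p‖ * v p ^ 2) := by
        refine add_le_add ?_ ?_
        · rw [Measure.volume_eq_prod, lintegral_prod _ (by
            rw [← Measure.volume_eq_prod]; fun_prop)]
          exact half u hu
        · rw [Measure.volume_eq_prod, lintegral_prod_symm _ (by
            rw [← Measure.volume_eq_prod]; fun_prop)]
          exact half v hv
    _ = _ := by rw [mul_add]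

/-! ### Gaussian superposition and test functions -/

section Superposition

variable {X : Type*} [MeasurableSpace X] {μ : Measure X} [SFinite μ] {k : X → ℝ → ℝ} {K : X → ℝ}

lemma lintegral_superposition {f : X → ENNReal} (hf : AEMeasurable f μ)
    (hk : Measurable (Function.uncurry k))
    (hkK : ∀ᵐ x ∂μ, ∫⁻ t in Set.Ioi (0 : ℝ), ENNReal.ofReal (k x t) = ENNReal.ofReal (K x)) :
    ∫⁻ x, f x * ENNReal.ofReal (K x) ∂μ
      = ∫⁻ t in Set.Ioi (0 : ℝ), ∫⁻ x, f x * ENNReal.ofReal (k x t) ∂μ := by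
  have hk' : ∀ x, Measurable (k x) := fun x => hk.comp measurable_prodMk_left
  rw [lintegral_lintegral_swap]
  · refine lintegral_congr_ae ?_
    filter_upwards [hkK] with x hx
    rw [← hx, lintegral_const_mul _ (hk' x).ennreal_ofReal]
  · have h1 : AEMeasurable (fun z : ℝ × X => f z.2) ((volume.restrict (Set.Ioi 0)).prod μ) :=
      hf.comp_quasiMeasurePreserving Measure.quasiMeasurePreserving_snd
    exact h1.mul ((hk.comp measurable_swap).ennreal_ofReal.aemeasurable)

/-- Fubini's theorem for a positive kernel `K` which is a superposition `∫₀^∞ k(·, t) dt` of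
positive kernels. -/
lemma integral_superposition {F : X → ℂ} (hF : AEStronglyMeasurable F μ)
    (hk : Measurable (Function.uncurry k)) (k0 : ∀ x t, 0 < t → 0 ≤ k x t) (K0 : ∀ x, 0 ≤ K x)
    (hkK : ∀ᵐ x ∂μ, ∫⁻ t in Set.Ioi (0 : ℝ), ENNReal.ofReal (k x t) = ENNReal.ofReal (K x))
    (hint : Integrable (fun x => F x * (K x : ℂ)) μ) :
    Integrable (fun z : ℝ × X => F z.2 * (k z.2 z.1 : ℂ)) ((volume.restrict (Set.Ioi 0)).prod μ) ∧
    ∫ x, F x * (K x : ℂ) ∂μ = ∫ t in Set.Ioi (0 : ℝ), ∫ x, F x * (k x t : ℂ) ∂μ := by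
  have hm : AEStronglyMeasurable (fun z : ℝ × X => F z.2 * (k z.2 z.1 : ℂ))
      ((volume.restrict (Set.Ioi 0)).prod μ) :=
    (hF.comp_quasiMeasurePreserving Measure.quasiMeasurePreserving_snd).mul
      (Complex.measurable_ofReal.comp (hk.comp measurable_swap)).aestronglyMeasurable
  have henn : ∀ (a : ℂ) (b : ℝ), 0 ≤ b → ‖a * (b : ℂ)‖ₑ = ‖a‖ₑ * ENNReal.ofReal b := by
    intro a b hb
    rw [enorm_mul, ← ofReal_norm (b : ℂ), Complex.norm_real, Real.norm_of_nonneg hb]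
  have h1 : Integrable (fun z : ℝ × X => F z.2 * (k z.2 z.1 : ℂ))
      ((volume.restrict (Set.Ioi 0)).prod μ) := by
    refine ⟨hm, ?_⟩
    rw [HasFiniteIntegral, lintegral_prod _ hm.enorm]
    have := lintegral_superposition (μ := μ) hF.enorm hk hkK
    have h3 : ∀ t ∈ Set.Ioi (0 : ℝ), ∫⁻ x, ‖F x * (k x t : ℂ)‖ₑ ∂μ
        = ∫⁻ x, ‖F x‖ₑ * ENNReal.ofReal (k x t) ∂μ :=
      fun t ht => lintegral_congr fun x => henn _ _ (k0 x t ht)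
    rw [setLIntegral_congr_fun measurableSet_Ioi h3, ← this]
    have h2 := hint.2
    simp only [HasFiniteIntegral, henn _ _ (K0 _)] at h2
    exact h2
  refine ⟨h1, ?_⟩
  rw [integral_integral_swap h1]
  refine integral_congr_ae ?_
  filter_upwards [hkK] with x hx
  rw [integral_const_mul, integral_complex_ofReal,
    integral_eq_lintegral_of_nonneg_ae ((ae_restrict_iff' measurableSet_Ioi).2
      (Filter.Eventually.of_forall fun t ht => k0 x t ht))
      (hk.comp measurable_prodMk_left).aestronglyMeasurable]
  rw [hx, ENNReal.toReal_ofReal (K0 x)]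

end Superposition

lemma lintegral_exp_neg_mul {s : ℝ} (hs : 0 < s) :
    ∫⁻ t in Set.Ioi (0 : ℝ), ENNReal.ofReal (Real.exp (-(s * t))) = ENNReal.ofReal s⁻¹ := by
  have h : -s < 0 := by linarith
  have h1 : IntegrableOn (fun t => Real.exp (-(s * t))) (Set.Ioi 0) := by
    simpa using integrableOn_exp_mul_Ioi h 0
  rw [← ofReal_integral_eq_lintegral_ofReal h1
    (Filter.Eventually.of_forall fun t => (Real.exp_pos _).le)]
  have h2 := integral_exp_mul_Ioi h 0
  simp only [neg_mul, mul_zero, Real.exp_zero] at h2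
  rw [h2]
  congr 1
  field_simp

/-- The heat kernel of `ℝ³` at time `t`, as a function of the distance `r`. -/
def heatKernel (t r : ℝ) : ℝ := (4 * Real.pi * t) ^ (-(3 / 2) : ℝ) * Real.exp (-(r ^ 2 / (4 * t)))

lemma heatKernel_nonneg {t : ℝ} (ht : 0 < t) (r : ℝ) : 0 ≤ heatKernel t r := by
  unfold heatKernel; positivity

/-- The time integral of the heat kernel is the Newtonian potential. -/
lemma lintegral_heatKernel {r : ℝ} (hr : 0 < r) :
    ∫⁻ t in Set.Ioi (0 : ℝ), ENNReal.ofReal (heatKernel t r)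
      = ENNReal.ofReal ((4 * Real.pi)⁻¹ * r⁻¹) := by
  have hpi := Real.pi_pos
  have h1 : ∫ t in Set.Ioi (0 : ℝ), heatKernel t r = (4 * Real.pi)⁻¹ * r⁻¹ := by
    have e := integral_comp_rpow_Ioi
      (fun s : ℝ => s ^ ((1 / 2 : ℝ) - 1) * Real.exp (-(r ^ 2 / 4 * s))) (p := -1) (by norm_num)
    rw [Real.integral_rpow_mul_exp_neg_mul_Ioi (by norm_num) (by positivity),
      Real.Gamma_one_half_eq] at e
    have e2 : ∀ t ∈ Set.Ioi (0 : ℝ), heatKernel t r = (4 * Real.pi) ^ (-(3 / 2) : ℝ) *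
        ((|(-1 : ℝ)| * t ^ ((-1 : ℝ) - 1)) • ((t ^ (-1 : ℝ)) ^ ((1 / 2 : ℝ) - 1)
          * Real.exp (-(r ^ 2 / 4 * t ^ (-1 : ℝ))))) := by
      intro t ht
      have ht0 : (0 : ℝ) < t := ht
      rw [heatKernel, Real.mul_rpow (by positivity) ht0.le, ← Real.rpow_mul ht0.le, smul_eq_mul]
      have : t ^ (-(3 / 2) : ℝ) = |(-1 : ℝ)| * t ^ ((-1 : ℝ) - 1) * t ^ ((-1 : ℝ) * (1 / 2 - 1)) := by
        rw [abs_neg, abs_one, one_mul, ← Real.rpow_add ht0]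
        norm_num
      rw [this, Real.rpow_neg_one t]
      have : r ^ 2 / (4 * t) = r ^ 2 / 4 * t⁻¹ := by field_simp
      rw [this]
      ring
    rw [setIntegral_congr_fun measurableSet_Ioi e2, integral_const_mul, e]
    have e3 : (1 / (r ^ 2 / 4)) ^ (1 / 2 : ℝ) = 2 * r⁻¹ := by
      rw [← Real.sqrt_eq_rpow]
      have : 1 / (r ^ 2 / 4) = (2 * r⁻¹) ^ 2 := by field_simp; norm_num
      rw [this, Real.sqrt_sq (by positivity)]
    have e4 : (4 * Real.pi) ^ (-(3 / 2) : ℝ) = (4 * Real.pi)⁻¹ * (2 * Real.sqrt Real.pi)⁻¹ := by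
      have : (-(3 / 2) : ℝ) = -1 + -(1 / 2) := by norm_num
      rw [this, Real.rpow_add (by positivity), Real.rpow_neg_one, Real.rpow_neg (by positivity),
        ← Real.sqrt_eq_rpow, Real.sqrt_mul (by norm_num)]
      congr 3
      rw [show (4 : ℝ) = 2 ^ 2 by norm_num, Real.sqrt_sq (by norm_num)]
    rw [e3, e4]
    have : Real.sqrt Real.pi ≠ 0 := by positivity
    field_simp
  have hI : IntegrableOn (fun t => heatKernel t r) (Set.Ioi 0) := by
    by_contra h
    have := integral_undef h
    rw [h1] at this
    have : 0 < (4 * Real.pi)⁻¹ * r⁻¹ := by positivity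
    linarith
  rw [← ofReal_integral_eq_lintegral_ofReal hI
    ((ae_restrict_iff' measurableSet_Ioi).2
      (Filter.Eventually.of_forall fun t ht => heatKernel_nonneg ht r)), h1]

/-- The test functions on the Fourier side: continuous with compact support. -/
structure IsTest (u : E3 → ℂ) : Prop where
  cont : Continuous u
  supp : HasCompactSupport u

namespace IsTest

variable {u v : E3 → ℂ}

lemma integrable (hu : IsTest u) : Integrable u := hu.cont.integrable_of_hasCompactSupport hu.supp

lemma memLp (hu : IsTest u) (p : ENNReal) : MemLp u p :=
  hu.cont.memLp_of_hasCompactSupport hu.supp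

lemma continuous_mul (hu : IsTest u) {f : E3 → ℂ} (hf : Continuous f) :
    IsTest (fun p => f p * u p) :=
  ⟨hf.mul hu.cont, hu.supp.mul_left⟩

lemma integrable_weight (hu : IsTest u) {w : E3 → ℝ} (hw : Continuous w) :
    Integrable (fun p => w p * ‖u p‖ ^ 2) := by
  have hs : HasCompactSupport (fun p => w p * ‖u p‖ ^ 2) := by
    refine hu.supp.mono (Function.support_subset_iff'.2 fun p hp => ?_)
    have : u p = 0 := by simpa using hp
    simp [this]
  exact Continuous.integrable_of_hasCompactSupport
    (hw.mul (hu.cont.norm.pow 2)) hs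

protected lemma star (hu : IsTest u) : IsTest (fun p => conj (u p)) :=
  ⟨Complex.continuous_conj.comp hu.cont, hu.supp.comp_left (g := fun z : ℂ => conj z) (map_zero _)⟩

lemma integrable_prod (hu : IsTest u) (hv : IsTest v) :
    Integrable (fun z : E3 × E3 => conj (u z.1) * v z.2) := by
  exact hu.star.integrable.mul_prod hv.integrable

end IsTest

/-- The inverse Fourier transform `(2π)^(-3/2) ∫ exp(i p·y) u(p) dp` as an integral. -/
def invFourier (u : E3 → ℂ) (y : E3) : ℂ :=
  (((2 * Real.pi) ^ (-(3 / 2) : ℝ) : ℝ) : ℂ) *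
    ∫ p : E3, Complex.exp (Complex.I * (inner ℝ p y : ℝ)) * u p

lemma two_pi_rpow_sq :
    ((2 * Real.pi) ^ (-(3 / 2) : ℝ)) * ((2 * Real.pi) ^ (-(3 / 2) : ℝ)) = ((2 * Real.pi) ^ 3)⁻¹ := by
  have hpi := Real.pi_pos
  rw [← Real.rpow_add (by positivity), ← Real.rpow_natCast, ← Real.rpow_neg (by positivity)]
  norm_num

lemma conj_mul_self_eq (a : ℂ) : conj a * a = ((‖a‖ ^ 2 : ℝ) : ℂ) := by
  rw [mul_comm, Complex.mul_conj, Complex.normSq_eq_norm_sq]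

lemma norm_exp_I_mul (x : ℝ) : ‖Complex.exp (Complex.I * x)‖ = 1 := by
  rw [mul_comm]; exact Complex.norm_exp_ofReal_mul_I x

lemma continuous_invFourier {u : E3 → ℂ} (hu : Integrable u) : Continuous (invFourier u) := by
  unfold invFourier
  refine continuous_const.mul ?_
  refine continuous_of_dominated (bound := fun p => ‖u p‖) ?_ ?_ hu.norm ?_
  · intro y
    refine AEStronglyMeasurable.mul ?_ hu.1
    exact Continuous.aestronglyMeasurable (by fun_prop)
  · intro y
    refine Filter.Eventually.of_forall fun p => ?_
    rw [norm_mul, norm_exp_I_mul, one_mul]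
  · exact Filter.Eventually.of_forall fun p => by fun_prop

lemma norm_invFourier_le {u : E3 → ℂ} (y : E3) :
    ‖invFourier u y‖ ≤ (2 * Real.pi) ^ (-(3 / 2) : ℝ) * ∫ p, ‖u p‖ := by
  unfold invFourier
  have h0 : (0 : ℝ) ≤ (2 * Real.pi) ^ (-(3 / 2) : ℝ) := by have := Real.pi_pos; positivity
  rw [norm_mul, Complex.norm_real, Real.norm_of_nonneg h0]
  gcongr
  refine (norm_integral_le_integral_norm _).trans (le_of_eq ?_)
  refine integral_congr_ae (Filter.Eventually.of_forall fun p => ?_)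
  simp only [norm_mul, norm_exp_I_mul, one_mul]

lemma integral_gaussian_exp {t : ℝ} (ht : 0 < t) (w : E3) :
    ∫ y : E3, (heatKernel t ‖y‖ : ℂ) * Complex.exp (Complex.I * (inner ℝ w y : ℝ))
      = (Real.exp (-(‖w‖ ^ 2 * t)) : ℂ) := by
  have hpi := Real.pi_pos
  have hb : 0 < ((1 / (4 * t) : ℝ) : ℂ).re := by rw [Complex.ofReal_re]; positivity
  have h := GaussianFourier.integral_cexp_neg_mul_sq_norm_add (V := E3) hb Complex.I w
  have e1 : ∀ y : E3, (heatKernel t ‖y‖ : ℂ) * Complex.exp (Complex.I * (inner ℝ w y : ℝ))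
      = (((4 * Real.pi * t) ^ (-(3 / 2) : ℝ) : ℝ) : ℂ) *
        Complex.exp (-((1 / (4 * t) : ℝ) : ℂ) * (‖y‖ : ℂ) ^ 2
          + Complex.I * (inner ℝ w y : ℝ)) := by
    intro y
    rw [heatKernel, Complex.exp_add, Complex.ofReal_mul, Complex.ofReal_exp, mul_assoc]
    congr 3
    push_cast
    field_simp
  simp_rw [e1]
  rw [integral_const_mul, h]
  have e2 : ((Real.pi : ℂ) / ((1 / (4 * t) : ℝ) : ℂ)) ^ ((Module.finrank ℝ E3 : ℂ) / 2)
      = (((4 * Real.pi * t) ^ (3 / 2 : ℝ) : ℝ) : ℂ) := by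
    rw [Complex.ofReal_cpow (by positivity), ← Complex.ofReal_div]
    congr 1
    · congr 1; field_simp
    · simp
  rw [e2, ← mul_assoc, ← Complex.ofReal_mul, ← Real.rpow_add (by positivity)]
  norm_num
  congr 1
  field_simp

lemma ae_fst_ne_snd : ∀ᵐ z : E3 × E3, z.1 ≠ z.2 := by
  have hm : MeasurableSet {z : E3 × E3 | ¬ z.1 ≠ z.2} := by
    simp only [ne_eq, not_not]
    exact measurableSet_eq_fun measurable_fst measurable_snd
  rw [ae_iff, Measure.volume_eq_prod, Measure.measure_prod_null hm]
  refine Filter.Eventually.of_forall fun p => ?_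
  have : (Prod.mk p ⁻¹' {z : E3 × E3 | ¬ z.1 ≠ z.2}) = {p} := by
    ext q; simp [eq_comm]
  simp only [this]
  simp

/-- Fubini's theorem and the Fourier transform of the Gaussian. -/
lemma integral_heatKernel_invFourier {t : ℝ} (ht : 0 < t) {u v : E3 → ℂ} (hu : IsTest u)
    (hv : IsTest v) :
    ∫ y : E3, conj (invFourier u y) * invFourier v y * (heatKernel t ‖y‖ : ℂ)
      = (((2 * Real.pi) ^ 3)⁻¹ : ℝ) * ∫ z : E3 × E3, conj (u z.1) * v z.2 *
          (Real.exp (-(‖z.1 - z.2‖ ^ 2 * t)) : ℂ) := by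
  have hpi := Real.pi_pos
  have hc : (((2 * Real.pi) ^ (-(3 / 2) : ℝ) : ℝ) : ℂ) * (((2 * Real.pi) ^ (-(3 / 2) : ℝ) : ℝ) : ℂ)
      = (((2 * Real.pi) ^ 3)⁻¹ : ℝ) := by
    rw [← Complex.ofReal_mul, two_pi_rpow_sq]
  have e1 : ∀ y : E3, conj (invFourier u y) * invFourier v y = (((2 * Real.pi) ^ 3)⁻¹ : ℝ) *
      ∫ z : E3 × E3, conj (u z.1) * v z.2 *
        Complex.exp (Complex.I * (inner ℝ (z.2 - z.1) y : ℝ)) := by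
    intro y
    rw [invFourier, invFourier, map_mul, Complex.conj_ofReal, ← integral_conj, mul_mul_mul_comm, hc,
      ← integral_prod_mul, ← Measure.volume_eq_prod]
    congr 1
    refine integral_congr_ae (Filter.Eventually.of_forall fun z => ?_)
    simp only [map_mul, ← Complex.exp_conj, Complex.conj_I, Complex.conj_ofReal, inner_sub_left,
      Complex.ofReal_sub]
    rw [mul_sub, sub_eq_neg_add, Complex.exp_add]
    ring_nf
  simp_rw [e1]
  have hk : Integrable (fun y : E3 => (heatKernel t ‖y‖ : ℂ)) := by
    have hb : 0 < ((1 / (4 * t) : ℝ) : ℂ).re := by rw [Complex.ofReal_re]; positivity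
    have h := (GaussianFourier.integrable_cexp_neg_mul_sq_norm_add (V := E3) hb 0 0).const_mul
      (((4 * Real.pi * t) ^ (-(3 / 2) : ℝ) : ℝ) : ℂ)
    refine h.congr (Filter.Eventually.of_forall fun y => ?_)
    simp only [heatKernel, Complex.ofReal_mul, Complex.ofReal_exp, zero_mul, add_zero]
    congr 2
    push_cast
    field_simp
  have hP := hk.mul_prod (hu.integrable_prod hv)
  have hI : Integrable (Function.uncurry fun (y : E3) (z : E3 × E3) =>
      conj (u z.1) * v z.2 * Complex.exp (Complex.I * (inner ℝ (z.2 - z.1) y : ℝ))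
        * (heatKernel t ‖y‖ : ℂ)) (volume.prod volume) := by
    refine hP.mono ?_ (Filter.Eventually.of_forall fun x => ?_)
    · have h1 : AEStronglyMeasurable (fun x : E3 × (E3 × E3) =>
          Complex.exp (Complex.I * (inner ℝ (x.2.2 - x.2.1) x.1 : ℝ))) (volume.prod volume) :=
        Continuous.aestronglyMeasurable (by fun_prop)
      refine (h1.mul hP.1).congr (Filter.Eventually.of_forall fun x => ?_)
      simp only [Function.uncurry, Pi.mul_apply]
      ring
    · simp only [Function.uncurry, norm_mul, norm_exp_I_mul]
      apply le_of_eq; ring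
  calc ∫ y : E3, ((((2 * Real.pi) ^ 3)⁻¹ : ℝ) : ℂ) * (∫ z : E3 × E3, conj (u z.1) * v z.2 *
        Complex.exp (Complex.I * (inner ℝ (z.2 - z.1) y : ℝ))) * (heatKernel t ‖y‖ : ℂ)
      = ((((2 * Real.pi) ^ 3)⁻¹ : ℝ) : ℂ) * ∫ y : E3, ∫ z : E3 × E3, conj (u z.1) * v z.2 *
        Complex.exp (Complex.I * (inner ℝ (z.2 - z.1) y : ℝ)) * (heatKernel t ‖y‖ : ℂ) := by
        rw [← integral_const_mul]
        refine integral_congr_ae (Filter.Eventually.of_forall fun y => ?_)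
        simp only
        rw [integral_mul_const, mul_assoc]
    _ = _ := by
        rw [integral_integral_swap hI]
        congr 1
        refine integral_congr_ae (Filter.Eventually.of_forall fun z => ?_)
        simp only
        have := integral_gaussian_exp ht (z.2 - z.1)
        rw [norm_sub_rev] at this
        rw [← this, ← integral_const_mul]
        refine integral_congr_ae (Filter.Eventually.of_forall fun y => ?_)
        simp only
        ring

/-! ### Kato's inequality and the Coulomb potential in momentum space -/

/-- The Coulomb kernel `|p - q|⁻²` paired with two functions is absolutely integrable on the space
with weight `|p|`. -/
lemma integrable_coulomb {u v : E3 → ℂ} (hu : AEStronglyMeasurable u) (hv : AEStronglyMeasurable v)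
    (iu : Integrable fun p => ‖p‖ * ‖u p‖ ^ 2) (iv : Integrable fun p => ‖p‖ * ‖v p‖ ^ 2) :
    Integrable (fun z : E3 × E3 => conj (u z.1) * v z.2 * (((‖z.1 - z.2‖ ^ 2)⁻¹ : ℝ) : ℂ)) ∧
    ∫ z : E3 × E3, ‖conj (u z.1) * v z.2 * (((‖z.1 - z.2‖ ^ 2)⁻¹ : ℝ) : ℂ)‖
      ≤ 11 * sphereArea * ((∫ p, ‖p‖ * ‖u p‖ ^ 2) + ∫ p, ‖p‖ * ‖v p‖ ^ 2) := by
  have hS := sphereArea_nonneg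
  have hn : ∀ z : E3 × E3, ‖conj (u z.1) * v z.2 * (((‖z.1 - z.2‖ ^ 2)⁻¹ : ℝ) : ℂ)‖
      = |‖u z.1‖| * |‖v z.2‖| * (‖z.1 - z.2‖ ^ 2)⁻¹ := by
    intro z
    rw [norm_mul, norm_mul, Complex.norm_real, RCLike.norm_conj, abs_norm, abs_norm,
      Real.norm_of_nonneg (by positivity)]
  have hm : AEStronglyMeasurable
      (fun z : E3 × E3 => conj (u z.1) * v z.2 * (((‖z.1 - z.2‖ ^ 2)⁻¹ : ℝ) : ℂ)) := by
    have h1 : AEStronglyMeasurable (fun z : E3 × E3 => u z.1) :=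
      hu.comp_quasiMeasurePreserving Measure.quasiMeasurePreserving_fst
    have h2 : AEStronglyMeasurable (fun z : E3 × E3 => v z.2) :=
      hv.comp_quasiMeasurePreserving Measure.quasiMeasurePreserving_snd
    refine ((Complex.continuous_conj.comp_aestronglyMeasurable h1).mul h2).mul ?_
    exact (Complex.measurable_ofReal.comp (by fun_prop)).aestronglyMeasurable
  have hs := lintegral_schur hu.norm.aemeasurable hv.norm.aemeasurable
  rw [← ofReal_integral_eq_lintegral_ofReal iu
      (Filter.Eventually.of_forall fun p => by positivity),
    ← ofReal_integral_eq_lintegral_ofReal iv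
      (Filter.Eventually.of_forall fun p => by positivity),
    ← ENNReal.ofReal_add (by positivity) (by positivity), ← ENNReal.ofReal_mul (by positivity)] at hs
  have hl : ∫⁻ z : E3 × E3, ‖conj (u z.1) * v z.2 * (((‖z.1 - z.2‖ ^ 2)⁻¹ : ℝ) : ℂ)‖ₑ
      = ∫⁻ z : E3 × E3, ENNReal.ofReal (|‖u z.1‖| * |‖v z.2‖| * (‖z.1 - z.2‖ ^ 2)⁻¹) :=
    lintegral_congr fun z => by rw [← ofReal_norm, hn]
  rw [← hl] at hs
  refine ⟨⟨hm, lt_of_le_of_lt hs ENNReal.ofReal_lt_top⟩, ?_⟩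
  rw [integral_norm_eq_lintegral_enorm hm]
  exact ENNReal.toReal_le_of_le_ofReal (by positivity) hs

lemma IsTest.integrable_norm_weight {u : E3 → ℂ} (hu : IsTest u) :
    Integrable fun p => ‖p‖ * ‖u p‖ ^ 2 := hu.integrable_weight continuous_norm

lemma lintegral_exp_neg_ae : ∀ᵐ z : E3 × E3,
    ∫⁻ t in Set.Ioi (0 : ℝ), ENNReal.ofReal (Real.exp (-(‖z.1 - z.2‖ ^ 2 * t)))
      = ENNReal.ofReal (‖z.1 - z.2‖ ^ 2)⁻¹ := by
  filter_upwards [ae_fst_ne_snd] with z hz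
  have : 0 < ‖z.1 - z.2‖ := norm_pos_iff.2 (sub_ne_zero.2 hz)
  exact lintegral_exp_neg_mul (by positivity)

lemma lintegral_heatKernel_ae : ∀ᵐ y : E3,
    ∫⁻ t in Set.Ioi (0 : ℝ), ENNReal.ofReal (heatKernel t ‖y‖)
      = ENNReal.ofReal ((4 * Real.pi)⁻¹ * ‖y‖⁻¹) := by
  have hae : ∀ᵐ p : E3, p ≠ 0 := by simp [ae_iff, measure_singleton]
  filter_upwards [hae] with y hy
  exact lintegral_heatKernel (norm_pos_iff.2 hy)

lemma measurable_heatKernel : Measurable (Function.uncurry fun (y : E3) t => heatKernel t ‖y‖) := by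
  unfold heatKernel Function.uncurry
  fun_prop

/-- Kato's inequality `∫ |φ|² / |y| ≤ C ∫ |p| |φ̂|²` for the inverse Fourier transform of a test
function. -/
lemma lintegral_kato {u : E3 → ℂ} (hu : IsTest u) :
    ∫⁻ y, ‖invFourier u y‖ₑ ^ 2 * ENNReal.ofReal ‖y‖⁻¹
      ≤ ENNReal.ofReal (22 * sphereArea * ∫ p, ‖p‖ * ‖u p‖ ^ 2) := by
  have hpi := Real.pi_pos
  have hpi3 := Real.pi_gt_three
  have hS := sphereArea_nonneg
  have hcont := continuous_invFourier hu.integrable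
  have hu1 := hu.cont.aestronglyMeasurable (μ := volume)
  have hm : AEMeasurable (fun y => ‖invFourier u y‖ₑ ^ 2) :=
    (hcont.enorm.measurable.pow_const 2).aemeasurable
  -- the time-slices of both sides
  have slice : ∀ t ∈ Set.Ioi (0 : ℝ),
      ∫⁻ y, ‖invFourier u y‖ₑ ^ 2 * ENNReal.ofReal (heatKernel t ‖y‖)
      ≤ ENNReal.ofReal (((2 * Real.pi) ^ 3)⁻¹) * ∫⁻ z : E3 × E3, ‖conj (u z.1) * u z.2‖ₑ *
          ENNReal.ofReal (Real.exp (-(‖z.1 - z.2‖ ^ 2 * t))) := by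
    intro t ht
    have e := integral_heatKernel_invFourier ht hu hu
    have e0 : ∀ y, conj (invFourier u y) * invFourier u y * (heatKernel t ‖y‖ : ℂ)
        = ((‖invFourier u y‖ ^ 2 * heatKernel t ‖y‖ : ℝ) : ℂ) := by
      intro y
      rw [mul_comm (conj _), Complex.mul_conj, Complex.normSq_eq_norm_sq]
      push_cast; ring
    simp_rw [e0] at e
    rw [integral_complex_ofReal] at e
    have hk : Integrable (fun y : E3 => heatKernel t ‖y‖) := by
      by_contra hcon
      have h1 := integral_gaussian_exp ht (0 : E3)
      simp only [inner_zero_left, Complex.ofReal_zero, mul_zero, Complex.exp_zero, mul_one] at h1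
      rw [integral_complex_ofReal, integral_undef hcon] at h1
      simp at h1
    have hI : Integrable (fun y => ‖invFourier u y‖ ^ 2 * heatKernel t ‖y‖) := by
      refine hk.bdd_mul (c := ((2 * Real.pi) ^ (-(3 / 2) : ℝ) * ∫ p, ‖u p‖) ^ 2)
        (hcont.norm.pow 2).aestronglyMeasurable (Filter.Eventually.of_forall fun y => ?_)
      rw [norm_pow, norm_norm]
      gcongr
      exact norm_invFourier_le y
    have e1 : ∫⁻ y, ‖invFourier u y‖ₑ ^ 2 * ENNReal.ofReal (heatKernel t ‖y‖)
        = ENNReal.ofReal (∫ y, ‖invFourier u y‖ ^ 2 * heatKernel t ‖y‖) := by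
      rw [ofReal_integral_eq_lintegral_ofReal hI (Filter.Eventually.of_forall fun y =>
        mul_nonneg (by positivity) (heatKernel_nonneg ht _))]
      refine lintegral_congr fun y => ?_
      rw [ENNReal.ofReal_mul (by positivity), ENNReal.ofReal_pow (norm_nonneg _), ofReal_norm]
    have e2 : ENNReal.ofReal (∫ y, ‖invFourier u y‖ ^ 2 * heatKernel t ‖y‖)
        = ‖((∫ y, ‖invFourier u y‖ ^ 2 * heatKernel t ‖y‖ : ℝ) : ℂ)‖ₑ := by
      rw [← ofReal_norm, Complex.norm_real, Real.norm_of_nonneg]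
      exact integral_nonneg fun y => mul_nonneg (by positivity) (heatKernel_nonneg ht _)
    rw [e1, e2, e, enorm_mul]
    refine mul_le_mul' (le_of_eq ?_) ((enorm_integral_le_lintegral_enorm _).trans (le_of_eq ?_))
    · rw [← ofReal_norm, Complex.norm_real, Real.norm_of_nonneg (by positivity)]
    · refine lintegral_congr fun z => ?_
      rw [enorm_mul, ← ofReal_norm (Complex.ofReal _), Complex.norm_real,
        Real.norm_of_nonneg (Real.exp_pos _).le]
  have h1 : ∫⁻ y, ‖invFourier u y‖ₑ ^ 2 * ENNReal.ofReal ((4 * Real.pi)⁻¹ * ‖y‖⁻¹)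
      ≤ ENNReal.ofReal (((2 * Real.pi) ^ 3)⁻¹) * ∫⁻ z : E3 × E3, ‖conj (u z.1) * u z.2‖ₑ *
          ENNReal.ofReal (‖z.1 - z.2‖ ^ 2)⁻¹ := by
    rw [lintegral_superposition hm measurable_heatKernel lintegral_heatKernel_ae,
      lintegral_superposition (k := fun (z : E3 × E3) t => Real.exp (-(‖z.1 - z.2‖ ^ 2 * t)))
        (hu.integrable_prod hu).1.enorm (by fun_prop) lintegral_exp_neg_ae,
      ← lintegral_const_mul' _ _ ENNReal.ofReal_ne_top]
    exact setLIntegral_mono' measurableSet_Ioi slice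
  obtain ⟨-, hb⟩ := integrable_coulomb hu1 hu1 hu.integrable_norm_weight hu.integrable_norm_weight
  have h2 : ∫⁻ z : E3 × E3, ‖conj (u z.1) * u z.2‖ₑ * ENNReal.ofReal (‖z.1 - z.2‖ ^ 2)⁻¹
      ≤ ENNReal.ofReal (22 * sphereArea * ∫ p, ‖p‖ * ‖u p‖ ^ 2) := by
    have hi := (integrable_coulomb hu1 hu1 hu.integrable_norm_weight
      hu.integrable_norm_weight).1
    have : ∀ z : E3 × E3, ‖conj (u z.1) * u z.2‖ₑ * ENNReal.ofReal (‖z.1 - z.2‖ ^ 2)⁻¹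
        = ‖conj (u z.1) * u z.2 * (((‖z.1 - z.2‖ ^ 2)⁻¹ : ℝ) : ℂ)‖ₑ := by
      intro z
      rw [enorm_mul _ (Complex.ofReal _), ← ofReal_norm (Complex.ofReal _), Complex.norm_real,
        Real.norm_of_nonneg (by positivity)]
    simp_rw [this]
    rw [← ofReal_integral_norm_eq_lintegral_enorm hi]
    refine ENNReal.ofReal_le_ofReal (hb.trans (le_of_eq ?_))
    ring
  have h3 : ∫⁻ y, ‖invFourier u y‖ₑ ^ 2 * ENNReal.ofReal ((4 * Real.pi)⁻¹ * ‖y‖⁻¹)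
      = ENNReal.ofReal ((4 * Real.pi)⁻¹) * ∫⁻ y, ‖invFourier u y‖ₑ ^ 2 * ENNReal.ofReal ‖y‖⁻¹ := by
    rw [← lintegral_const_mul' _ _ ENNReal.ofReal_ne_top]
    refine lintegral_congr fun y => ?_
    rw [ENNReal.ofReal_mul (by positivity)]
    ring
  rw [h3] at h1
  have h4 := mul_le_mul_right (h1.trans (mul_le_mul_right h2 _)) (ENNReal.ofReal (4 * Real.pi))
  rw [← mul_assoc, ← ENNReal.ofReal_mul (by positivity), mul_inv_cancel₀ (by positivity),
    ENNReal.ofReal_one, one_mul] at h4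
  refine h4.trans ?_
  rw [← mul_assoc, ← ENNReal.ofReal_mul (by positivity)]
  have h5 : ENNReal.ofReal (4 * Real.pi * ((2 * Real.pi) ^ 3)⁻¹) ≤ 1 := by
    rw [ENNReal.ofReal_le_one]
    have : 4 * Real.pi * ((2 * Real.pi) ^ 3)⁻¹ = (2 * Real.pi ^ 2)⁻¹ := by field_simp; norm_num
    rw [this]
    apply inv_le_one_of_one_le₀
    nlinarith
  exact (mul_le_mul_left h5 _).trans (by rw [one_mul])

/-- The integrability statement contained in Kato's inequality. -/
lemma integrable_invFourier_div_norm {u v : E3 → ℂ} (hu : IsTest u) (hv : IsTest v) :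
    Integrable fun y => conj (invFourier u y) * invFourier v y * ((‖y‖⁻¹ : ℝ) : ℂ) := by
  have cu := continuous_invFourier hu.integrable
  have cv := continuous_invFourier hv.integrable
  have sq : ∀ w : E3 → ℂ, IsTest w → Integrable fun y => ‖invFourier w y‖ ^ 2 * ‖y‖⁻¹ := by
    intro w hw
    have cw := continuous_invFourier hw.integrable
    refine ⟨((cw.norm.pow 2).measurable.mul (by fun_prop)).aestronglyMeasurable, ?_⟩
    refine lt_of_eq_of_lt ?_ (lt_of_le_of_lt (lintegral_kato hw) ENNReal.ofReal_lt_top)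
    refine lintegral_congr fun y => ?_
    rw [enorm_mul, ← ofReal_norm (‖y‖⁻¹), Real.norm_of_nonneg (by positivity), enorm_pow,
      enorm_norm]
  refine ((sq u hu).add (sq v hv)).mono ?_ (Filter.Eventually.of_forall fun y => ?_)
  · exact (((Complex.continuous_conj.comp cu).mul cv).measurable.mul (by fun_prop)).aestronglyMeasurable
  · have hy : 0 ≤ ‖y‖⁻¹ := by positivity
    simp only [Pi.add_apply, norm_mul, RCLike.norm_conj, Complex.norm_real]
    rw [Real.norm_of_nonneg hy, Real.norm_of_nonneg (by positivity), ← add_mul]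
    gcongr
    nlinarith [sq_nonneg (‖invFourier u y‖ - ‖invFourier v y‖), sq_nonneg ‖invFourier u y‖,
      sq_nonneg ‖invFourier v y‖]

/-- Multiplication by `|y|⁻¹` is convolution with `(2π²)⁻¹ |p|⁻²` on the Fourier side. -/
lemma integral_invFourier_div_norm {u v : E3 → ℂ} (hu : IsTest u) (hv : IsTest v) :
    ∫ y, conj (invFourier u y) * invFourier v y * ((‖y‖⁻¹ : ℝ) : ℂ)
      = ((2 * Real.pi ^ 2)⁻¹ : ℝ) * ∫ z : E3 × E3,
        conj (u z.1) * v z.2 * (((‖z.1 - z.2‖ ^ 2)⁻¹ : ℝ) : ℂ) := by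
  have hpi := Real.pi_pos
  have cu := continuous_invFourier hu.integrable
  have cv := continuous_invFourier hv.integrable
  have e0 : ∀ y : E3, conj (invFourier u y) * invFourier v y * ((‖y‖⁻¹ : ℝ) : ℂ)
      = ((4 * Real.pi : ℝ) : ℂ) * (conj (invFourier u y) * invFourier v y *
        (((4 * Real.pi)⁻¹ * ‖y‖⁻¹ : ℝ) : ℂ)) := by
    intro y
    have h : ‖y‖⁻¹ = (4 * Real.pi) * ((4 * Real.pi)⁻¹ * ‖y‖⁻¹) := by field_simp
    conv_lhs => rw [h, Complex.ofReal_mul (4 * Real.pi)]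
    ring
  have hi : Integrable fun y => conj (invFourier u y) * invFourier v y *
        (((4 * Real.pi)⁻¹ * ‖y‖⁻¹ : ℝ) : ℂ) := by
    refine ((integrable_invFourier_div_norm hu hv).const_mul ((4 * Real.pi)⁻¹ : ℂ)).congr
      (Filter.Eventually.of_forall fun y => ?_)
    push_cast; ring
  have e1 := (integral_superposition (X := E3) (k := fun y t => heatKernel t ‖y‖)
    (F := fun y => conj (invFourier u y) * invFourier v y)
    ((Complex.continuous_conj.comp cu).mul cv).aestronglyMeasurable measurable_heatKernel
    (fun y t ht => heatKernel_nonneg ht _) (fun y => by positivity) lintegral_heatKernel_ae hi).2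
  have e2 := (integral_superposition (X := E3 × E3)
    (k := fun z t => Real.exp (-(‖z.1 - z.2‖ ^ 2 * t)))
    (hu.integrable_prod hv).1 (by fun_prop)
    (fun y t ht => (Real.exp_pos _).le) (fun y => by positivity) lintegral_exp_neg_ae
    (integrable_coulomb hu.cont.aestronglyMeasurable hv.cont.aestronglyMeasurable
      hu.integrable_norm_weight hv.integrable_norm_weight).1).2
  simp_rw [e0]
  rw [integral_const_mul, e1, e2, ← integral_const_mul, ← integral_const_mul]
  refine setIntegral_congr_fun measurableSet_Ioi fun t ht => ?_
  rw [integral_heatKernel_invFourier ht hu hv, ← mul_assoc, ← Complex.ofReal_mul]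
  congr 2
  field_simp
  norm_num

/-! ### The off-diagonal kernel is dominated by the Coulomb kernel -/

/-- The denominator `p² + q² + p·q + lam` of the off-diagonal kernel. -/
def denom (lam : ℝ) (p q : E3) : ℝ := ‖p‖ ^ 2 + ‖q‖ ^ 2 + inner ℝ p q + lam

lemma norm_sub_sq_le_denom (lam : ℝ) (p q : E3) : 4⁻¹ * ‖p - q‖ ^ 2 + lam ≤ denom lam p q := by
  have h1 := norm_sub_sq_real p q
  have h2 := norm_add_sq_real p q
  have h3 := sq_nonneg ‖p + q‖
  unfold denom
  nlinarith [sq_nonneg ‖p‖, sq_nonneg ‖q‖]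

lemma denom_pos {lam : ℝ} (hl : 0 < lam) (p q : E3) : 0 < denom lam p q :=
  lt_of_lt_of_le (by positivity) (norm_sub_sq_le_denom lam p q)

lemma continuous_denom (lam : ℝ) : Continuous fun z : E3 × E3 => denom lam z.1 z.2 := by
  unfold denom; fun_prop

/-- The off-diagonal kernel is dominated by the Coulomb kernel. -/
lemma integrable_offDiag {lam : ℝ} (hl : 0 < lam) {u v : E3 → ℂ}
    (hu : AEStronglyMeasurable u) (hv : AEStronglyMeasurable v)
    (iu : Integrable fun p => ‖p‖ * ‖u p‖ ^ 2) (iv : Integrable fun p => ‖p‖ * ‖v p‖ ^ 2) :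
    Integrable (fun z : E3 × E3 => conj (u z.1) * v z.2 * (((denom lam z.1 z.2)⁻¹ : ℝ) : ℂ)) ∧
    ∫ z : E3 × E3, ‖conj (u z.1) * v z.2 * (((denom lam z.1 z.2)⁻¹ : ℝ) : ℂ)‖
      ≤ 44 * sphereArea * ((∫ p, ‖p‖ * ‖u p‖ ^ 2) + ∫ p, ‖p‖ * ‖v p‖ ^ 2) := by
  obtain ⟨h1, h2⟩ := integrable_coulomb hu hv iu iv
  have hb : ∀ᵐ z : E3 × E3, ‖conj (u z.1) * v z.2 * (((denom lam z.1 z.2)⁻¹ : ℝ) : ℂ)‖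
      ≤ 4 * ‖conj (u z.1) * v z.2 * (((‖z.1 - z.2‖ ^ 2)⁻¹ : ℝ) : ℂ)‖ := by
    filter_upwards [ae_fst_ne_snd] with z hz
    have hz' : 0 < ‖z.1 - z.2‖ := norm_pos_iff.2 (sub_ne_zero.2 hz)
    have hd := denom_pos hl z.1 z.2
    have h3 : (denom lam z.1 z.2)⁻¹ ≤ 4 * (‖z.1 - z.2‖ ^ 2)⁻¹ := by
      have : 4 * (‖z.1 - z.2‖ ^ 2)⁻¹ = (4⁻¹ * ‖z.1 - z.2‖ ^ 2)⁻¹ := by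
        rw [mul_inv, inv_inv]
      rw [this]
      apply inv_anti₀ (by positivity)
      linarith [norm_sub_sq_le_denom lam z.1 z.2]
    rw [norm_mul, norm_mul _ (Complex.ofReal _), Complex.norm_real, Complex.norm_real,
      Real.norm_of_nonneg (by positivity), Real.norm_of_nonneg (by positivity)]
    have := mul_le_mul_of_nonneg_left h3 (norm_nonneg (conj (u z.1) * v z.2))
    linarith
  have hm : AEStronglyMeasurable
      (fun z : E3 × E3 => conj (u z.1) * v z.2 * (((denom lam z.1 z.2)⁻¹ : ℝ) : ℂ)) := by
    have h1 : AEStronglyMeasurable (fun z : E3 × E3 => u z.1) :=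
      hu.comp_quasiMeasurePreserving Measure.quasiMeasurePreserving_fst
    have h2 : AEStronglyMeasurable (fun z : E3 × E3 => v z.2) :=
      hv.comp_quasiMeasurePreserving Measure.quasiMeasurePreserving_snd
    refine ((Complex.continuous_conj.comp_aestronglyMeasurable h1).mul h2).mul ?_
    exact (Complex.measurable_ofReal.comp
      (continuous_denom lam).measurable.inv).aestronglyMeasurable
  have h3 := h1.norm.const_mul 4
  refine ⟨h3.mono' hm hb, ?_⟩
  refine (integral_mono_of_nonneg (Filter.Eventually.of_forall fun z => norm_nonneg _) h3 hb).trans ?_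
  rw [integral_const_mul]
  linarith

lemma IsTest.integrable_prod_continuous {u v : E3 → ℂ} (hu : IsTest u) (hv : IsTest v)
    {f : E3 × E3 → ℂ} (hf : Continuous f) :
    Integrable (fun z : E3 × E3 => conj (u z.1) * v z.2 * f z) := by
  have hc : Continuous (fun z : E3 × E3 => conj (u z.1) * v z.2 * f z) :=
    ((Complex.continuous_conj.comp (hu.cont.comp continuous_fst)).mul
      (hv.cont.comp continuous_snd)).mul hf
  refine hc.integrable_of_hasCompactSupport ?_
  refine HasCompactSupport.intro (hu.supp.isCompact.prod hv.supp.isCompact) fun z hz => ?_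
  by_cases h : z.1 ∈ tsupport u
  · have h2 : z.2 ∉ tsupport v := fun h2 => hz ⟨h, h2⟩
    simp [image_eq_zero_of_notMem_tsupport h2]
  · simp [image_eq_zero_of_notMem_tsupport h]

lemma continuous_coord (i : Fin 3) : Continuous fun p : E3 => ((p i : ℝ) : ℂ) :=
  Complex.continuous_ofReal.comp (by fun_prop)

lemma inner_eq_sum (p q : E3) : inner ℝ p q = ∑ i, p i * q i := by
  rw [PiLp.inner_apply]
  exact Finset.sum_congr rfl fun i _ => by simp [mul_comm]

open scoped ComplexOrder in
/-- The kernel `(p·q)^k` is positive definite. -/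
lemma integral_inner_pow_nonneg (k : ℕ) : ∀ {v : E3 → ℂ}, IsTest v →
    0 ≤ ∫ z : E3 × E3, conj (v z.1) * v z.2 * (((inner ℝ z.1 z.2) ^ k : ℝ) : ℂ) := by
  induction k with
  | zero =>
    intro v hv
    simp only [pow_zero, Complex.ofReal_one, mul_one]
    rw [Measure.volume_eq_prod, integral_prod_mul (fun p => conj (v p)) v, integral_conj,
      mul_comm, Complex.mul_conj]
    exact_mod_cast Complex.normSq_nonneg _
  | succ k ih =>
    intro v hv
    have h1 : ∀ i : Fin 3, IsTest fun p => ((p i : ℝ) : ℂ) * v p := fun i =>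
      hv.continuous_mul (continuous_coord i)
    have h2 : ∀ z : E3 × E3, conj (v z.1) * v z.2 * (((inner ℝ z.1 z.2) ^ (k + 1) : ℝ) : ℂ)
        = ∑ i : Fin 3, conj (((z.1 i : ℝ) : ℂ) * v z.1) * (((z.2 i : ℝ) : ℂ) * v z.2)
          * (((inner ℝ z.1 z.2) ^ k : ℝ) : ℂ) := by
      intro z
      rw [pow_succ, Complex.ofReal_mul, inner_eq_sum z.1 z.2, Complex.ofReal_sum, Finset.mul_sum,
        Finset.mul_sum]
      refine Finset.sum_congr rfl fun i _ => ?_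
      rw [map_mul, Complex.conj_ofReal]
      push_cast
      ring
    simp_rw [h2]
    have h3 : ∀ i : Fin 3, Integrable fun z : E3 × E3 => conj (((z.1 i : ℝ) : ℂ) * v z.1) *
        (((z.2 i : ℝ) : ℂ) * v z.2) * (((inner ℝ z.1 z.2) ^ k : ℝ) : ℂ) := fun i =>
      (h1 i).integrable_prod_continuous (h1 i) (Complex.continuous_ofReal.comp (by fun_prop))
    rw [integral_finsetSum _ fun i _ => h3 i]
    exact Finset.sum_nonneg fun i _ => ih (h1 i)

lemma hasSum_integral_inner_pow (s : ℝ) {v : E3 → ℂ} (hv : IsTest v) :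
    HasSum (fun k : ℕ => ((s ^ k / k.factorial : ℝ) : ℂ) *
        ∫ z : E3 × E3, conj (v z.1) * v z.2 * (((inner ℝ z.1 z.2) ^ k : ℝ) : ℂ))
      (∫ z : E3 × E3, conj (v z.1) * v z.2 * (Real.exp (s * inner ℝ z.1 z.2) : ℂ)) := by
  obtain ⟨R, hR⟩ := hv.supp.isCompact.isBounded.exists_norm_le
  set F : ℕ → E3 × E3 → ℂ := fun k z => conj (v z.1) * v z.2 *
    ((s ^ k / k.factorial * (inner ℝ z.1 z.2) ^ k : ℝ) : ℂ) with hF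
  have hFi : ∀ k, Integrable (F k) := fun k =>
    hv.integrable_prod_continuous hv (Complex.continuous_ofReal.comp (by fun_prop))
  have hb : ∀ k z, ‖F k z‖ ≤ ‖conj (v z.1) * v z.2‖ * ((|s| * R ^ 2) ^ k / k.factorial) := by
    intro k z
    rw [hF]
    simp only [norm_mul (conj (v z.1) * v z.2)]
    by_cases h1 : v z.1 = 0
    · simp [h1]
    by_cases h2 : v z.2 = 0
    · simp [h2]
    have b1 := hR z.1 (subset_tsupport _ h1)
    have b2 := hR z.2 (subset_tsupport _ h2)
    have b3 : |inner ℝ z.1 z.2| ≤ R ^ 2 := by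
      refine (abs_real_inner_le_norm _ _).trans ?_
      rw [sq]
      exact mul_le_mul b1 b2 (norm_nonneg _) ((norm_nonneg _).trans b1)
    gcongr
    rw [Complex.norm_real, Real.norm_eq_abs, abs_mul, abs_div, abs_pow, abs_pow, Nat.abs_cast,
      mul_pow, div_mul_eq_mul_div]
    gcongr
  have hsum : Summable fun k => ∫ z, ‖F k z‖ := by
    refine Summable.of_nonneg_of_le (fun k => integral_nonneg fun z => norm_nonneg _)
      (fun k => integral_mono (hFi k).norm ((hv.integrable_prod hv).norm.mul_const _) (hb k)) ?_
    simp_rw [integral_mul_const]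
    exact (Real.summable_pow_div_factorial _).mul_left _
  have h := hasSum_integral_of_summable_integral_norm hFi hsum
  have e1 : ∀ k : ℕ, ((s ^ k / k.factorial : ℝ) : ℂ) *
      ∫ z : E3 × E3, conj (v z.1) * v z.2 * (((inner ℝ z.1 z.2) ^ k : ℝ) : ℂ) = ∫ z, F k z := by
    intro k
    rw [← integral_const_mul]
    refine integral_congr_ae (Filter.Eventually.of_forall fun z => ?_)
    simp only [hF]
    push_cast
    ring
  have e2 : ∫ z : E3 × E3, conj (v z.1) * v z.2 * (Real.exp (s * inner ℝ z.1 z.2) : ℂ)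
      = ∫ z, ∑' k, F k z := by
    refine integral_congr_ae (Filter.Eventually.of_forall fun z => ?_)
    simp only [hF]
    rw [tsum_mul_left, ← Complex.ofReal_tsum]
    congr 2
    rw [Real.exp_eq_exp_ℝ, NormedSpace.exp_eq_tsum_div]
    refine tsum_congr fun k => ?_
    rw [mul_pow]
    ring
  simp_rw [e1, e2]
  exact h

open scoped ComplexOrder in
/-- Comparison of the Gaussian kernels `exp(-t (p² + q² + p·q))` and `exp(-t |p - q|²)`: the power
series of `exp(2t p·q)` dominates that of `exp(-t p·q)` coefficientwise, and each `(p·q)^k` is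
positive definite. -/
lemma norm_integral_gaussian_le {t lam : ℝ} (ht : 0 < t) (hl : 0 < lam) {u : E3 → ℂ}
    (hu : IsTest u) :
    ‖∫ z : E3 × E3, conj (u z.1) * u z.2 * (Real.exp (-(denom lam z.1 z.2 * t)) : ℂ)‖
      ≤ (∫ z : E3 × E3, conj (u z.1) * u z.2 * (Real.exp (-(‖z.1 - z.2‖ ^ 2 * t)) : ℂ)).re := by
  set v : E3 → ℂ := fun p => (Real.exp (-(‖p‖ ^ 2 * t)) : ℂ) * u p with hvdef
  have hv : IsTest v := hu.continuous_mul (Complex.continuous_ofReal.comp (by fun_prop))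
  set a : ℕ → ℂ := fun k =>
    ∫ z : E3 × E3, conj (v z.1) * v z.2 * (((inner ℝ z.1 z.2) ^ k : ℝ) : ℂ) with ha
  have ha0 : ∀ k, 0 ≤ a k := fun k => integral_inner_pow_nonneg k hv
  have har : ∀ k, a k = ((a k).re : ℂ) := fun k => (Complex.eq_re_of_ofReal_le (ha0 k))
  have ha1 : ∀ k, 0 ≤ (a k).re := fun k => (Complex.nonneg_iff.1 (ha0 k)).1
  have e1 : ∀ z : E3 × E3, conj (u z.1) * u z.2 * (Real.exp (-(denom lam z.1 z.2 * t)) : ℂ)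
      = (Real.exp (-(lam * t)) : ℂ) *
        (conj (v z.1) * v z.2 * (Real.exp (-t * inner ℝ z.1 z.2) : ℂ)) := by
    intro z
    have : -(denom lam z.1 z.2 * t) = -(lam * t) + -(‖z.1‖ ^ 2 * t) + -(‖z.2‖ ^ 2 * t)
        + -t * inner ℝ z.1 z.2 := by unfold denom; ring
    rw [this, Real.exp_add, Real.exp_add, Real.exp_add]
    simp only [hvdef, map_mul, Complex.conj_ofReal, Complex.ofReal_mul]
    ring
  have e2 : ∀ z : E3 × E3, conj (u z.1) * u z.2 * (Real.exp (-(‖z.1 - z.2‖ ^ 2 * t)) : ℂ)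
      = conj (v z.1) * v z.2 * (Real.exp (2 * t * inner ℝ z.1 z.2) : ℂ) := by
    intro z
    have : -(‖z.1 - z.2‖ ^ 2 * t) = -(‖z.1‖ ^ 2 * t) + -(‖z.2‖ ^ 2 * t)
        + 2 * t * inner ℝ z.1 z.2 := by rw [norm_sub_sq_real]; ring
    rw [this, Real.exp_add, Real.exp_add]
    simp only [hvdef, map_mul, Complex.conj_ofReal, Complex.ofReal_mul]
    ring
  simp_rw [e1, e2]
  rw [integral_const_mul, norm_mul, Complex.norm_real, Real.norm_of_nonneg (Real.exp_pos _).le]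
  have s1 := hasSum_integral_inner_pow (-t) hv
  have s2 := Complex.hasSum_re (hasSum_integral_inner_pow (2 * t) hv)
  have hle : ∀ k : ℕ, ‖(((-t) ^ k / k.factorial : ℝ) : ℂ) * a k‖
      ≤ ((((2 * t) ^ k / k.factorial : ℝ) : ℂ) * a k).re := by
    intro k
    rw [norm_mul, Complex.norm_real, Real.norm_eq_abs, abs_div, abs_pow, abs_neg, abs_of_pos ht,
      Nat.abs_cast, Complex.re_ofReal_mul, har k, Complex.norm_real, Complex.ofReal_re,
      Real.norm_of_nonneg (ha1 k)]
    have := ha1 k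
    gcongr
    linarith
  have h1 : Real.exp (-(lam * t)) ≤ 1 := Real.exp_le_one_iff.2 (by have := mul_pos hl ht; linarith)
  calc _ ≤ 1 * ‖∫ z : E3 × E3, conj (v z.1) * v z.2 * (Real.exp (-t * inner ℝ z.1 z.2) : ℂ)‖ := by
        gcongr
    _ ≤ _ := by
        rw [one_mul, ← s1.tsum_eq]
        exact (tsum_of_norm_bounded s2 hle)

/-- As quadratic forms, the off-diagonal kernel is dominated by the Coulomb kernel with constant
one. -/
lemma norm_offDiag_le {lam : ℝ} (hl : 0 < lam) {u : E3 → ℂ} (hu : IsTest u) :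
    ‖∫ z : E3 × E3, conj (u z.1) * u z.2 * (((denom lam z.1 z.2)⁻¹ : ℝ) : ℂ)‖
      ≤ (∫ z : E3 × E3, conj (u z.1) * u z.2 * (((‖z.1 - z.2‖ ^ 2)⁻¹ : ℝ) : ℂ)).re := by
  have hu1 := hu.cont.aestronglyMeasurable (μ := volume)
  obtain ⟨i1, e1⟩ := integral_superposition (X := E3 × E3)
    (k := fun z t => Real.exp (-(‖z.1 - z.2‖ ^ 2 * t)))
    (hu.integrable_prod hu).1 (by fun_prop)
    (fun y t ht => (Real.exp_pos _).le) (fun y => by positivity) lintegral_exp_neg_ae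
    (integrable_coulomb hu1 hu1 hu.integrable_norm_weight hu.integrable_norm_weight).1
  obtain ⟨i2, e2⟩ := integral_superposition (X := E3 × E3)
    (k := fun z t => Real.exp (-(denom lam z.1 z.2 * t))) (K := fun z => (denom lam z.1 z.2)⁻¹)
    (hu.integrable_prod hu).1
    (by unfold denom Function.uncurry; fun_prop)
    (fun y t ht => (Real.exp_pos _).le) (fun z => (inv_pos.2 (denom_pos hl _ _)).le)
    (Filter.Eventually.of_forall fun z => lintegral_exp_neg_mul (denom_pos hl _ _))
    (integrable_offDiag hl hu1 hu1 hu.integrable_norm_weight hu.integrable_norm_weight).1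
  rw [e1, e2]
  have i3 := i1.integral_prod_left
  have := integral_re (𝕜 := ℂ) i3
  simp only [RCLike.re_to_complex] at this
  rw [← this]
  refine norm_integral_le_of_norm_le i3.re ?_
  refine (ae_restrict_iff' measurableSet_Ioi).2 (Filter.Eventually.of_forall fun t ht => ?_)
  exact norm_integral_gaussian_le ht hl hu

/-! ### The unitary Fourier transform on `L²` -/

/-- On `L¹ ∩ L²` the inverse Fourier transform of `L²` is given by the Fourier integral. -/
lemma fourierInv_toLp_ae_eq {f : E3 → ℂ} (h1 : Integrable f) (h2 : MemLp f 2) :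
    ((𝓕⁻ (h2.toLp f : L2) : L2) : E3 → ℂ) =ᵐ[volume] (𝓕⁻ f : E3 → ℂ) := by
  have hc : Continuous (𝓕⁻ f : E3 → ℂ) := by
    have e : (𝓕⁻ f : E3 → ℂ) = fun w => (𝓕 f : E3 → ℂ) (-w) := by
      funext w; exact Real.fourierInv_eq_fourier_neg f w
    rw [e]
    exact (VectorFourier.fourierIntegral_continuous Real.continuous_fourierChar
      (by exact continuous_inner) h1).comp continuous_neg
  have hloc : LocallyIntegrable (fun y => ((𝓕⁻ (h2.toLp f : L2) : L2) : E3 → ℂ) y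
      - (𝓕⁻ f : E3 → ℂ) y) :=
    ((Lp.memLp (𝓕⁻ (h2.toLp f : L2) : L2)).locallyIntegrable (by norm_num)).sub
      hc.locallyIntegrable
  have key := ae_eq_zero_of_integral_contDiff_smul_eq_zero hloc ?_
  · filter_upwards [key] with y hy
    exact sub_eq_zero.1 hy
  intro g hg hgs
  have hgc : HasCompactSupport (fun x => (g x : ℂ)) :=
    hgs.comp_left (g := fun r : ℝ => (r : ℂ)) Complex.ofReal_zero
  set G : SchwartzMap E3 ℂ := hgc.toSchwartzMap
    (Complex.ofRealCLM.contDiff.comp hg) with hG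
  have hGc : ∀ x, G x = (g x : ℂ) := fun x => rfl
  have hin : inner ℂ (G.toLp 2 : L2) (𝓕⁻ (h2.toLp f : L2) : L2)
      = inner ℂ ((𝓕 G).toLp 2 : L2) (h2.toLp f : L2) := by
    rw [← SchwartzMap.toLp_fourier_eq, ← Lp.inner_fourier_eq, FourierTransform.fourier_fourierInv_eq]
  have e1 : inner ℂ (G.toLp 2 : L2) (𝓕⁻ (h2.toLp f : L2) : L2)
      = ∫ y, (g y : ℂ) * ((𝓕⁻ (h2.toLp f : L2) : L2) : E3 → ℂ) y := by
    rw [L2.inner_def]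
    refine integral_congr_ae ?_
    filter_upwards [G.coeFn_toLp 2 volume] with y hy
    rw [hy, hGc, RCLike.inner_apply, Complex.conj_ofReal, mul_comm]
  have e2 : inner ℂ ((𝓕 G).toLp 2 : L2) (h2.toLp f : L2)
      = ∫ y, (g y : ℂ) * (𝓕⁻ f : E3 → ℂ) y := by
    rw [L2.inner_def]
    have e3 : ∫ y, inner ℂ (((𝓕 G).toLp 2 : L2) y) ((h2.toLp f : L2) y)
        = ∫ y, (innerSL ℂ) (VectorFourier.fourierIntegral Real.fourierChar volume (innerₗ E3) G y)
            (f y) := by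
      refine integral_congr_ae ?_
      filter_upwards [(𝓕 G).coeFn_toLp 2 volume, h2.coeFn_toLp] with y hy hy2
      rw [hy, hy2]
      rfl
    rw [e3, VectorFourier.integral_sesq_fourierIntegral_eq_neg_flip (innerSL ℂ)
      Real.continuous_fourierChar (by exact continuous_inner) G.integrable h1]
    refine integral_congr_ae (Filter.Eventually.of_forall fun y => ?_)
    have e4 : VectorFourier.fourierIntegral Real.fourierChar volume (-(innerₗ E3).flip) f y
        = (𝓕⁻ f : E3 → ℂ) y := by
      rw [Real.fourierInv_eq]
      simp [VectorFourier.fourierIntegral]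
    simp only
    rw [e4, hGc, innerSL_apply_apply, RCLike.inner_apply, Complex.conj_ofReal, mul_comm]
  have hi : ∀ {h : E3 → ℂ}, LocallyIntegrable h → Integrable fun y => (g y : ℂ) * h y := by
    intro h hh
    have := hh.integrable_smul_left_of_hasCompactSupport hg.continuous hgs
    simpa using this
  calc ∫ y, g y • (((𝓕⁻ (h2.toLp f : L2) : L2) : E3 → ℂ) y - (𝓕⁻ f : E3 → ℂ) y)
      = ∫ y, ((g y : ℂ) * ((𝓕⁻ (h2.toLp f : L2) : L2) : E3 → ℂ) y
          - (g y : ℂ) * (𝓕⁻ f : E3 → ℂ) y) := by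
        refine integral_congr_ae (Filter.Eventually.of_forall fun y => ?_)
        simp only [Complex.real_smul]
        ring
    _ = 0 := by
        rw [integral_sub (hi ((Lp.memLp _).locallyIntegrable (by norm_num)))
          (hi hc.locallyIntegrable), ← e1, ← e2, hin, sub_self]

lemma memLp_comp_smul {f : E3 → ℂ} (hf : MemLp f 2) {r : ℝ} (hr : r ≠ 0) :
    MemLp (fun p => f (r • p)) 2 := by
  have h : MemLp f 2 (Measure.map (fun p : E3 => r • p) volume) := by
    rw [Measure.map_addHaar_smul volume hr]
    exact hf.smul_measure ENNReal.ofReal_ne_top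
  exact h.comp_of_map (by fun_prop)

lemma ae_comp_smul {P : E3 → Prop} (h : ∀ᵐ p, P p) {r : ℝ} (hr : r ≠ 0) : ∀ᵐ p, P (r • p) := by
  have hq : Measure.QuasiMeasurePreserving (fun p : E3 => r • p) volume volume := by
    refine ⟨by fun_prop, ?_⟩
    rw [Measure.map_addHaar_smul volume hr]
    exact Measure.smul_absolutelyContinuous
  exact hq.ae h

lemma memLp_fhat (ξ : L2) : MemLp (fhat ξ) 2 := by
  have hpi := Real.pi_pos
  exact (memLp_comp_smul (Lp.memLp (𝓕 ξ : L2)) (inv_ne_zero (by positivity))).const_mul _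

lemma fhat_add (η ξ : L2) : ∀ᵐ p, fhat (η + ξ) p = fhat η p + fhat ξ p := by
  have hpi := Real.pi_pos
  have h := Lp.coeFn_add (𝓕 η : L2) (𝓕 ξ : L2)
  rw [← FourierTransform.fourier_add] at h
  filter_upwards [ae_comp_smul h (inv_ne_zero (show 2 * Real.pi ≠ 0 by positivity))] with p hp
  rw [fhat, hp, Pi.add_apply, mul_add]
  rfl

lemma fhat_smul (c : ℂ) (ξ : L2) : ∀ᵐ p, fhat (c • ξ) p = c * fhat ξ p := by
  have hpi := Real.pi_pos
  have h := Lp.coeFn_smul c (𝓕 ξ : L2)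
  rw [← FourierTransform.fourier_smul] at h
  filter_upwards [ae_comp_smul h (inv_ne_zero (show 2 * Real.pi ≠ 0 by positivity))] with p hp
  rw [fhat, hp, Pi.smul_apply, smul_eq_mul, mul_left_comm]
  rfl

/-- Parseval's identity for `fhat`. -/
lemma integral_conj_fhat_mul_fhat (η ξ : L2) :
    ∫ p, conj (fhat η p) * fhat ξ p = inner ℂ η ξ := by
  have hpi := Real.pi_pos
  have e1 : ∀ p, conj (fhat η p) * fhat ξ p = ((((2 * Real.pi) ^ 3)⁻¹ : ℝ) : ℂ) *
      (fun w => inner ℂ ((𝓕 η : L2) w) ((𝓕 ξ : L2) w)) ((2 * Real.pi)⁻¹ • p) := by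
    intro p
    simp only
    rw [← two_pi_rpow_sq, fhat, fhat, map_mul, Complex.conj_ofReal, RCLike.inner_apply,
      Complex.ofReal_mul]
    ring
  simp_rw [e1]
  rw [integral_const_mul, Measure.integral_comp_inv_smul volume
    (fun w => inner ℂ ((𝓕 η : L2) w) ((𝓕 ξ : L2) w)), ← L2.inner_def, Lp.inner_fourier_eq]
  have : |(2 * Real.pi) ^ Module.finrank ℝ E3| = (2 * Real.pi) ^ 3 := by
    rw [abs_of_pos (by positivity)]; simp
  rw [this, Complex.real_smul, ← mul_assoc, ← Complex.ofReal_mul, inv_mul_cancel₀ (by positivity),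
    Complex.ofReal_one, one_mul]

lemma integral_norm_fhat_sq (ξ : L2) : ∫ p, ‖fhat ξ p‖ ^ 2 = ‖ξ‖ ^ 2 := by
  have h := integral_conj_fhat_mul_fhat ξ ξ
  rw [inner_self_eq_norm_sq_to_K] at h
  simp_rw [conj_mul_self_eq] at h
  rw [integral_complex_ofReal] at h
  have h2 := congrArg Complex.re h
  rw [Complex.ofReal_re] at h2
  rw [h2]
  norm_cast

lemma eq_of_fhat_ae_eq {η ξ : L2} (h : ∀ᵐ p, fhat η p = fhat ξ p) : η = ξ := by
  have h1 := fhat_add η (-ξ)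
  have h2 := fhat_smul (-1) ξ
  have h3 := integral_norm_fhat_sq (η + -ξ)
  have h4 : ∫ p, ‖fhat (η + -ξ) p‖ ^ 2 = 0 := by
    rw [integral_eq_zero_of_ae]
    filter_upwards [h, h1, h2] with p a b c
    rw [neg_one_smul] at c
    rw [b, c, a]
    simp
  rw [h4] at h3
  have : ‖η + -ξ‖ = 0 := by
    rw [eq_comm, sq_eq_zero_iff] at h3; exact h3
  rw [norm_eq_zero, ← sub_eq_add_neg, sub_eq_zero] at this
  exact this

/-- The rescaling which turns `fhat` into Mathlib's Fourier transform. -/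
lemma memLp_rescale {v : E3 → ℂ} (hv : MemLp v 2) :
    MemLp (fun w => (((2 * Real.pi) ^ (3 / 2 : ℝ) : ℝ) : ℂ) * v ((2 * Real.pi) • w)) 2 := by
  have hpi := Real.pi_pos
  exact (memLp_comp_smul hv (by positivity)).const_mul _

/-- The element of `L²` whose Fourier transform `fhat` is the given function. -/
def ofFhat {v : E3 → ℂ} (hv : MemLp v 2) : L2 := 𝓕⁻ ((memLp_rescale hv).toLp _ : L2)

lemma fhat_ofFhat {v : E3 → ℂ} (hv : MemLp v 2) : ∀ᵐ p, fhat (ofFhat hv) p = v p := by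
  have hpi := Real.pi_pos
  have h := (memLp_rescale hv).coeFn_toLp
  filter_upwards [ae_comp_smul h (inv_ne_zero (show 2 * Real.pi ≠ 0 by positivity))] with p hp
  rw [fhat, ofFhat, FourierTransform.fourier_fourierInv_eq, hp, smul_smul,
    mul_inv_cancel₀ (by positivity), one_smul, ← mul_assoc, ← Complex.ofReal_mul,
    ← Real.rpow_add (by positivity)]
  norm_num

lemma eq_ofFhat {v : E3 → ℂ} (hv : MemLp v 2) {ξ : L2} (h : ∀ᵐ p, fhat ξ p = v p) :
    ξ = ofFhat hv := by
  refine eq_of_fhat_ae_eq ?_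
  filter_upwards [h, fhat_ofFhat hv] with p h1 h2
  rw [h1, h2]

/-- An element of `L²` whose Fourier transform is a test function is its Fourier integral. -/
lemma ae_eq_invFourier {u : E3 → ℂ} (hu : IsTest u) {ξ : L2} (h : ∀ᵐ p, fhat ξ p = u p) :
    ∀ᵐ y, ξ y = invFourier u y := by
  have hpi := Real.pi_pos
  rw [eq_ofFhat (hu.memLp 2) h]
  have hi : Integrable (fun w => (((2 * Real.pi) ^ (3 / 2 : ℝ) : ℝ) : ℂ) *
      u ((2 * Real.pi) • w)) :=
    (hu.integrable.comp_smul (by positivity)).const_mul _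
  filter_upwards [fourierInv_toLp_ae_eq hi (memLp_rescale (hu.memLp 2))] with y hy
  rw [ofFhat, hy, Real.fourierInv_eq', invFourier]
  have e : ∀ w : E3, Complex.exp ((2 * Real.pi * inner ℝ w y : ℝ) * Complex.I) •
      ((((2 * Real.pi) ^ (3 / 2 : ℝ) : ℝ) : ℂ) * u ((2 * Real.pi) • w))
      = (((2 * Real.pi) ^ (3 / 2 : ℝ) : ℝ) : ℂ) *
        (fun p => Complex.exp (Complex.I * (inner ℝ p y : ℝ)) * u p) ((2 * Real.pi) • w) := by
    intro w
    simp only [smul_eq_mul, real_inner_smul_left]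
    rw [mul_comm Complex.I]
    ring
  simp_rw [e]
  rw [integral_const_mul, Measure.integral_comp_smul volume
    (fun p => Complex.exp (Complex.I * (inner ℝ p y : ℝ)) * u p), Complex.real_smul, ← mul_assoc,
    ← Complex.ofReal_mul]
  congr 2
  rw [abs_of_pos (by positivity), ← Real.rpow_natCast, ← Real.rpow_neg (by positivity),
    ← Real.rpow_add (by positivity)]
  norm_num

/-- Plancherel's theorem for test functions. -/
lemma integral_conj_invFourier_mul {u v : E3 → ℂ} (hu : IsTest u) (hv : IsTest v) :
    ∫ y, conj (invFourier u y) * invFourier v y = ∫ p, conj (u p) * v p := by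
  have h1 := fhat_ofFhat (hu.memLp 2)
  have h2 := fhat_ofFhat (hv.memLp 2)
  have e := integral_conj_fhat_mul_fhat (ofFhat (hu.memLp 2)) (ofFhat (hv.memLp 2))
  rw [L2.inner_def] at e
  rw [integral_congr_ae (g := fun p => conj (u p) * v p)
    (by filter_upwards [h1, h2] with p a b; rw [a, b])] at e
  rw [e]
  refine integral_congr_ae ?_
  filter_upwards [ae_eq_invFourier hu h1, ae_eq_invFourier hv h2] with y a b
  rw [a, b, RCLike.inner_apply, mul_comm]

lemma memLp_invFourier {u : E3 → ℂ} (hu : IsTest u) : MemLp (invFourier u) 2 :=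
  (memLp_congr_ae (ae_eq_invFourier hu (fhat_ofFhat (hu.memLp 2)))).1 (Lp.memLp _)

lemma integral_norm_invFourier_sq {u : E3 → ℂ} (hu : IsTest u) :
    ∫ y, ‖invFourier u y‖ ^ 2 = ∫ p, ‖u p‖ ^ 2 := by
  have h := integral_conj_invFourier_mul hu hu
  simp_rw [conj_mul_self_eq] at h
  rw [integral_complex_ofReal, integral_complex_ofReal] at h
  exact_mod_cast h

/-! ### Testing a bounded Lipschitz potential with `-Δφ` -/

/-- The part `β + γ (θ(y) - 1) / y` of the regularizing potential without its Coulomb singularity. -/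
def boundedPart (β γ : ℝ) (θ : ℝ → ℝ) (y : E3) : ℝ := β + γ * ((θ ‖y‖ - 1) / ‖y‖)

lemma gammaReg_eq (β γ : ℝ) (θ : ℝ → ℝ) (y : E3) :
    gammaReg β γ θ y = boundedPart β γ θ y + γ * ‖y‖⁻¹ := by
  unfold gammaReg boundedPart
  rw [div_eq_mul_inv, div_eq_mul_inv]
  ring

namespace SmoothCutoff

variable {θ : ℝ → ℝ}

/-- By the mean value theorem, `(θ(r) - 1) / r` is bounded and Lipschitz. -/
lemma exists_bound (hθ : SmoothCutoff θ) : ∃ M : ℝ, 0 ≤ M ∧ (∀ r, 0 < r → |(θ r - 1) / r| ≤ M) ∧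
    ∀ r s, 0 < r → 0 < s → |(θ r - 1) / r - (θ s - 1) / s| ≤ M * |r - s| := by
  obtain ⟨M, hM⟩ := hθ.bounded
  have hM0 : 0 ≤ M := (abs_nonneg _).trans (hM 1 one_pos).1
  have hd : ∀ r, 0 < r → DifferentiableAt ℝ θ r := fun r hr =>
    (hθ.contDiffOn.differentiableOn (by norm_num) r hr).differentiableAt (Ioi_mem_nhds hr)
  have hd2 : ∀ r, 0 < r → DifferentiableAt ℝ (deriv θ) r := fun r hr =>
    ((hθ.contDiffOn.deriv_of_isOpen isOpen_Ioi (m := 1) (by norm_num)).differentiableOn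
      (by norm_num) r hr).differentiableAt (Ioi_mem_nhds hr)
  have mvt : ∀ r, 0 < r → ∃ c, 0 < c ∧ c < r ∧ θ r - 1 = deriv θ c * r := by
    intro r hr
    obtain ⟨c, hc, h⟩ := exists_deriv_eq_slope θ hr
      (hθ.continuousOn.mono fun x hx => hx.1)
      (fun x hx => (hd x hx.1).differentiableWithinAt)
    refine ⟨c, hc.1, hc.2, ?_⟩
    rw [h, hθ.zero, sub_zero, div_mul_cancel₀ _ hr.ne']
  have lip : ∀ r c, 0 < r → 0 < c → |deriv θ r - deriv θ c| ≤ M * |r - c| := by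
    intro r c hr hc
    have := Convex.norm_image_sub_le_of_norm_deriv_le (f := deriv θ) (s := Set.Ioi 0) (C := M)
      (fun x hx => hd2 x hx) (fun x hx => (hM x hx).2.2) (convex_Ioi 0) hc hr
    simpa using this
  refine ⟨M, hM0, ?_, ?_⟩
  · intro r hr
    obtain ⟨c, hc, -, h⟩ := mvt r hr
    rw [h, mul_div_cancel_right₀ _ hr.ne']
    exact (hM c hc).2.1
  · intro r s hr hs
    have hder : ∀ x, 0 < x →
        HasDerivAt (fun x => (θ x - 1) / x) ((deriv θ x * x - (θ x - 1) * 1) / x ^ 2) x :=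
      fun x hx => ((hd x hx).hasDerivAt.sub_const 1).div (hasDerivAt_id x) hx.ne'
    have hb : ∀ x ∈ Set.Ioi (0 : ℝ), ‖deriv (fun x => (θ x - 1) / x) x‖ ≤ M := by
      intro x hx
      have hx0 : 0 < x := hx
      rw [(hder x hx0).deriv, Real.norm_eq_abs, abs_div, abs_of_pos (by positivity : 0 < x ^ 2),
        div_le_iff₀ (by positivity)]
      obtain ⟨c, hc, hcx, h⟩ := mvt x hx0
      have h1 := lip x c hx0 hc
      rw [abs_of_pos (by linarith : 0 < x - c)] at h1
      have e : deriv θ x * x - (θ x - 1) * 1 = (deriv θ x - deriv θ c) * x := by rw [h]; ring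
      rw [e, abs_mul, abs_of_pos hx0]
      nlinarith [mul_le_mul_of_nonneg_right h1 hx0.le, mul_nonneg hM0 (mul_nonneg hc.le hx0.le)]
    have := Convex.norm_image_sub_le_of_norm_deriv_le (f := fun x => (θ x - 1) / x)
      (s := Set.Ioi 0) (C := M) (fun x hx => (hder x hx).differentiableAt) hb (convex_Ioi 0) hs hr
    simpa using this

lemma measurable_boundedPart (hθ : SmoothCutoff θ) (β γ : ℝ) : Measurable (boundedPart β γ θ) := by
  have h : Continuous fun y : E3 => θ ‖y‖ :=
    hθ.continuousOn.comp_continuous continuous_norm fun y => norm_nonneg y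
  exact (((h.measurable.sub_const 1).div measurable_norm).const_mul γ).const_add β

lemma exists_boundedPart_bound (hθ : SmoothCutoff θ) (β γ : ℝ) : ∃ B L : ℝ, 0 ≤ B ∧ 0 ≤ L ∧
    (∀ y, |boundedPart β γ θ y| ≤ B) ∧
    ∀ x y, x ≠ 0 → y ≠ 0 → |boundedPart β γ θ x - boundedPart β γ θ y| ≤ L * ‖x - y‖ := by
  obtain ⟨M, hM0, h1, h2⟩ := hθ.exists_bound
  refine ⟨|β| + |γ| * M, |γ| * M, by positivity, by positivity, ?_, ?_⟩
  · intro y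
    unfold boundedPart
    refine (abs_add_le _ _).trans ?_
    rw [abs_mul]
    gcongr
    by_cases hy : y = 0
    · simp [hy, hM0]
    · exact h1 _ (norm_pos_iff.2 hy)
  · intro x y hx hy
    unfold boundedPart
    rw [add_sub_add_left_eq_sub, ← mul_sub, abs_mul, mul_assoc]
    gcongr
    refine (h2 _ _ (norm_pos_iff.2 hx) (norm_pos_iff.2 hy)).trans ?_
    gcongr
    exact abs_norm_sub_norm_le x y

end SmoothCutoff

lemma invFourier_add {u v : E3 → ℂ} (hu : IsTest u) (hv : IsTest v) (y : E3) :
    invFourier (fun p => u p + v p) y = invFourier u y + invFourier v y := by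
  have h : ∀ {w : E3 → ℂ}, IsTest w →
      Integrable fun p : E3 => Complex.exp (Complex.I * (inner ℝ p y : ℝ)) * w p := fun hw =>
    (hw.continuous_mul (f := fun p : E3 => Complex.exp (Complex.I * (inner ℝ p y : ℝ)))
      (by fun_prop)).integrable
  simp only [invFourier, mul_add]
  rw [integral_add (h hu) (h hv), mul_add]

lemma invFourier_const_mul (c : ℂ) (u : E3 → ℂ) (y : E3) :
    invFourier (fun p => c * u p) y = c * invFourier u y := by
  simp only [invFourier, mul_left_comm _ c]
  rw [integral_const_mul, mul_left_comm]

lemma invFourier_shift (u : E3 → ℂ) (y a : E3) :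
    invFourier u (y + a)
      = invFourier (fun p => Complex.exp (Complex.I * (inner ℝ p a : ℝ)) * u p) y := by
  simp only [invFourier]
  congr 1
  refine integral_congr_ae (Filter.Eventually.of_forall fun p => ?_)
  simp only
  rw [inner_add_right, Complex.ofReal_add, mul_add, Complex.exp_add]
  ring

section FiniteDifference

variable {W : E3 → ℝ} {B L : ℝ} {u v : E3 → ℂ}

lemma memLp_mul_invFourier (hW : Measurable W) (hB : ∀ y, |W y| ≤ B) (hu : IsTest u) :
    MemLp (fun y => (W y : ℂ) * invFourier u y) 2 := by
  refine (memLp_invFourier hu).of_le_mul (c := B) ?_ (Filter.Eventually.of_forall fun y => ?_)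
  · exact (Complex.measurable_ofReal.comp hW).aestronglyMeasurable.mul (memLp_invFourier hu).1
  · rw [norm_mul, Complex.norm_real]
    gcongr
    exact hB y

lemma integrable_conj_mul {f g : E3 → ℂ} (hf : MemLp f 2) (hg : MemLp g 2) :
    Integrable fun y => conj (f y) * g y := by
  exact hf.star.integrable_mul hg

lemma integrable_norm_sq {f : E3 → ℂ} (hf : MemLp f 2) : Integrable fun y => ‖f y‖ ^ 2 :=
  hf.integrable_norm_pow (by norm_num)

/-- Multiplication by a bounded function, with a free parameter `s` in the
arithmetic-geometric mean inequality. -/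
lemma norm_integral_mul_le (hB : ∀ y, |W y| ≤ B) (hu : IsTest u)
    (hv : IsTest v) {s : ℝ} (hs : 0 < s) :
    ‖∫ y, conj (invFourier v y) * ((W y : ℂ) * invFourier u y)‖
      ≤ B * (s⁻¹ * (∫ p, ‖v p‖ ^ 2) + s * ∫ p, ‖u p‖ ^ 2) := by
  have hB0 : 0 ≤ B := (abs_nonneg _).trans (hB 0)
  have i1 := integrable_norm_sq (memLp_invFourier hu)
  have i2 := integrable_norm_sq (memLp_invFourier hv)
  rw [← integral_norm_invFourier_sq hu, ← integral_norm_invFourier_sq hv, ← integral_const_mul,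
    ← integral_const_mul, ← integral_add (i2.const_mul _) (i1.const_mul _), ← integral_const_mul]
  refine norm_integral_le_of_norm_le (((i2.const_mul _).add (i1.const_mul _)).const_mul _)
    (Filter.Eventually.of_forall fun y => ?_)
  rw [norm_mul, norm_mul, RCLike.norm_conj, Complex.norm_real, Real.norm_eq_abs]
  have h1 : ‖invFourier v y‖ * ‖invFourier u y‖
      ≤ s⁻¹ * ‖invFourier v y‖ ^ 2 + s * ‖invFourier u y‖ ^ 2 := by
    have e : s⁻¹ * ‖invFourier v y‖ ^ 2 + s * ‖invFourier u y‖ ^ 2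
        - ‖invFourier v y‖ * ‖invFourier u y‖
        = s⁻¹ * ((‖invFourier v y‖ - s * ‖invFourier u y‖ / 2) ^ 2
          + 3 / 4 * (s * ‖invFourier u y‖) ^ 2) := by field_simp; ring
    have : 0 ≤ s⁻¹ * ((‖invFourier v y‖ - s * ‖invFourier u y‖ / 2) ^ 2
          + 3 / 4 * (s * ‖invFourier u y‖) ^ 2) := by positivity
    linarith
  calc ‖invFourier v y‖ * (|W y| * ‖invFourier u y‖)
      = |W y| * (‖invFourier v y‖ * ‖invFourier u y‖) := by ring
    _ ≤ B * (s⁻¹ * ‖invFourier v y‖ ^ 2 + s * ‖invFourier u y‖ ^ 2) := by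
        gcongr
        exact hB y

/-- Summation by parts for the second difference in direction `a`. -/
lemma norm_integral_second_difference_le (hW : Measurable W) (hB : ∀ y, |W y| ≤ B) (hL0 : 0 ≤ L)
    (hL : ∀ x y, x ≠ 0 → y ≠ 0 → |W x - W y| ≤ L * ‖x - y‖) (hu : IsTest u) (a : E3) :
    ‖∫ y, conj (invFourier (fun p => ((2 - 2 * Real.cos (inner ℝ p a) : ℝ) : ℂ) * u p) y)
        * ((W y : ℂ) * invFourier u y)‖
      ≤ ‖a‖ ^ 2 * ((B + L) * ∫ p, (1 + ‖p‖ ^ 2) * ‖u p‖ ^ 2) := by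
  have hB0 : 0 ≤ B := (abs_nonneg _).trans (hB 0)
  set d : E3 → ℂ := fun p => Complex.exp (Complex.I * (inner ℝ p a : ℝ)) - 1 with hd
  have hdt : IsTest fun p => d p * u p := hu.continuous_mul (by fun_prop)
  set φ := invFourier u with hφ
  set δ := invFourier fun p => d p * u p with hδ
  have tr : ∀ b : E3, IsTest fun p => Complex.exp (Complex.I * (inner ℝ p b : ℝ)) * u p :=
    fun b => hu.continuous_mul (by fun_prop)
  have hδφ : ∀ y, δ y = φ (y + a) - φ y := by
    intro y
    rw [hφ, hδ, invFourier_shift]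
    have := invFourier_add (tr a) (hu.continuous_mul (f := fun _ => (-1 : ℂ)) (by fun_prop)) y
    rw [invFourier_const_mul] at this
    rw [sub_eq_add_neg, ← neg_one_mul (invFourier u y), ← this]
    congr 1
    funext p
    simp only [hd]
    ring
  have hD : ∀ y, invFourier (fun p => ((2 - 2 * Real.cos (inner ℝ p a) : ℝ) : ℂ) * u p) y
      = δ (y - a) - δ y := by
    intro y
    have h1 := invFourier_shift (fun p => d p * u p) y (-a)
    rw [← sub_eq_add_neg] at h1
    have t1 : IsTest fun p : E3 => Complex.exp (Complex.I * (inner ℝ p (-a) : ℝ)) * (d p * u p) :=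
      hdt.continuous_mul (by fun_prop)
    have := invFourier_add t1 (hdt.continuous_mul (f := fun _ => (-1 : ℂ)) (by fun_prop)) y
    rw [invFourier_const_mul] at this
    rw [hδ, h1, sub_eq_add_neg, ← neg_one_mul (invFourier (fun p => d p * u p) y), ← this]
    congr 1
    funext p
    have e : Complex.exp (Complex.I * (inner ℝ p a : ℝ))
        * Complex.exp (Complex.I * (inner ℝ p (-a) : ℝ)) = 1 := by
      rw [← Complex.exp_add, inner_neg_right]
      simp
    have e2 : (2 * Complex.cos (inner ℝ p a : ℝ)) = Complex.exp (Complex.I * (inner ℝ p a : ℝ))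
        + Complex.exp (Complex.I * (inner ℝ p (-a) : ℝ)) := by
      rw [Complex.two_cos, inner_neg_right]
      push_cast
      ring_nf
    have e3 : ((2 - 2 * Real.cos (inner ℝ p a) : ℝ) : ℂ)
        = 2 - 2 * Complex.cos (inner ℝ p a : ℝ) := by push_cast; ring
    rw [e3, e2]
    simp only [hd]
    linear_combination (-u p) * e
  have mδ : MemLp δ 2 := memLp_invFourier hdt
  have mδa : MemLp (fun y => δ (y - a)) 2 :=
    mδ.comp_measurePreserving (measurePreserving_sub_right volume a)
  have mWφ := memLp_mul_invFourier hW hB hu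
  have mWφa : MemLp (fun y => (W (y + a) : ℂ) * φ (y + a)) 2 :=
    mWφ.comp_measurePreserving (measurePreserving_add_right volume a)
  have e1 : ∫ y, conj (invFourier (fun p => ((2 - 2 * Real.cos (inner ℝ p a) : ℝ) : ℂ) * u p) y)
        * ((W y : ℂ) * φ y)
      = ∫ y, conj (δ y) * ((W (y + a) : ℂ) * φ (y + a) - (W y : ℂ) * φ y) := by
    simp_rw [hD, map_sub, sub_mul, mul_sub]
    rw [integral_sub (integrable_conj_mul mδa mWφ) (integrable_conj_mul mδ mWφ),
      integral_sub (integrable_conj_mul mδ mWφa) (integrable_conj_mul mδ mWφ),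
      ← integral_add_right_eq_self (fun y => conj (δ (y - a)) * ((W y : ℂ) * φ y)) a]
    simp only [add_sub_cancel_right]
  have i1 := integrable_norm_sq mδ
  have i2 := integrable_norm_sq (memLp_invFourier hu)
  have hae : ∀ᵐ y : E3, y ≠ 0 := by simp [ae_iff, measure_singleton]
  have haea : ∀ᵐ y : E3, y + a ≠ 0 :=
    (measurePreserving_add_right volume a).quasiMeasurePreserving.ae hae
  have b1 : ‖∫ y, conj (δ y) * ((W (y + a) : ℂ) * φ (y + a) - (W y : ℂ) * φ y)‖
      ≤ ∫ y, ((B + L / 2) * ‖δ y‖ ^ 2 + (L / 2 * ‖a‖ ^ 2) * ‖φ y‖ ^ 2) := by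
    refine norm_integral_le_of_norm_le ((i1.const_mul _).add (i2.const_mul _)) ?_
    filter_upwards [hae, haea] with y h1 h2
    have e : (W (y + a) : ℂ) * φ (y + a) - (W y : ℂ) * φ y
        = (W (y + a) : ℂ) * δ y + ((W (y + a) - W y : ℝ) : ℂ) * φ y := by
      rw [hδφ]; push_cast; ring
    have h3 := hL (y + a) y h2 h1
    rw [add_sub_cancel_left] at h3
    rw [e, norm_mul, RCLike.norm_conj]
    have h4 : ‖(W (y + a) : ℂ) * δ y + ((W (y + a) - W y : ℝ) : ℂ) * φ y‖
        ≤ B * ‖δ y‖ + L * ‖a‖ * ‖φ y‖ := by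
      refine (norm_add_le _ _).trans ?_
      rw [norm_mul, norm_mul, Complex.norm_real, Complex.norm_real]
      gcongr
      exact hB _
      exact h3
    have h5 := mul_le_mul_of_nonneg_left h4 (norm_nonneg (δ y))
    nlinarith [mul_nonneg hL0 (sq_nonneg (‖δ y‖ - ‖a‖ * ‖φ y‖))]
  have b2 : ∫ y, ‖δ y‖ ^ 2 ≤ ‖a‖ ^ 2 * ∫ p, ‖p‖ ^ 2 * ‖u p‖ ^ 2 := by
    rw [hδ, integral_norm_invFourier_sq hdt, ← integral_const_mul]
    refine integral_mono (integrable_norm_sq (hdt.memLp 2))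
      ((hu.integrable_weight (by fun_prop)).const_mul _) fun p => ?_
    simp only
    have h1 : ‖d p‖ ≤ ‖p‖ * ‖a‖ := by
      refine (Real.norm_exp_I_mul_ofReal_sub_one_le).trans ?_
      exact abs_real_inner_le_norm p a
    rw [norm_mul, mul_pow]
    calc ‖d p‖ ^ 2 * ‖u p‖ ^ 2 ≤ (‖p‖ * ‖a‖) ^ 2 * ‖u p‖ ^ 2 := by gcongr
      _ = ‖a‖ ^ 2 * (‖p‖ ^ 2 * ‖u p‖ ^ 2) := by ring
  have e2 : ∫ y, ‖φ y‖ ^ 2 = ∫ p, ‖u p‖ ^ 2 := integral_norm_invFourier_sq hu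
  have e3 : ∫ p, (1 + ‖p‖ ^ 2) * ‖u p‖ ^ 2 = (∫ p, ‖u p‖ ^ 2) + ∫ p, ‖p‖ ^ 2 * ‖u p‖ ^ 2 := by
    rw [← integral_add (integrable_norm_sq (hu.memLp 2)) (hu.integrable_weight (by fun_prop))]
    refine integral_congr_ae (Filter.Eventually.of_forall fun p => ?_)
    simp only
    ring
  rw [integral_add (i1.const_mul _) (i2.const_mul _), integral_const_mul, integral_const_mul,
    e2] at b1
  rw [e1, e3]
  refine b1.trans ?_
  have n1 : 0 ≤ ∫ p, ‖u p‖ ^ 2 := integral_nonneg fun p => by positivity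
  have n2 : 0 ≤ ∫ p : E3, ‖p‖ ^ 2 * ‖u p‖ ^ 2 := integral_nonneg fun p => by positivity
  have h1 := mul_le_mul_of_nonneg_left b2 (by positivity : 0 ≤ B + L / 2)
  have h2 : 0 ≤ ‖a‖ ^ 2 := by positivity
  nlinarith [mul_nonneg h2 (mul_nonneg hL0 n1), mul_nonneg h2 (mul_nonneg hL0 n2),
    mul_nonneg h2 (mul_nonneg hB0 n1)]

/-- The bound for one second derivative. The symbol `p_i²` is approximated by that of the second
difference `h⁻² (2 - 2 cos (h p_i))`, which can be summed by parts against the merely Lipschitz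
function `W`, with constants independent of `h`. -/
lemma norm_integral_coord_sq_le (hW : Measurable W) (hB : ∀ y, |W y| ≤ B) (hL0 : 0 ≤ L)
    (hL : ∀ x y, x ≠ 0 → y ≠ 0 → |W x - W y| ≤ L * ‖x - y‖) (hu : IsTest u) (i : Fin 3) :
    ‖∫ y, conj (invFourier (fun p => ((p i ^ 2 : ℝ) : ℂ) * u p) y)
        * ((W y : ℂ) * invFourier u y)‖
      ≤ (B + L) * ∫ p, (1 + ‖p‖ ^ 2) * ‖u p‖ ^ 2 := by
  have hB0 : 0 ≤ B := (abs_nonneg _).trans (hB 0)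
  obtain ⟨R, hR⟩ := hu.supp.isCompact.isBounded.exists_norm_le
  obtain ⟨R, hR0, hR⟩ : ∃ R : ℝ, 0 < R ∧ ∀ x ∈ tsupport u, ‖x‖ ≤ R :=
    ⟨max R 1, by positivity, fun x hx => (hR x hx).trans (le_max_left _ _)⟩
  set K := (B + L) * ∫ p, (1 + ‖p‖ ^ 2) * ‖u p‖ ^ 2 with hK
  set N := ∫ p, ‖u p‖ ^ 2 with hN
  -- the error of replacing `p_i²` by the symbol of the second difference with step `h`
  have step : ∀ h : ℝ, 0 < h → h * R ≤ 1 →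
      ‖∫ y, conj (invFourier (fun p => ((p i ^ 2 : ℝ) : ℂ) * u p) y)
        * ((W y : ℂ) * invFourier u y)‖ ≤ K + B * (h ^ 2 * (R ^ 8 * N + N)) := by
    intro h hh hhR
    set a : E3 := EuclideanSpace.single i h with ha
    have hna : ‖a‖ = h := by rw [ha]; simp [abs_of_pos hh]
    have hin : ∀ p : E3, inner ℝ p a = h * p i := by
      intro p; rw [ha]; simp [EuclideanSpace.inner_single_right]
    set m : E3 → ℝ := fun p => 2 - 2 * Real.cos (inner ℝ p a) with hm
    have hmc : Continuous m := by rw [hm]; fun_prop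
    set r : E3 → ℝ := fun p => p i ^ 2 - (h ^ 2)⁻¹ * m p with hr
    have hrc : Continuous r := by rw [hr]; fun_prop
    have tm : IsTest fun p => (m p : ℂ) * u p :=
      hu.continuous_mul (Complex.continuous_ofReal.comp hmc)
    have tr : IsTest fun p => (r p : ℂ) * u p :=
      hu.continuous_mul (Complex.continuous_ofReal.comp hrc)
    have tm' : IsTest fun p => (((h ^ 2)⁻¹ : ℝ) : ℂ) * ((m p : ℂ) * u p) :=
      tm.continuous_mul continuous_const
    have split : ∀ y, invFourier (fun p => ((p i ^ 2 : ℝ) : ℂ) * u p) y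
        = invFourier (fun p => (r p : ℂ) * u p) y
          + (((h ^ 2)⁻¹ : ℝ) : ℂ) * invFourier (fun p => (m p : ℂ) * u p) y := by
      intro y
      rw [← invFourier_const_mul, ← invFourier_add tr tm']
      congr 1
      funext p
      simp only [hr]
      push_cast
      ring
    have mW := memLp_mul_invFourier hW hB hu
    have e : ∫ y, conj (invFourier (fun p => ((p i ^ 2 : ℝ) : ℂ) * u p) y)
          * ((W y : ℂ) * invFourier u y)
        = (∫ y, conj (invFourier (fun p => (r p : ℂ) * u p) y) * ((W y : ℂ) * invFourier u y))
          + (((h ^ 2)⁻¹ : ℝ) : ℂ) * ∫ y, conj (invFourier (fun p => (m p : ℂ) * u p) y)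
              * ((W y : ℂ) * invFourier u y) := by
      rw [← integral_const_mul, ← integral_add (integrable_conj_mul (memLp_invFourier tr) mW)
        ((integrable_conj_mul (memLp_invFourier tm) mW).const_mul _)]
      refine integral_congr_ae (Filter.Eventually.of_forall fun y => ?_)
      simp only
      rw [split, map_add, map_mul, Complex.conj_ofReal]
      ring
    have b1 := norm_integral_second_difference_le hW hB hL0 hL hu a
    rw [hna] at b1
    have b2 := norm_integral_mul_le hB hu tr (s := h ^ 2) (by positivity)
    have b3 : ∫ p, ‖(r p : ℂ) * u p‖ ^ 2 ≤ h ^ 4 * R ^ 8 * N := by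
      rw [hN, ← integral_const_mul]
      refine integral_mono (integrable_norm_sq (tr.memLp 2))
        ((integrable_norm_sq (hu.memLp 2)).const_mul _) fun p => ?_
      simp only
      by_cases hp : u p = 0
      · simp [hp]
      have hpR := hR p (subset_tsupport _ hp)
      have hpi : |p i| ≤ R := (by simpa using PiLp.norm_apply_le p i : |p i| ≤ ‖p‖).trans hpR
      have hx : |h * p i| ≤ 1 := by
        rw [abs_mul, abs_of_pos hh]
        exact (mul_le_mul_of_nonneg_left hpi hh.le).trans hhR
      have hcos := Real.cos_bound hx
      have hrb : |r p| ≤ h ^ 2 * R ^ 4 := by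
        have e : r p = (h ^ 2)⁻¹ * (2 * (Real.cos (h * p i) - (1 - (h * p i) ^ 2 / 2))) := by
          simp only [hr, hm, hin]
          field_simp
          ring
        rw [e, abs_mul, abs_mul, abs_of_pos (by positivity : 0 < (h ^ 2)⁻¹),
          abs_of_pos (by norm_num : (0 : ℝ) < 2), inv_mul_le_iff₀ (by positivity)]
        have h1 : |h * p i| ^ 4 ≤ h ^ 4 * R ^ 4 := by
          rw [abs_mul, abs_of_pos hh, mul_pow]
          gcongr
        have h2 : 0 ≤ |h * p i| ^ 4 := by positivity
        nlinarith
      rw [norm_mul, Complex.norm_real, mul_pow, Real.norm_eq_abs]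
      calc |r p| ^ 2 * ‖u p‖ ^ 2 ≤ (h ^ 2 * R ^ 4) ^ 2 * ‖u p‖ ^ 2 := by gcongr
        _ = h ^ 4 * R ^ 8 * ‖u p‖ ^ 2 := by ring
    rw [e]
    refine (norm_add_le _ _).trans ?_
    rw [norm_mul, Complex.norm_real, Real.norm_of_nonneg (by positivity : 0 ≤ (h ^ 2)⁻¹), add_comm]
    refine add_le_add ?_ (b2.trans ?_)
    · rw [inv_mul_le_iff₀ (by positivity)]
      exact b1
    · gcongr
      calc (h ^ 2)⁻¹ * (∫ p, ‖(r p : ℂ) * u p‖ ^ 2) + h ^ 2 * N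
          ≤ (h ^ 2)⁻¹ * (h ^ 4 * R ^ 8 * N) + h ^ 2 * N := by gcongr
        _ = h ^ 2 * (R ^ 8 * N + N) := by field_simp
  have lim : Filter.Tendsto (fun h : ℝ => K + B * (h ^ 2 * (R ^ 8 * N + N)))
      (nhdsWithin 0 (Set.Ioi 0)) (nhds K) := by
    have : Continuous fun h : ℝ => K + B * (h ^ 2 * (R ^ 8 * N + N)) := by fun_prop
    have h := this.tendsto 0
    simp only [ne_eq, OfNat.ofNat_ne_zero, not_false_eq_true, zero_pow, zero_mul, mul_zero,
      add_zero] at h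
    exact h.mono_left nhdsWithin_le_nhds
  refine ge_of_tendsto lim ?_
  have hsmall : ∀ᶠ h : ℝ in nhdsWithin 0 (Set.Ioi 0), h < R⁻¹ :=
    nhdsWithin_le_nhds (gt_mem_nhds (by positivity))
  filter_upwards [hsmall, self_mem_nhdsWithin] with h h1 h2
  refine step h h2 ?_
  rw [← inv_mul_cancel₀ hR0.ne']
  gcongr

/-- A bounded Lipschitz potential contributes a term of the order of the `H¹` norm when the form
is tested with `-Δφ`. -/
lemma norm_integral_norm_sq_le (hW : Measurable W) (hB : ∀ y, |W y| ≤ B) (hL0 : 0 ≤ L)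
    (hL : ∀ x y, x ≠ 0 → y ≠ 0 → |W x - W y| ≤ L * ‖x - y‖) (hu : IsTest u) :
    ‖∫ y, conj (invFourier (fun p => ((‖p‖ ^ 2 : ℝ) : ℂ) * u p) y)
        * ((W y : ℂ) * invFourier u y)‖
      ≤ 3 * (B + L) * ∫ p, (1 + ‖p‖ ^ 2) * ‖u p‖ ^ 2 := by
  have t : ∀ i : Fin 3, IsTest fun p => ((p i ^ 2 : ℝ) : ℂ) * u p := fun i =>
    hu.continuous_mul (Complex.continuous_ofReal.comp (by fun_prop))
  have split : ∀ y, invFourier (fun p => ((‖p‖ ^ 2 : ℝ) : ℂ) * u p) y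
      = invFourier (fun p => ((p 0 ^ 2 : ℝ) : ℂ) * u p) y
        + invFourier (fun p => ((p 1 ^ 2 : ℝ) : ℂ) * u p) y
        + invFourier (fun p => ((p 2 ^ 2 : ℝ) : ℂ) * u p) y := by
    intro y
    have t01 : IsTest fun p => ((p 0 ^ 2 : ℝ) : ℂ) * u p + ((p 1 ^ 2 : ℝ) : ℂ) * u p := by
      have := hu.continuous_mul (f := fun p : E3 => ((p 0 ^ 2 + p 1 ^ 2 : ℝ) : ℂ))
        (Complex.continuous_ofReal.comp (by fun_prop))
      convert this using 2 with p
      push_cast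
      ring
    rw [← invFourier_add (t 0) (t 1), ← invFourier_add t01 (t 2)]
    congr 1
    funext p
    rw [EuclideanSpace.real_norm_sq_eq, Fin.sum_univ_three]
    push_cast
    ring
  have mW := memLp_mul_invFourier hW hB hu
  have ii : ∀ i : Fin 3, Integrable fun y => conj (invFourier (fun p => ((p i ^ 2 : ℝ) : ℂ) * u p) y)
        * ((W y : ℂ) * invFourier u y) := fun i => integrable_conj_mul (memLp_invFourier (t i)) mW
  have e : ∫ y, conj (invFourier (fun p => ((‖p‖ ^ 2 : ℝ) : ℂ) * u p) y)
        * ((W y : ℂ) * invFourier u y)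
      = ∑ i : Fin 3, ∫ y, conj (invFourier (fun p => ((p i ^ 2 : ℝ) : ℂ) * u p) y)
        * ((W y : ℂ) * invFourier u y) := by
    rw [← integral_finsetSum _ fun i _ => ii i]
    refine integral_congr_ae (Filter.Eventually.of_forall fun y => ?_)
    simp only [Fin.sum_univ_three]
    rw [split, map_add, map_add, add_mul, add_mul]
  rw [e, Fin.sum_univ_three]
  have b := norm_integral_coord_sq_le hW hB hL0 hL hu
  refine (norm_add₃_le).trans ?_
  linarith [b 0, b 1, b 2]

end FiniteDifference

/-! ### Bessel potentials -/

lemma memLp_bounded_mul {m : E3 → ℝ} (hm : Continuous m) {C : ℝ} (hC : ∀ p, |m p| ≤ C) (g : L2) :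
    MemLp (fun p => (m p : ℂ) * g p) 2 :=
  (Lp.memLp g).of_le_mul (c := C)
    ((Complex.continuous_ofReal.comp hm).aestronglyMeasurable.mul (Lp.memLp g).1)
    (Filter.Eventually.of_forall fun p => by
      rw [norm_mul, Complex.norm_real]
      exact mul_le_mul_of_nonneg_right (hC p) (norm_nonneg _))

/-- Multiplication by a bounded continuous real function as an operator on `L²`. -/
def mulCLM (m : E3 → ℝ) (hm : Continuous m) (C : ℝ) (hC : ∀ p, |m p| ≤ C) : L2 →L[ℂ] L2 :=
  LinearMap.mkContinuous
    { toFun := fun g => (memLp_bounded_mul hm hC g).toLp _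
      map_add' := fun g h => by
        refine Lp.ext ?_
        filter_upwards [(memLp_bounded_mul hm hC (g + h)).coeFn_toLp,
          (memLp_bounded_mul hm hC g).coeFn_toLp, (memLp_bounded_mul hm hC h).coeFn_toLp,
          Lp.coeFn_add g h, Lp.coeFn_add ((memLp_bounded_mul hm hC g).toLp _)
            ((memLp_bounded_mul hm hC h).toLp _)] with p a b c d e
        rw [a, e, Pi.add_apply, b, c, d, Pi.add_apply, mul_add]
      map_smul' := fun c g => by
        refine Lp.ext ?_
        filter_upwards [(memLp_bounded_mul hm hC (c • g)).coeFn_toLp,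
          (memLp_bounded_mul hm hC g).coeFn_toLp, Lp.coeFn_smul c g,
          Lp.coeFn_smul c ((memLp_bounded_mul hm hC g).toLp _)] with p a b d e
        simp only [RingHom.id_apply]
        rw [a, e, Pi.smul_apply, b, d, Pi.smul_apply, smul_eq_mul, smul_eq_mul, mul_left_comm] }
    C (fun g => by
      refine Lp.norm_le_mul_norm_of_ae_le_mul ?_
      filter_upwards [(memLp_bounded_mul hm hC g).coeFn_toLp] with p hp
      simp only [LinearMap.coe_mk, AddHom.coe_mk]
      rw [hp, norm_mul, Complex.norm_real]
      exact mul_le_mul_of_nonneg_right (hC p) (norm_nonneg _))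

lemma mulCLM_ae {m : E3 → ℝ} {hm : Continuous m} {C : ℝ} {hC : ∀ p, |m p| ≤ C} (g : L2) :
    ∀ᵐ p, mulCLM m hm C hC g p = (m p : ℂ) * g p := by
  exact (memLp_bounded_mul hm hC g).coeFn_toLp

lemma norm_mulCLM_le {m : E3 → ℝ} {hm : Continuous m} {C : ℝ} {hC : ∀ p, |m p| ≤ C} (g : L2) :
    ‖mulCLM m hm C hC g‖ ≤ C * ‖g‖ := by
  refine Lp.norm_le_mul_norm_of_ae_le_mul ?_
  filter_upwards [mulCLM_ae g] with p hp
  rw [hp, norm_mul, Complex.norm_real]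
  exact mul_le_mul_of_nonneg_right (hC p) (norm_nonneg _)

lemma continuous_bracket (s : ℝ) : Continuous fun p : E3 => (1 + ‖p‖ ^ 2) ^ s := by
  refine Continuous.rpow_const (by fun_prop) fun p => Or.inl ?_
  positivity

lemma bracket_pos (s : ℝ) (p : E3) : 0 < (1 + ‖p‖ ^ 2) ^ s := by positivity

lemma bracket_add (s t : ℝ) (p : E3) :
    (1 + ‖p‖ ^ 2) ^ s * (1 + ‖p‖ ^ 2) ^ t = (1 + ‖p‖ ^ 2) ^ (s + t) := by
  rw [← Real.rpow_add (by positivity)]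

lemma bracket_sq (s : ℝ) (p : E3) :
    ((1 + ‖p‖ ^ 2) ^ s) ^ 2 = (1 + ‖p‖ ^ 2) ^ (s + s) := by
  rw [pow_two ((1 + ‖p‖ ^ 2) ^ s), bracket_add]

lemma abs_bracket_neg_le {s : ℝ} (hs : 0 ≤ s) (p : E3) : |(1 + ‖p‖ ^ 2) ^ (-s)| ≤ 1 := by
  rw [abs_of_pos (bracket_pos _ _)]
  exact Real.rpow_le_one_of_one_le_of_nonpos (by nlinarith [sq_nonneg ‖p‖]) (by linarith)

/-- Multiplication by `(1 + p²)^(-s)`, `s ≥ 0`. -/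
def bracketCLM (s : NNReal) : L2 →L[ℂ] L2 :=
  mulCLM (fun p => (1 + ‖p‖ ^ 2) ^ (-(s : ℝ))) (continuous_bracket _) 1
    (abs_bracket_neg_le s.coe_nonneg)

/-- The inverse of the unitary Fourier transform `fhat`, as a linear isometry of `L²`. -/
def invFhat : L2 →ₗᵢ[ℂ] L2 where
  toFun g := ofFhat (Lp.memLp g)
  map_add' g h := by
    refine (eq_ofFhat _ ?_).symm
    filter_upwards [fhat_add (ofFhat (Lp.memLp g)) (ofFhat (Lp.memLp h)),
      fhat_ofFhat (Lp.memLp g), fhat_ofFhat (Lp.memLp h), Lp.coeFn_add g h] with p a b c d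
    rw [a, b, c, d, Pi.add_apply]
  map_smul' c g := by
    refine (eq_ofFhat _ ?_).symm
    filter_upwards [fhat_smul c (ofFhat (Lp.memLp g)),
      fhat_ofFhat (Lp.memLp g), Lp.coeFn_smul c g] with p a b d
    simp only [RingHom.id_apply]
    rw [a, b, d, Pi.smul_apply, smul_eq_mul]
  norm_map' g := by
    have h := integral_conj_fhat_mul_fhat (ofFhat (Lp.memLp g)) (ofFhat (Lp.memLp g))
    have e : inner ℂ g g = ∫ p, conj (fhat (ofFhat (Lp.memLp g)) p)
        * fhat (ofFhat (Lp.memLp g)) p := by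
      rw [L2.inner_def]
      refine integral_congr_ae ?_
      filter_upwards [fhat_ofFhat (Lp.memLp g)] with p hp
      rw [hp, RCLike.inner_apply, mul_comm]
    simp only [LinearMap.coe_mk, AddHom.coe_mk]
    rw [@norm_eq_sqrt_re_inner ℂ, ← h, ← e, ← @norm_eq_sqrt_re_inner ℂ]

lemma fhat_invFhat (g : L2) : ∀ᵐ p, fhat (invFhat g) p = g p := fhat_ofFhat (Lp.memLp g)

/-- The Bessel potential `(1 - Δ)^(-s)`, precomposed with the inverse Fourier transform: a unitary
map from `L²` onto the Sobolev space `H^(2s)`. -/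
def bessel (s : NNReal) : L2 →L[ℂ] L2 :=
  invFhat.toContinuousLinearMap ∘L bracketCLM s

lemma fhat_bessel (s : NNReal) (g : L2) :
    ∀ᵐ p, fhat (bessel s g) p = (((1 + ‖p‖ ^ 2) ^ (-(s : ℝ)) : ℝ) : ℂ) * g p := by
  filter_upwards [fhat_invFhat (bracketCLM s g), mulCLM_ae g
    (hm := continuous_bracket (-(s : ℝ))) (hC := abs_bracket_neg_le s.coe_nonneg)] with p a b
  exact a.trans b

lemma bracket_mul_norm_fhat_bessel_sq (s : NNReal) (g : L2) :
    ∀ᵐ p, (1 + ‖p‖ ^ 2) ^ (2 * (s : ℝ)) * ‖fhat (bessel s g) p‖ ^ 2 = ‖g p‖ ^ 2 := by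
  filter_upwards [fhat_bessel s g] with p hp
  have h0 := bracket_pos (-(s : ℝ)) p
  rw [hp, norm_mul, Complex.norm_real, Real.norm_of_nonneg h0.le, mul_pow, ← mul_assoc,
    bracket_sq, bracket_add]
  have : 2 * (s : ℝ) + (-(s : ℝ) + -(s : ℝ)) = 0 := by ring
  rw [this, Real.rpow_zero, one_mul]

lemma integral_norm_sq_eq (g : L2) : ∫ p, ‖g p‖ ^ 2 = ‖g‖ ^ 2 := by
  have h := @inner_self_eq_norm_sq ℂ _ _ _ _ g
  rw [← h, L2.inner_def]
  have e : ∀ p, inner ℂ (g p) (g p) = ((‖g p‖ ^ 2 : ℝ) : ℂ) := by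
    intro p
    rw [RCLike.inner_apply, Complex.mul_conj, Complex.normSq_eq_norm_sq]
  simp_rw [e]
  rw [integral_complex_ofReal]
  simp

lemma memH_bessel (s : NNReal) (g : L2) : MemH (2 * s) (bessel s g) :=
  (integrable_norm_sq (Lp.memLp g)).congr
    ((bracket_mul_norm_fhat_bessel_sq s g).mono fun _ h => h.symm)

lemma normH_bessel (s : NNReal) (g : L2) : normH (2 * s) (bessel s g) = ‖g‖ := by
  rw [normH, integral_congr_ae (bracket_mul_norm_fhat_bessel_sq s g), integral_norm_sq_eq,
    Real.sqrt_sq (norm_nonneg _)]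

lemma exists_eq_bessel (s : NNReal) {ξ : L2} (h : MemH (2 * s) ξ) : ∃ g, ξ = bessel s g := by
  have hm : MemLp (fun p => (((1 + ‖p‖ ^ 2) ^ (s : ℝ) : ℝ) : ℂ) * fhat ξ p) 2 := by
    have hmeas : AEStronglyMeasurable
        (fun p => (((1 + ‖p‖ ^ 2) ^ (s : ℝ) : ℝ) : ℂ) * fhat ξ p) volume :=
      (Complex.continuous_ofReal.comp (continuous_bracket _)).aestronglyMeasurable.mul
        (memLp_fhat ξ).1
    rw [memLp_two_iff_integrable_sq_norm hmeas]
    refine h.congr (Filter.Eventually.of_forall fun p => ?_)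
    simp only
    rw [norm_mul, Complex.norm_real, Real.norm_of_nonneg (bracket_pos _ _).le, mul_pow,
      bracket_sq, two_mul]
  refine ⟨hm.toLp _, eq_of_fhat_ae_eq ?_⟩
  filter_upwards [fhat_bessel s (hm.toLp _), hm.coeFn_toLp] with p a b
  rw [a, b, ← mul_assoc, ← Complex.ofReal_mul, bracket_add, neg_add_cancel, Real.rpow_zero,
    Complex.ofReal_one, one_mul]

/-- The class in `L²` of a test function. -/
def IsTest.toL2 {u : E3 → ℂ} (hu : IsTest u) : L2 := (hu.memLp 2).toLp u

lemma dense_isTest : Dense {g : L2 | ∃ (u : E3 → ℂ) (hu : IsTest u), g = hu.toL2} := by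
  rw [Metric.dense_iff]
  intro g ε hε
  obtain ⟨u, hus, hu, huc, hum⟩ := (Lp.memLp g).exists_hasCompactSupport_eLpNorm_sub_le
    (by norm_num) (ε := ENNReal.ofReal (ε / 2)) (by simpa using hε)
  refine ⟨IsTest.toL2 ⟨huc, hus⟩, ?_, u, ⟨huc, hus⟩, rfl⟩
  rw [Metric.mem_ball, dist_comm, dist_eq_norm, Lp.norm_def]
  have e : eLpNorm (g - IsTest.toL2 ⟨huc, hus⟩ : L2) 2 volume = eLpNorm (fun p => g p - u p) 2 := by
    refine eLpNorm_congr_ae ?_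
    filter_upwards [Lp.coeFn_sub g (IsTest.toL2 ⟨huc, hus⟩), hum.coeFn_toLp] with p a b
    rw [a, Pi.sub_apply]
    exact congrArg (g p - ·) b
  rw [e]
  exact lt_of_le_of_lt (ENNReal.toReal_le_of_le_ofReal (by positivity) hu) (by linarith)

lemma fhat_bessel_toL2 (s : NNReal) {u : E3 → ℂ} (hu : IsTest u) :
    ∀ᵐ p, fhat (bessel s hu.toL2) p = (((1 + ‖p‖ ^ 2) ^ (-(s : ℝ)) : ℝ) : ℂ) * u p := by
  filter_upwards [fhat_bessel s hu.toL2, (hu.memLp 2).coeFn_toLp] with p a b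
  rw [a, IsTest.toL2, b]

lemma norm_le_bracket (p : E3) : ‖p‖ ≤ (1 + ‖p‖ ^ 2) ^ (1 / 2 : ℝ) := by
  rw [← Real.sqrt_eq_rpow]
  exact Real.le_sqrt_of_sq_le (by linarith)

/-- Kato's inequality on `H^(1/2)`. -/
lemma lintegral_kato_bessel (g : L2) :
    ∫⁻ y, ‖bessel (1 / 4) g y‖ₑ ^ 2 * ENNReal.ofReal ‖y‖⁻¹
      ≤ ENNReal.ofReal (22 * sphereArea * ‖g‖ ^ 2) := by
  have hS := sphereArea_nonneg
  have test : ∀ (u : E3 → ℂ) (hu : IsTest u),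
      ∫⁻ y, ‖bessel (1 / 4) hu.toL2 y‖ₑ ^ 2 * ENNReal.ofReal ‖y‖⁻¹
        ≤ ENNReal.ofReal (22 * sphereArea * ‖hu.toL2‖ ^ 2) := by
    intro u hu
    have hv : IsTest fun p => (((1 + ‖p‖ ^ 2) ^ (-((1 / 4 : NNReal) : ℝ)) : ℝ) : ℂ) * u p :=
      hu.continuous_mul (Complex.continuous_ofReal.comp (continuous_bracket _))
    have h1 : ∫⁻ y, ‖bessel (1 / 4) hu.toL2 y‖ₑ ^ 2 * ENNReal.ofReal ‖y‖⁻¹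
        = ∫⁻ y, ‖invFourier
          (fun p => (((1 + ‖p‖ ^ 2) ^ (-((1 / 4 : NNReal) : ℝ)) : ℝ) : ℂ) * u p) y‖ₑ ^ 2
            * ENNReal.ofReal ‖y‖⁻¹ := by
      refine lintegral_congr_ae ?_
      filter_upwards [ae_eq_invFourier hv (fhat_bessel_toL2 (1 / 4) hu)] with y hy
      rw [hy]
    rw [h1]
    refine (lintegral_kato hv).trans (ENNReal.ofReal_le_ofReal ?_)
    gcongr
    rw [← integral_norm_sq_eq]
    refine integral_mono_ae hv.integrable_norm_weight (integrable_norm_sq (Lp.memLp _)) ?_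
    filter_upwards [(hu.memLp 2).coeFn_toLp] with p hp
    rw [IsTest.toL2, hp, norm_mul, Complex.norm_real, Real.norm_of_nonneg (bracket_pos _ _).le,
      mul_pow, bracket_sq, ← mul_assoc]
    have h2 : ‖p‖ * (1 + ‖p‖ ^ 2) ^ (-((1 / 4 : NNReal) : ℝ) + -((1 / 4 : NNReal) : ℝ)) ≤ 1 := by
      calc _ ≤ (1 + ‖p‖ ^ 2) ^ (1 / 2 : ℝ) *
            (1 + ‖p‖ ^ 2) ^ (-((1 / 4 : NNReal) : ℝ) + -((1 / 4 : NNReal) : ℝ)) := by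
            gcongr
            exact norm_le_bracket p
        _ = 1 := by
            rw [bracket_add]
            norm_num
    calc _ ≤ 1 * ‖u p‖ ^ 2 := by gcongr
      _ = _ := one_mul _
  obtain ⟨x, hx, hlim⟩ := mem_closure_iff_seq_limit.1 (dense_isTest g)
  have hlim2 : Filter.Tendsto (fun n => bessel (1 / 4) (x n)) Filter.atTop
      (nhds (bessel (1 / 4) g)) := ((bessel (1 / 4)).continuous.tendsto g).comp hlim
  obtain ⟨ns, hns, hae⟩ := (tendstoInMeasure_of_tendsto_Lp hlim2).exists_seq_tendsto_ae
  have hm : ∀ h : L2, AEMeasurable fun y => ‖bessel (1 / 4) h y‖ₑ ^ 2 * ENNReal.ofReal ‖y‖⁻¹ :=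
    fun h => ((Lp.aestronglyMeasurable _).enorm.pow_const 2).mul (by fun_prop)
  calc ∫⁻ y, ‖bessel (1 / 4) g y‖ₑ ^ 2 * ENNReal.ofReal ‖y‖⁻¹
      = ∫⁻ y, Filter.liminf (fun n => ‖bessel (1 / 4) (x (ns n)) y‖ₑ ^ 2
          * ENNReal.ofReal ‖y‖⁻¹) Filter.atTop := by
        refine lintegral_congr_ae ?_
        filter_upwards [hae] with y hy
        refine (Filter.Tendsto.liminf_eq ?_).symm
        have h1 : Filter.Tendsto (fun n => ‖bessel (1 / 4) (x (ns n)) y‖ₑ ^ 2) Filter.atTop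
            (nhds (‖bessel (1 / 4) g y‖ₑ ^ 2)) :=
          (ENNReal.continuous_pow 2).continuousAt.tendsto.comp hy.enorm
        exact ENNReal.Tendsto.mul_const h1 (Or.inr ENNReal.ofReal_ne_top)
    _ ≤ Filter.liminf (fun n => ∫⁻ y, ‖bessel (1 / 4) (x (ns n)) y‖ₑ ^ 2
          * ENNReal.ofReal ‖y‖⁻¹) Filter.atTop := lintegral_liminf_le' fun n => hm _
    _ ≤ Filter.liminf (fun n => ENNReal.ofReal (22 * sphereArea * ‖x (ns n)‖ ^ 2))
          Filter.atTop := by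
        refine Filter.liminf_le_liminf (Filter.Eventually.of_forall fun n => ?_)
        obtain ⟨u, hu, e⟩ := hx (ns n)
        rw [e]
        exact test u hu
    _ = ENNReal.ofReal (22 * sphereArea * ‖g‖ ^ 2) := by
        refine Filter.Tendsto.liminf_eq ?_
        have h1 := (hlim.comp hns.tendsto_atTop).norm
        exact ENNReal.tendsto_ofReal ((h1.pow 2).const_mul _)

/-! ### Boundedness of the form -/

/-- A sesquilinear integral expression which is bounded by the squares of the norms is a bounded
sesquilinear form. -/
lemma exists_sesquilinear {X : Type*} [MeasurableSpace X] {μ : Measure X} {A B : L2 → X → ℂ}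
    {k : X → ℂ} (hA : ∀ g h, ∀ᵐ x ∂μ, A (g + h) x = A g x + A h x)
    (hA' : ∀ c g, ∀ᵐ x ∂μ, A (c • g) x = c * A g x)
    (hB : ∀ g h, ∀ᵐ x ∂μ, B (g + h) x = B g x + B h x)
    (hB' : ∀ c g, ∀ᵐ x ∂μ, B (c • g) x = c * B g x)
    (hi : ∀ g h, Integrable (fun x => conj (A g x) * (k x * B h x)) μ) {C : ℝ}
    (hC : ∀ g h, ‖∫ x, conj (A g x) * (k x * B h x) ∂μ‖ ≤ C * (‖g‖ ^ 2 + ‖h‖ ^ 2)) :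
    ∃ a : L2 →L⋆[ℂ] L2 →L[ℂ] ℂ, ∀ g h, a g h = ∫ x, conj (A g x) * (k x * B h x) ∂μ := by
  set b : L2 →ₗ⋆[ℂ] L2 →ₗ[ℂ] ℂ := LinearMap.mk₂'ₛₗ (starRingEnd ℂ) (RingHom.id ℂ)
    (fun g h => ∫ x, conj (A g x) * (k x * B h x) ∂μ)
    (fun g g' h => by
      rw [← integral_add (hi _ _) (hi _ _)]
      refine integral_congr_ae ?_
      filter_upwards [hA g g'] with x hx
      rw [hx, map_add, add_mul])
    (fun c g h => by
      rw [smul_eq_mul, ← integral_const_mul]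
      refine integral_congr_ae ?_
      filter_upwards [hA' c g] with x hx
      rw [hx, map_mul, mul_assoc])
    (fun g h h' => by
      rw [← integral_add (hi _ _) (hi _ _)]
      refine integral_congr_ae ?_
      filter_upwards [hB h h'] with x hx
      rw [hx, mul_add, mul_add])
    (fun c g h => by
      rw [RingHom.id_apply, smul_eq_mul, ← integral_const_mul]
      refine integral_congr_ae ?_
      filter_upwards [hB' c h] with x hx
      rw [hx]
      ring) with hb
  have hbv : ∀ g h, b g h = ∫ x, conj (A g x) * (k x * B h x) ∂μ := fun g h => rfl
  have bound : ∀ g h, ‖b g h‖ ≤ (2 * C) * ‖g‖ * ‖h‖ := by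
    intro g h
    by_cases hg : g = 0
    · simp [hg]
    by_cases hh : h = 0
    · simp [hh]
    have ng : 0 < ‖g‖ := norm_pos_iff.2 hg
    have nh : 0 < ‖h‖ := norm_pos_iff.2 hh
    have h1 := hC (((‖g‖⁻¹ : ℝ) : ℂ) • g) (((‖h‖⁻¹ : ℝ) : ℂ) • h)
    rw [← hbv, (b _).map_smul, b.map_smulₛₗ, LinearMap.smul_apply, norm_smul, norm_smul, norm_smul,
      norm_smul, RCLike.norm_conj, Complex.norm_real, Complex.norm_real, norm_inv, norm_inv,
      norm_norm, norm_norm, inv_mul_cancel₀ ng.ne', inv_mul_cancel₀ nh.ne'] at h1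
    rw [inv_mul_le_iff₀ nh, inv_mul_le_iff₀ ng] at h1
    exact h1.trans (le_of_eq (by ring))
  exact ⟨b.mkContinuous₂ (2 * C) bound, fun g h => rfl⟩

lemma two_mul_quarter : 2 * ((1 / 4 : NNReal) : ℝ) = 1 / 2 := by norm_num

lemma integrable_bracket_fhat (g : L2) :
    Integrable (fun p => (1 + ‖p‖ ^ 2) ^ (1 / 2 : ℝ) * ‖fhat (bessel (1 / 4) g) p‖ ^ 2) ∧
    ∫ p, (1 + ‖p‖ ^ 2) ^ (1 / 2 : ℝ) * ‖fhat (bessel (1 / 4) g) p‖ ^ 2 = ‖g‖ ^ 2 := by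
  have h := bracket_mul_norm_fhat_bessel_sq (1 / 4) g
  rw [two_mul_quarter] at h
  refine ⟨(integrable_norm_sq (Lp.memLp g)).congr (h.mono fun _ h => h.symm), ?_⟩
  rw [integral_congr_ae h, integral_norm_sq_eq]

lemma integrable_norm_fhat (g : L2) :
    Integrable (fun p => ‖p‖ * ‖fhat (bessel (1 / 4) g) p‖ ^ 2) ∧
    ∫ p, ‖p‖ * ‖fhat (bessel (1 / 4) g) p‖ ^ 2 ≤ ‖g‖ ^ 2 := by
  obtain ⟨h1, h2⟩ := integrable_bracket_fhat g
  have h3 : ∀ p, ‖p‖ * ‖fhat (bessel (1 / 4) g) p‖ ^ 2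
      ≤ (1 + ‖p‖ ^ 2) ^ (1 / 2 : ℝ) * ‖fhat (bessel (1 / 4) g) p‖ ^ 2 := fun p => by
    gcongr
    exact norm_le_bracket p
  have h4 : Integrable (fun p => ‖p‖ * ‖fhat (bessel (1 / 4) g) p‖ ^ 2) := by
    refine h1.mono' ?_ (Filter.Eventually.of_forall fun p => ?_)
    · exact continuous_norm.aestronglyMeasurable.mul ((memLp_fhat _).1.norm.pow 2)
    · rw [Real.norm_of_nonneg (by positivity)]
      exact h3 p
  exact ⟨h4, h2 ▸ integral_mono h4 h1 h3⟩

lemma norm_bessel_le (g : L2) : ‖bessel (1 / 4) g‖ ≤ ‖g‖ := by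
  have h : ‖bessel (1 / 4) g‖ = ‖bracketCLM (1 / 4) g‖ := invFhat.norm_map _
  rw [h]
  simpa [bracketCLM] using norm_mulCLM_le g
    (hm := continuous_bracket _) (hC := abs_bracket_neg_le (1 / 4 : NNReal).coe_nonneg)

lemma integrable_kato (g : L2) :
    Integrable (fun y => ‖bessel (1 / 4) g y‖ ^ 2 * ‖y‖⁻¹) ∧
    ∫ y, ‖bessel (1 / 4) g y‖ ^ 2 * ‖y‖⁻¹ ≤ 22 * sphereArea * ‖g‖ ^ 2 := by
  have hS := sphereArea_nonneg
  have hk := lintegral_kato_bessel g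
  have hm : AEStronglyMeasurable (fun y => ‖bessel (1 / 4) g y‖ ^ 2 * ‖y‖⁻¹) volume :=
    ((Lp.aestronglyMeasurable _).norm.pow 2).mul
      (by fun_prop : Measurable fun y : E3 => ‖y‖⁻¹).aestronglyMeasurable
  have e : ∫⁻ y, ‖bessel (1 / 4) g y‖ₑ ^ 2 * ENNReal.ofReal ‖y‖⁻¹
      = ∫⁻ y, ENNReal.ofReal (‖bessel (1 / 4) g y‖ ^ 2 * ‖y‖⁻¹) := by
    refine lintegral_congr fun y => ?_
    rw [ENNReal.ofReal_mul (by positivity), ENNReal.ofReal_pow (norm_nonneg _), ofReal_norm]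
  rw [e] at hk
  refine ⟨⟨hm, ?_⟩, ?_⟩
  · rw [hasFiniteIntegral_iff_ofReal (Filter.Eventually.of_forall fun y => by positivity)]
    exact lt_of_le_of_lt hk ENNReal.ofReal_lt_top
  · rw [integral_eq_lintegral_of_nonneg_ae (Filter.Eventually.of_forall fun y => by positivity) hm]
    exact ENNReal.toReal_le_of_le_ofReal (by positivity) hk

lemma formOff_eq {lam : ℝ} (hl : 0 < lam) {η ξ : L2}
    (iη : Integrable fun p => ‖p‖ * ‖fhat η p‖ ^ 2) (iξ : Integrable fun p => ‖p‖ * ‖fhat ξ p‖ ^ 2) :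
    formOff lam η ξ = -(1 / (Real.pi : ℂ) ^ 2) * ∫ z : E3 × E3,
      conj (fhat η z.1) * fhat ξ z.2 * (((denom lam z.1 z.2)⁻¹ : ℝ) : ℂ) := by
  have hI := (integrable_offDiag hl (memLp_fhat η).1 (memLp_fhat ξ).1 iη iξ).1
  rw [Measure.volume_eq_prod, integral_prod _ (by rwa [← Measure.volume_eq_prod]),
    ← integral_const_mul, formOff]
  refine integral_congr_ae (Filter.Eventually.of_forall fun p => ?_)
  simp only
  rw [← integral_const_mul, ← integral_const_mul, ← integral_const_mul]
  refine integral_congr_ae (Filter.Eventually.of_forall fun q => ?_)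
  simp only [denom]
  rw [div_eq_mul_inv, Complex.ofReal_inv]
  ring

lemma fhat_bessel_add (s : NNReal) (g h : L2) :
    ∀ᵐ p, fhat (bessel s (g + h)) p = fhat (bessel s g) p + fhat (bessel s h) p := by
  rw [map_add]; exact fhat_add _ _

lemma fhat_bessel_smul (s : NNReal) (c : ℂ) (g : L2) :
    ∀ᵐ p, fhat (bessel s (c • g)) p = c * fhat (bessel s g) p := by
  rw [map_smul]; exact fhat_smul _ _

lemma bessel_add_ae (s : NNReal) (g h : L2) :
    ∀ᵐ y, bessel s (g + h) y = bessel s g y + bessel s h y := by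
  rw [map_add]; exact Lp.coeFn_add _ _

lemma bessel_smul_ae (s : NNReal) (c : ℂ) (g : L2) :
    ∀ᵐ y, bessel s (c • g) y = c * bessel s g y := by
  rw [map_smul]; exact Lp.coeFn_smul _ _

lemma exists_formDiag {lam : ℝ} (hl : 0 < lam) : ∃ a : L2 →L⋆[ℂ] L2 →L[ℂ] ℂ,
    ∀ g h, a g h = formDiag lam (bessel (1 / 4) g) (bessel (1 / 4) h) := by
  have key : ∀ g h : L2, ∀ p : E3,
      ‖conj (fhat (bessel (1 / 4) g) p) *
        ((Real.sqrt (3 / 4 * ‖p‖ ^ 2 + lam) : ℂ) * fhat (bessel (1 / 4) h) p)‖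
      ≤ (1 + lam) * ((1 + ‖p‖ ^ 2) ^ (1 / 2 : ℝ) * ‖fhat (bessel (1 / 4) g) p‖ ^ 2
          + (1 + ‖p‖ ^ 2) ^ (1 / 2 : ℝ) * ‖fhat (bessel (1 / 4) h) p‖ ^ 2) := by
    intro g h p
    have h1 : Real.sqrt (3 / 4 * ‖p‖ ^ 2 + lam) ≤ (1 + lam) * (1 + ‖p‖ ^ 2) ^ (1 / 2 : ℝ) := by
      rw [← Real.sqrt_eq_rpow, ← Real.sqrt_sq (by positivity : 0 ≤ 1 + lam),
        ← Real.sqrt_mul (by positivity)]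
      apply Real.sqrt_le_sqrt
      nlinarith [sq_nonneg ‖p‖, mul_nonneg hl.le (sq_nonneg ‖p‖), mul_nonneg (mul_nonneg hl.le hl.le)
        (sq_nonneg ‖p‖)]
    rw [norm_mul, norm_mul, RCLike.norm_conj, Complex.norm_real,
      Real.norm_of_nonneg (Real.sqrt_nonneg _)]
    set a := ‖fhat (bessel (1 / 4) g) p‖
    set b := ‖fhat (bessel (1 / 4) h) p‖
    have ha : 0 ≤ a := norm_nonneg _
    have hb : 0 ≤ b := norm_nonneg _
    have hab : a * b ≤ a ^ 2 + b ^ 2 := by nlinarith [sq_nonneg (a - b)]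
    calc a * (Real.sqrt (3 / 4 * ‖p‖ ^ 2 + lam) * b)
        = Real.sqrt (3 / 4 * ‖p‖ ^ 2 + lam) * (a * b) := by ring
      _ ≤ ((1 + lam) * (1 + ‖p‖ ^ 2) ^ (1 / 2 : ℝ)) * (a ^ 2 + b ^ 2) := by gcongr
      _ = _ := by ring
  have hdom : ∀ g h : L2, Integrable fun p =>
      (1 + lam) * ((1 + ‖p‖ ^ 2) ^ (1 / 2 : ℝ) * ‖fhat (bessel (1 / 4) g) p‖ ^ 2
          + (1 + ‖p‖ ^ 2) ^ (1 / 2 : ℝ) * ‖fhat (bessel (1 / 4) h) p‖ ^ 2) := fun g h =>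
    ((integrable_bracket_fhat g).1.add (integrable_bracket_fhat h).1).const_mul _
  refine exists_sesquilinear (fhat_bessel_add _) (fhat_bessel_smul _) (fhat_bessel_add _)
    (fhat_bessel_smul _) (fun g h => ?_) (C := 1 + lam) (fun g h => ?_)
  · refine (hdom g h).mono' ?_ (Filter.Eventually.of_forall (key g h))
    refine (Complex.continuous_conj.comp_aestronglyMeasurable (memLp_fhat _).1).mul ?_
    refine AEStronglyMeasurable.mul ?_ (memLp_fhat _).1
    exact (Complex.continuous_ofReal.comp (by fun_prop)).aestronglyMeasurable
  · refine (norm_integral_le_of_norm_le (hdom g h) (Filter.Eventually.of_forall (key g h))).trans ?_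
    rw [integral_const_mul, integral_add (integrable_bracket_fhat g).1 (integrable_bracket_fhat h).1,
      (integrable_bracket_fhat g).2, (integrable_bracket_fhat h).2]

lemma exists_formOff {lam : ℝ} (hl : 0 < lam) : ∃ a : L2 →L⋆[ℂ] L2 →L[ℂ] ℂ,
    ∀ g h, a g h = formOff lam (bessel (1 / 4) g) (bessel (1 / 4) h) := by
  have hS := sphereArea_nonneg
  have q1 : ∀ {P : E3 → Prop}, (∀ᵐ p, P p) → ∀ᵐ z : E3 × E3, P z.1 :=
    fun h => Measure.quasiMeasurePreserving_fst.ae h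
  have q2 : ∀ {P : E3 → Prop}, (∀ᵐ p, P p) → ∀ᵐ z : E3 × E3, P z.2 :=
    fun h => Measure.quasiMeasurePreserving_snd.ae h
  have ii := fun g h : L2 => integrable_offDiag hl (memLp_fhat (bessel (1 / 4) g)).1
    (memLp_fhat (bessel (1 / 4) h)).1 (integrable_norm_fhat g).1 (integrable_norm_fhat h).1
  obtain ⟨a, ha⟩ := exists_sesquilinear (μ := (volume : Measure (E3 × E3)))
    (A := fun g z => fhat (bessel (1 / 4) g) z.1) (B := fun g z => fhat (bessel (1 / 4) g) z.2)
    (k := fun z => (((denom lam z.1 z.2)⁻¹ : ℝ) : ℂ)) (C := 44 * sphereArea)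
    (fun g h => q1 (fhat_bessel_add _ g h)) (fun c g => q1 (fhat_bessel_smul _ c g))
    (fun g h => q2 (fhat_bessel_add _ g h)) (fun c g => q2 (fhat_bessel_smul _ c g))
    (fun g h => (ii g h).1.congr (Filter.Eventually.of_forall fun z => by simp only; ring))
    (fun g h => by
      refine (norm_integral_le_integral_norm _).trans ?_
      have e : ∀ z : E3 × E3, conj (fhat (bessel (1 / 4) g) z.1) *
          ((((denom lam z.1 z.2)⁻¹ : ℝ) : ℂ) * fhat (bessel (1 / 4) h) z.2)
          = conj (fhat (bessel (1 / 4) g) z.1) * fhat (bessel (1 / 4) h) z.2 *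
            (((denom lam z.1 z.2)⁻¹ : ℝ) : ℂ) := fun z => by ring
      simp_rw [e]
      refine (ii g h).2.trans ?_
      gcongr
      · exact (integrable_norm_fhat g).2
      · exact (integrable_norm_fhat h).2)
  refine ⟨(-(1 / (Real.pi : ℂ) ^ 2)) • a, fun g h => ?_⟩
  rw [formOff_eq hl (integrable_norm_fhat g).1 (integrable_norm_fhat h).1]
  simp only [smul_apply, smul_eq_mul, ha]
  congr 1
  refine integral_congr_ae (Filter.Eventually.of_forall fun z => ?_)
  simp only
  ring

lemma exists_formReg {θ : ℝ → ℝ} (hθ : SmoothCutoff θ) (β γ : ℝ) :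
    ∃ a : L2 →L⋆[ℂ] L2 →L[ℂ] ℂ,
      ∀ g h, a g h = formReg β γ θ (bessel (1 / 4) g) (bessel (1 / 4) h) := by
  have hS := sphereArea_nonneg
  obtain ⟨B, L, hB0, hL0, hB, -⟩ := hθ.exists_boundedPart_bound β γ
  have hm : Measurable (gammaReg β γ θ) := by
    have e : gammaReg β γ θ = fun y => boundedPart β γ θ y + γ * ‖y‖⁻¹ :=
      funext fun y => gammaReg_eq β γ θ y
    rw [e]
    exact (hθ.measurable_boundedPart β γ).add (by fun_prop)
  set dom : L2 → E3 → ℝ := fun g y =>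
    B * ‖bessel (1 / 4) g y‖ ^ 2 + |γ| * (‖bessel (1 / 4) g y‖ ^ 2 * ‖y‖⁻¹) with hdom
  have idom : ∀ g, Integrable (dom g) := fun g =>
    ((integrable_norm_sq (Lp.memLp _)).const_mul B).add ((integrable_kato g).1.const_mul _)
  have bdom : ∀ g, ∫ y, dom g y ≤ (B + |γ| * (22 * sphereArea)) * ‖g‖ ^ 2 := by
    intro g
    rw [hdom]
    simp only
    rw [integral_add ((integrable_norm_sq (Lp.memLp _)).const_mul B)
      ((integrable_kato g).1.const_mul _), integral_const_mul, integral_const_mul,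
      integral_norm_sq_eq, add_mul, mul_assoc |γ|]
    have h1 := norm_bessel_le g
    have h2 := (integrable_kato g).2
    gcongr
  have key : ∀ g h : L2, ∀ y : E3, ‖conj (bessel (1 / 4) g y) *
      ((gammaReg β γ θ y : ℂ) * bessel (1 / 4) h y)‖ ≤ dom g y + dom h y := by
    intro g h y
    have h1 : |gammaReg β γ θ y| ≤ B + |γ| * ‖y‖⁻¹ := by
      rw [gammaReg_eq]
      refine (abs_add_le _ _).trans ?_
      rw [abs_mul, abs_of_nonneg (by positivity : 0 ≤ ‖y‖⁻¹)]
      gcongr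
      exact hB y
    rw [norm_mul, norm_mul, RCLike.norm_conj, Complex.norm_real, Real.norm_eq_abs]
    set a := ‖bessel (1 / 4) g y‖ with ha'
    set b := ‖bessel (1 / 4) h y‖ with hb'
    have ha : 0 ≤ a := norm_nonneg _
    have hb : 0 ≤ b := norm_nonneg _
    have hab : a * b ≤ a ^ 2 + b ^ 2 := by nlinarith [sq_nonneg (a - b)]
    calc a * (|gammaReg β γ θ y| * b) = |gammaReg β γ θ y| * (a * b) := by ring
      _ ≤ (B + |γ| * ‖y‖⁻¹) * (a ^ 2 + b ^ 2) := by gcongr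
      _ = dom g y + dom h y := by simp only [hdom, ← ha', ← hb']; ring
  refine exists_sesquilinear (bessel_add_ae _) (bessel_smul_ae _) (bessel_add_ae _)
    (bessel_smul_ae _) (fun g h => ?_) (C := B + |γ| * (22 * sphereArea)) (fun g h => ?_)
  · refine ((idom g).add (idom h)).mono' ?_ (Filter.Eventually.of_forall (key g h))
    refine (Complex.continuous_conj.comp_aestronglyMeasurable (Lp.aestronglyMeasurable _)).mul ?_
    exact (Complex.measurable_ofReal.comp hm).aestronglyMeasurable.mul (Lp.aestronglyMeasurable _)
  · refine (norm_integral_le_of_norm_le ((idom g).add (idom h))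
      (Filter.Eventually.of_forall (key g h))).trans ?_
    simp only [Pi.add_apply]
    rw [integral_add (idom g) (idom h), mul_add]
    exact add_le_add (bdom g) (bdom h)

/-- The form `Φ^lam` is bounded on `H^(1/2)`. -/
lemma exists_form {θ : ℝ → ℝ} (hθ : SmoothCutoff θ) (β γ : ℝ) {lam : ℝ} (hl : 0 < lam) :
    ∃ a : L2 →L⋆[ℂ] L2 →L[ℂ] ℂ,
      ∀ g h, a g h = form β γ θ lam (bessel (1 / 4) g) (bessel (1 / 4) h) := by
  obtain ⟨a, ha⟩ := exists_formDiag hl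
  obtain ⟨b, hb⟩ := exists_formOff hl
  obtain ⟨c, hc⟩ := exists_formReg hθ β γ
  refine ⟨a + b + c, fun g h => ?_⟩
  simp only [add_apply, form, ha, hb, hc]

/-- The form on elements of `L²` whose Fourier transforms are test functions. -/
lemma form_eq_of_isTest {θ : ℝ → ℝ} (hθ : SmoothCutoff θ) (β γ : ℝ) {lam : ℝ} (hl : 0 < lam)
    {u v : E3 → ℂ} (hu : IsTest u) (hv : IsTest v) {η ξ : L2} (hη : ∀ᵐ p, fhat η p = u p)
    (hξ : ∀ᵐ p, fhat ξ p = v p) :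
    form β γ θ lam η ξ
      = (∫ p, conj (u p) * ((Real.sqrt (3 / 4 * ‖p‖ ^ 2 + lam) : ℂ) * v p))
      + (-(1 / (Real.pi : ℂ) ^ 2) * ∫ z : E3 × E3,
          conj (u z.1) * v z.2 * (((denom lam z.1 z.2)⁻¹ : ℝ) : ℂ))
      + ((∫ y, conj (invFourier u y) * ((boundedPart β γ θ y : ℂ) * invFourier v y))
        + ((γ * (2 * Real.pi ^ 2)⁻¹ : ℝ) : ℂ) * ∫ z : E3 × E3,
          conj (u z.1) * v z.2 * (((‖z.1 - z.2‖ ^ 2)⁻¹ : ℝ) : ℂ)) := by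
  obtain ⟨B, L, hB0, hL0, hB, -⟩ := hθ.exists_boundedPart_bound β γ
  have wt : ∀ {w : E3 → ℂ}, IsTest w → ∀ {ζ : L2}, (∀ᵐ p, fhat ζ p = w p) →
      Integrable fun p => ‖p‖ * ‖fhat ζ p‖ ^ 2 := fun hw ζ hζ =>
    hw.integrable_norm_weight.congr (hζ.mono fun p hp => by simp only [hp])
  have e1 : formDiag lam η ξ
      = ∫ p, conj (u p) * ((Real.sqrt (3 / 4 * ‖p‖ ^ 2 + lam) : ℂ) * v p) := by
    refine integral_congr_ae ?_
    filter_upwards [hη, hξ] with p a b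
    rw [a, b]
  have e2 : formOff lam η ξ = -(1 / (Real.pi : ℂ) ^ 2) * ∫ z : E3 × E3,
          conj (u z.1) * v z.2 * (((denom lam z.1 z.2)⁻¹ : ℝ) : ℂ) := by
    rw [formOff_eq hl (wt hu hη) (wt hv hξ)]
    congr 1
    refine integral_congr_ae ?_
    filter_upwards [Measure.quasiMeasurePreserving_fst.ae hη,
      Measure.quasiMeasurePreserving_snd.ae hξ] with z a b
    rw [a, b]
  have e3 : formReg β γ θ η ξ
      = (∫ y, conj (invFourier u y) * ((boundedPart β γ θ y : ℂ) * invFourier v y))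
        + ((γ * (2 * Real.pi ^ 2)⁻¹ : ℝ) : ℂ) * ∫ z : E3 × E3,
          conj (u z.1) * v z.2 * (((‖z.1 - z.2‖ ^ 2)⁻¹ : ℝ) : ℂ) := by
    have i1 := integrable_conj_mul (memLp_invFourier hu)
      (memLp_mul_invFourier (hθ.measurable_boundedPart β γ) hB hv)
    have i2 := (integrable_invFourier_div_norm hu hv).const_mul (γ : ℂ)
    rw [Complex.ofReal_mul, mul_assoc, ← integral_invFourier_div_norm hu hv, ← integral_const_mul,
      ← integral_add i1 i2]
    refine integral_congr_ae ?_
    filter_upwards [ae_eq_invFourier hu hη, ae_eq_invFourier hv hξ] with y a b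
    rw [a, b, gammaReg_eq]
    push_cast
    ring
  rw [form, e1, e2, e3]

/-! ### Coercivity and the estimate with the test function `-Δφ` -/

/-- The self-energy of a test function for the Coulomb kernel `|p - q|⁻²`. -/
def coulombEnergy (u : E3 → ℂ) : ℂ :=
  ∫ z : E3 × E3, conj (u z.1) * u z.2 * (((‖z.1 - z.2‖ ^ 2)⁻¹ : ℝ) : ℂ)

/-- The self-energy of a test function for the off-diagonal kernel. -/
def offDiagEnergy (lam : ℝ) (u : E3 → ℂ) : ℂ :=
  ∫ z : E3 × E3, conj (u z.1) * u z.2 * (((denom lam z.1 z.2)⁻¹ : ℝ) : ℂ)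

lemma abs_re_offDiagEnergy_le {lam : ℝ} (hl : 0 < lam) {u : E3 → ℂ} (hu : IsTest u) :
    |(offDiagEnergy lam u).re| ≤ (coulombEnergy u).re :=
  (Complex.abs_re_le_norm _).trans (norm_offDiag_le hl hu)

lemma re_coulombEnergy_le {u : E3 → ℂ} (hu : IsTest u) :
    (coulombEnergy u).re ≤ 22 * sphereArea * ∫ p, ‖p‖ * ‖u p‖ ^ 2 := by
  have h1 := hu.cont.aestronglyMeasurable (μ := volume)
  have h2 := (integrable_coulomb h1 h1 hu.integrable_norm_weight hu.integrable_norm_weight).2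
  refine (Complex.re_le_norm _).trans ((norm_integral_le_integral_norm _).trans (h2.trans ?_))
  exact le_of_eq (by ring)

lemma re_neg_pi_mul (c : ℝ) (a b : ℂ) :
    (-(1 / (Real.pi : ℂ) ^ 2) * a + (c : ℂ) * b).re
      = -(Real.pi ^ 2)⁻¹ * a.re + c * b.re := by
  have : -(1 / (Real.pi : ℂ) ^ 2) = ((-(Real.pi ^ 2)⁻¹ : ℝ) : ℂ) := by push_cast; ring
  rw [this, Complex.add_re, Complex.re_ofReal_mul, Complex.re_ofReal_mul]

/-- For `γ > 2` the Coulomb part of the regularizing term compensates the off-diagonal part, which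
leaves the coercive diagonal part and a bounded perturbation. -/
lemma exists_formCoercive {β γ : ℝ} {θ : ℝ → ℝ} (hθ : SmoothCutoff θ) (hγ : 2 < γ) :
    ∃ lam₀ : ℝ, 0 < lam₀ ∧ ∀ lam : ℝ, lam₀ < lam → FormCoercive β γ θ lam := by
  have hpi := Real.pi_pos
  obtain ⟨B, L, hB0, hL0, hB, -⟩ := hθ.exists_boundedPart_bound β γ
  refine ⟨8 * B ^ 2 + 1, by positivity, fun lam hlam => ?_⟩
  have hl : 0 < lam := lt_trans (by positivity) hlam
  obtain ⟨a, ha⟩ := exists_form hθ β γ hl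
  have test : ∀ (w : E3 → ℂ) (hw : IsTest w),
      1 / 2 * ‖hw.toL2‖ ^ 2 ≤ (a hw.toL2 hw.toL2).re := by
    intro w hw
    set u : E3 → ℂ := fun p => (((1 + ‖p‖ ^ 2) ^ (-((1 / 4 : NNReal) : ℝ)) : ℝ) : ℂ) * w p with hudef
    have hu : IsTest u :=
      hw.continuous_mul (Complex.continuous_ofReal.comp (continuous_bracket _))
    have hφ := fhat_bessel_toL2 (1 / 4) hw
    have hn : ‖hw.toL2‖ ^ 2 = ∫ p, (1 + ‖p‖ ^ 2) ^ (1 / 2 : ℝ) * ‖u p‖ ^ 2 := by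
      rw [← (integrable_bracket_fhat hw.toL2).2]
      refine integral_congr_ae ?_
      filter_upwards [hφ] with p hp
      rw [hp]
    rw [ha, form_eq_of_isTest hθ β γ hl hu hu hφ hφ, hn]
    have e1 : ∫ p, conj (u p) * ((Real.sqrt (3 / 4 * ‖p‖ ^ 2 + lam) : ℂ) * u p)
        = ((∫ p, Real.sqrt (3 / 4 * ‖p‖ ^ 2 + lam) * ‖u p‖ ^ 2 : ℝ) : ℂ) := by
      rw [← integral_complex_ofReal]
      refine integral_congr_ae (Filter.Eventually.of_forall fun p => ?_)
      simp only
      rw [mul_left_comm, conj_mul_self_eq, Complex.ofReal_mul]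
    have e2 := norm_integral_mul_le hB hu hu one_pos
    have e3 := abs_re_offDiagEnergy_le hl hu
    have e4 : 0 ≤ (-(1 / (Real.pi : ℂ) ^ 2) * offDiagEnergy lam u
        + ((γ * (2 * Real.pi ^ 2)⁻¹ : ℝ) : ℂ) * coulombEnergy u).re := by
      rw [re_neg_pi_mul]
      have h1 := (le_abs_self _).trans e3
      have h2 := (abs_nonneg _).trans e3
      have h3 : γ * (2 * Real.pi ^ 2)⁻¹ = γ / 2 * (Real.pi ^ 2)⁻¹ := by rw [mul_inv]; ring
      rw [h3]
      have h4 : 0 < (Real.pi ^ 2)⁻¹ := by positivity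
      nlinarith [mul_le_mul_of_nonneg_left h1 h4.le, mul_nonneg h4.le h2]
    have e5 := Complex.abs_re_le_norm
      (∫ y, conj (invFourier u y) * ((boundedPart β γ θ y : ℂ) * invFourier u y))
    have e6 := (abs_le.1 (e5.trans e2)).1
    rw [Complex.add_re] at e4
    rw [Complex.add_re, Complex.add_re, Complex.add_re, e1, Complex.ofReal_re]
    unfold offDiagEnergy coulombEnergy at e4
    have e7 : 1 / 2 * (∫ p, (1 + ‖p‖ ^ 2) ^ (1 / 2 : ℝ) * ‖u p‖ ^ 2)
        + 2 * B * (∫ p, ‖u p‖ ^ 2) ≤ ∫ p, Real.sqrt (3 / 4 * ‖p‖ ^ 2 + lam) * ‖u p‖ ^ 2 := by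
      have i1 := hu.integrable_weight (continuous_bracket (1 / 2))
      have i2 := integrable_norm_sq (hu.memLp 2)
      rw [← integral_const_mul, ← integral_const_mul,
        ← integral_add (i1.const_mul _) (i2.const_mul _)]
      refine integral_mono ((i1.const_mul _).add (i2.const_mul _))
        (hu.integrable_weight (by fun_prop)) fun p => ?_
      simp only
      have h1 : 1 / 2 * (1 + ‖p‖ ^ 2) ^ (1 / 2 : ℝ) + 2 * B
          ≤ Real.sqrt (3 / 4 * ‖p‖ ^ 2 + lam) := by
        apply Real.le_sqrt_of_sq_le
        have h2 : ((1 + ‖p‖ ^ 2) ^ (1 / 2 : ℝ)) ^ 2 = 1 + ‖p‖ ^ 2 := by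
          rw [← Real.sqrt_eq_rpow, Real.sq_sqrt (by positivity)]
        nlinarith [sq_nonneg (1 / 2 * (1 + ‖p‖ ^ 2) ^ (1 / 2 : ℝ) - 2 * B), sq_nonneg ‖p‖]
      nlinarith [mul_le_mul_of_nonneg_right h1 (sq_nonneg ‖u p‖)]
    rw [inv_one, one_mul] at e6
    linarith
  refine ⟨1 / 2, by norm_num, fun ξ hξ => ?_⟩
  rw [← two_mul_quarter] at hξ
  obtain ⟨g, rfl⟩ := exists_eq_bessel (1 / 4) hξ
  rw [← two_mul_quarter, normH_bessel, two_mul_quarter, ← ha]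
  have hcl : IsClosed {g : L2 | 1 / 2 * ‖g‖ ^ 2 ≤ (a g g).re} :=
    isClosed_le (by fun_prop)
      (Complex.continuous_re.comp (a.continuous.clm_apply continuous_id))
  have hsub : {g : L2 | ∃ (u : E3 → ℂ) (hu : IsTest u), g = hu.toL2}
      ⊆ {g : L2 | 1 / 2 * ‖g‖ ^ 2 ≤ (a g g).re} := by
    rintro _ ⟨u, hu, rfl⟩
    exact test u hu
  exact closure_minimal hsub hcl (dense_isTest g)

/-- For a real symmetric kernel, the weight `p²` on one side may be replaced by `(p² + q²) / 2` in
the real part. -/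
lemma re_integral_symm {u : E3 → ℂ} {k : E3 × E3 → ℝ} (hk : ∀ z, k z.swap = k z)
    (hi : Integrable fun z : E3 × E3 =>
      conj (((‖z.1‖ ^ 2 : ℝ) : ℂ) * u z.1) * u z.2 * (k z : ℂ)) :
    (∫ z : E3 × E3, conj (((‖z.1‖ ^ 2 : ℝ) : ℂ) * u z.1) * u z.2 * (k z : ℂ)).re
      = 2⁻¹ * (∫ z : E3 × E3, conj (u z.1) * u z.2 *
          (((‖z.1‖ ^ 2 + ‖z.2‖ ^ 2) * k z : ℝ) : ℂ)).re := by
  set f : E3 × E3 → ℂ := fun z => conj (((‖z.1‖ ^ 2 : ℝ) : ℂ) * u z.1) * u z.2 * (k z : ℂ) with hf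
  have hsw : ∫ z : E3 × E3, f z.swap = ∫ z : E3 × E3, f z := by
    rw [Measure.volume_eq_prod]
    exact integral_prod_swap f
  have hisw : Integrable fun z : E3 × E3 => f z.swap := by
    rw [Measure.volume_eq_prod] at hi ⊢
    exact hi.swap
  have hic : Integrable fun z : E3 × E3 => conj (f z.swap) :=
    (Complex.conjCLE.toContinuousLinearMap.integrable_comp hisw :)
  have e : ∫ z : E3 × E3, conj (u z.1) * u z.2 * (((‖z.1‖ ^ 2 + ‖z.2‖ ^ 2) * k z : ℝ) : ℂ)
      = (∫ z : E3 × E3, f z) + conj (∫ z : E3 × E3, f z) := by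
    rw [← hsw, ← integral_conj, hsw, ← integral_add hi hic]
    refine integral_congr_ae (Filter.Eventually.of_forall fun z => ?_)
    simp only [hf, hk, Prod.fst_swap, Prod.snd_swap, map_mul, Complex.conj_conj,
      Complex.conj_ofReal]
    push_cast
    ring
  rw [e, Complex.add_re, Complex.conj_re]
  ring

/-- The factor `p·q` splits the energy into the energies of the three functions `p_i u`. -/
lemma integral_mul_inner {u : E3 → ℂ} {k : E3 × E3 → ℝ}
    (hi : ∀ i : Fin 3, Integrable fun z : E3 × E3 =>
      conj (((z.1 i : ℝ) : ℂ) * u z.1) * (((z.2 i : ℝ) : ℂ) * u z.2) * (k z : ℂ)) :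
    Integrable (fun z : E3 × E3 => conj (u z.1) * u z.2 * ((inner ℝ z.1 z.2 * k z : ℝ) : ℂ)) ∧
    ∫ z : E3 × E3, conj (u z.1) * u z.2 * ((inner ℝ z.1 z.2 * k z : ℝ) : ℂ)
      = ∑ i : Fin 3, ∫ z : E3 × E3,
        conj (((z.1 i : ℝ) : ℂ) * u z.1) * (((z.2 i : ℝ) : ℂ) * u z.2) * (k z : ℂ) := by
  have e : ∀ z : E3 × E3, conj (u z.1) * u z.2 * ((inner ℝ z.1 z.2 * k z : ℝ) : ℂ)
      = ∑ i : Fin 3, conj (((z.1 i : ℝ) : ℂ) * u z.1) * (((z.2 i : ℝ) : ℂ) * u z.2) * (k z : ℂ) := by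
    intro z
    rw [inner_eq_sum, Complex.ofReal_mul, Complex.ofReal_sum, Finset.sum_mul, Finset.mul_sum]
    refine Finset.sum_congr rfl fun i _ => ?_
    rw [map_mul, Complex.conj_ofReal]
    push_cast
    ring
  simp_rw [e]
  exact ⟨integrable_finsetSum _ fun i _ => hi i, integral_finsetSum _ fun i _ => hi i⟩

/-- The nonnegative number `|∫ u|²`. -/
lemma integral_prod_eq_norm_sq (u : E3 → ℂ) :
    ∫ z : E3 × E3, conj (u z.1) * u z.2 = ((‖∫ p, u p‖ ^ 2 : ℝ) : ℂ) := by
  rw [Measure.volume_eq_prod, integral_prod_mul (fun p => conj (u p)) u, integral_conj,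
    conj_mul_self_eq]

/-- Symmetrization `p² → (p² + q²) / 2` of the off-diagonal form tested with `-Δφ`. -/
lemma re_offDiag_laplacian {lam : ℝ} (hl : 0 < lam) {u : E3 → ℂ} (hu : IsTest u) :
    (∫ z : E3 × E3, conj (((‖z.1‖ ^ 2 : ℝ) : ℂ) * u z.1) * u z.2
        * (((denom lam z.1 z.2)⁻¹ : ℝ) : ℂ)).re
      = 2⁻¹ * (‖∫ p, u p‖ ^ 2 - (∑ i : Fin 3, (offDiagEnergy lam fun p => ((p i : ℝ) : ℂ) * u p).re)
        - lam * (offDiagEnergy lam u).re) := by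
  have h1 : ∀ {w : E3 → ℂ}, IsTest w → AEStronglyMeasurable w := fun hw =>
    hw.cont.aestronglyMeasurable
  have ii : ∀ {v w : E3 → ℂ}, IsTest v → IsTest w → Integrable fun z : E3 × E3 =>
      conj (v z.1) * w z.2 * (((denom lam z.1 z.2)⁻¹ : ℝ) : ℂ) := fun hv hw =>
    (integrable_offDiag hl (h1 hv) (h1 hw) hv.integrable_norm_weight hw.integrable_norm_weight).1
  have tv : IsTest fun p => ((‖p‖ ^ 2 : ℝ) : ℂ) * u p :=
    hu.continuous_mul (Complex.continuous_ofReal.comp (by fun_prop))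
  have ti : ∀ i : Fin 3, IsTest fun p => ((p i : ℝ) : ℂ) * u p := fun i =>
    hu.continuous_mul (continuous_coord i)
  have hk : ∀ z : E3 × E3, (denom lam z.swap.1 z.swap.2)⁻¹ = (denom lam z.1 z.2)⁻¹ := fun z => by
    simp only [denom, Prod.fst_swap, Prod.snd_swap, real_inner_comm z.2,
      add_comm (‖z.2‖ ^ 2)]
  have i0 := ii tv hu
  have ij := fun i => ii (ti i) (ti i)
  have e0 := re_integral_symm (u := u) (k := fun z => (denom lam z.1 z.2)⁻¹) hk i0
  obtain ⟨i1, e1⟩ := integral_mul_inner (u := u) (k := fun z => (denom lam z.1 z.2)⁻¹) ij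
  have e2 : ∫ z : E3 × E3, conj (u z.1) * u z.2 *
        (((‖z.1‖ ^ 2 + ‖z.2‖ ^ 2) * (denom lam z.1 z.2)⁻¹ : ℝ) : ℂ)
      = (∫ z : E3 × E3, conj (u z.1) * u z.2)
        - (∫ z : E3 × E3, conj (u z.1) * u z.2 *
          ((inner ℝ z.1 z.2 * (denom lam z.1 z.2)⁻¹ : ℝ) : ℂ))
        - lam * ∫ z : E3 × E3, conj (u z.1) * u z.2 * (((denom lam z.1 z.2)⁻¹ : ℝ) : ℂ) := by
    have i2 : Integrable fun z : E3 × E3 => conj (u z.1) * u z.2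
        - conj (u z.1) * u z.2 * ((inner ℝ z.1 z.2 * (denom lam z.1 z.2)⁻¹ : ℝ) : ℂ) :=
      (hu.integrable_prod hu).sub i1
    have i3 := (ii hu hu).const_mul (lam : ℂ)
    rw [← integral_const_mul, ← integral_sub (hu.integrable_prod hu) i1, ← integral_sub i2 i3]
    refine integral_congr_ae (Filter.Eventually.of_forall fun z => ?_)
    have h := (denom_pos hl z.1 z.2).ne'
    have e3 : (‖z.1‖ ^ 2 + ‖z.2‖ ^ 2) * (denom lam z.1 z.2)⁻¹
        = 1 - inner ℝ z.1 z.2 * (denom lam z.1 z.2)⁻¹ - lam * (denom lam z.1 z.2)⁻¹ := by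
      have : ‖z.1‖ ^ 2 + ‖z.2‖ ^ 2 = denom lam z.1 z.2 - inner ℝ z.1 z.2 - lam := by
        unfold denom; ring
      rw [this, sub_mul, sub_mul, mul_inv_cancel₀ h]
    simp only
    rw [e3]
    push_cast
    ring
  rw [e0, e2, e1, integral_prod_eq_norm_sq u, Complex.sub_re, Complex.sub_re, Complex.ofReal_re,
    Complex.re_ofReal_mul, Complex.re_sum]
  simp only [offDiagEnergy]

/-- Symmetrization of the Coulomb form tested with `-Δφ`; the term `|∫ u|²` is a multiple of
`|φ(0)|²`. -/
lemma re_coulomb_laplacian {u : E3 → ℂ} (hu : IsTest u) :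
    (∫ z : E3 × E3, conj (((‖z.1‖ ^ 2 : ℝ) : ℂ) * u z.1) * u z.2
        * (((‖z.1 - z.2‖ ^ 2)⁻¹ : ℝ) : ℂ)).re
      = 2⁻¹ * (‖∫ p, u p‖ ^ 2
        + 2 * ∑ i : Fin 3, (coulombEnergy fun p => ((p i : ℝ) : ℂ) * u p).re) := by
  have h1 : ∀ {w : E3 → ℂ}, IsTest w → AEStronglyMeasurable w := fun hw =>
    hw.cont.aestronglyMeasurable
  have ii : ∀ {v w : E3 → ℂ}, IsTest v → IsTest w → Integrable fun z : E3 × E3 =>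
      conj (v z.1) * w z.2 * (((‖z.1 - z.2‖ ^ 2)⁻¹ : ℝ) : ℂ) := fun hv hw =>
    (integrable_coulomb (h1 hv) (h1 hw) hv.integrable_norm_weight hw.integrable_norm_weight).1
  have tv : IsTest fun p => ((‖p‖ ^ 2 : ℝ) : ℂ) * u p :=
    hu.continuous_mul (Complex.continuous_ofReal.comp (by fun_prop))
  have ti : ∀ i : Fin 3, IsTest fun p => ((p i : ℝ) : ℂ) * u p := fun i =>
    hu.continuous_mul (continuous_coord i)
  have hk : ∀ z : E3 × E3, (‖z.swap.1 - z.swap.2‖ ^ 2)⁻¹ = (‖z.1 - z.2‖ ^ 2)⁻¹ := fun z => by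
    rw [Prod.fst_swap, Prod.snd_swap, norm_sub_rev]
  have i0 := ii tv hu
  have ij := fun i => ii (ti i) (ti i)
  have e0 := re_integral_symm (u := u) (k := fun z => (‖z.1 - z.2‖ ^ 2)⁻¹) hk i0
  obtain ⟨i1, e1⟩ := integral_mul_inner (u := u) (k := fun z => (‖z.1 - z.2‖ ^ 2)⁻¹) ij
  have e2 : ∫ z : E3 × E3, conj (u z.1) * u z.2 *
        (((‖z.1‖ ^ 2 + ‖z.2‖ ^ 2) * (‖z.1 - z.2‖ ^ 2)⁻¹ : ℝ) : ℂ)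
      = (∫ z : E3 × E3, conj (u z.1) * u z.2)
        + ((2 : ℝ) : ℂ) * ∫ z : E3 × E3, conj (u z.1) * u z.2 *
          ((inner ℝ z.1 z.2 * (‖z.1 - z.2‖ ^ 2)⁻¹ : ℝ) : ℂ) := by
    rw [← integral_const_mul, ← integral_add (hu.integrable_prod hu) (i1.const_mul _)]
    refine integral_congr_ae ?_
    -- on the diagonal the kernel takes the value `0⁻¹ = 0` and the identity fails
    filter_upwards [ae_fst_ne_snd] with z hz
    have h : ‖z.1 - z.2‖ ^ 2 ≠ 0 := by
      have := norm_pos_iff.2 (sub_ne_zero.2 hz)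
      positivity
    have e3 : (‖z.1‖ ^ 2 + ‖z.2‖ ^ 2) * (‖z.1 - z.2‖ ^ 2)⁻¹
        = 1 + 2 * (inner ℝ z.1 z.2 * (‖z.1 - z.2‖ ^ 2)⁻¹) := by
      have : ‖z.1‖ ^ 2 + ‖z.2‖ ^ 2 = ‖z.1 - z.2‖ ^ 2 + 2 * inner ℝ z.1 z.2 := by
        rw [norm_sub_sq_real]; ring
      rw [this, add_mul, mul_inv_cancel₀ h]
      ring
    rw [e3]
    push_cast
    ring
  rw [e0, e2, e1, integral_prod_eq_norm_sq u, Complex.add_re, Complex.ofReal_re,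
    Complex.re_ofReal_mul, Complex.re_sum]
  simp only [coulombEnergy]

/-- The a priori estimate: tested with `-Δφ`, the form controls the `H^(3/2)` norm up to lower order
terms. The condition `γ ≥ 2` gives the sign of the term proportional to `|φ(0)|²`. -/
lemma exists_form_laplacian_bound {β γ : ℝ} {θ : ℝ → ℝ} (hθ : SmoothCutoff θ) (hγ : 2 < γ)
    {lam : ℝ} (hl : 0 < lam) : ∃ C : ℝ, 0 ≤ C ∧ ∀ (u : E3 → ℂ), IsTest u → ∀ η φ : L2,
      (∀ᵐ p, fhat η p = ((‖p‖ ^ 2 : ℝ) : ℂ) * u p) → (∀ᵐ p, fhat φ p = u p) →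
      1 / 2 * (∫ p, ‖p‖ ^ 3 * ‖u p‖ ^ 2) - C * (∫ p, (1 + ‖p‖ ^ 2) * ‖u p‖ ^ 2)
        ≤ (form β γ θ lam η φ).re := by
  have hpi := Real.pi_pos
  have hS := sphereArea_nonneg
  obtain ⟨B, L, hB0, hL0, hB, hL⟩ := hθ.exists_boundedPart_bound β γ
  refine ⟨3 * (B + L) + (2 * Real.pi ^ 2)⁻¹ * lam * (22 * sphereArea), by positivity, ?_⟩
  intro u hu η φ hη hφ
  have tv : IsTest fun p => ((‖p‖ ^ 2 : ℝ) : ℂ) * u p :=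
    hu.continuous_mul (Complex.continuous_ofReal.comp (by fun_prop))
  have ti : ∀ i : Fin 3, IsTest fun p => ((p i : ℝ) : ℂ) * u p := fun i =>
    hu.continuous_mul (continuous_coord i)
  rw [form_eq_of_isTest hθ β γ hl tv hu hη hφ]
  have e1 : ∫ p, conj (((‖p‖ ^ 2 : ℝ) : ℂ) * u p) * ((Real.sqrt (3 / 4 * ‖p‖ ^ 2 + lam) : ℂ) * u p)
      = ((∫ p, (‖p‖ ^ 2 * Real.sqrt (3 / 4 * ‖p‖ ^ 2 + lam)) * ‖u p‖ ^ 2 : ℝ) : ℂ) := by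
    rw [← integral_complex_ofReal]
    refine integral_congr_ae (Filter.Eventually.of_forall fun p => ?_)
    simp only
    rw [map_mul, Complex.conj_ofReal, mul_mul_mul_comm, conj_mul_self_eq, ← Complex.ofReal_mul,
      ← Complex.ofReal_mul]
  have e2 : 1 / 2 * (∫ p, ‖p‖ ^ 3 * ‖u p‖ ^ 2)
      ≤ ∫ p, (‖p‖ ^ 2 * Real.sqrt (3 / 4 * ‖p‖ ^ 2 + lam)) * ‖u p‖ ^ 2 := by
    rw [← integral_const_mul]
    refine integral_mono ((hu.integrable_weight (by fun_prop)).const_mul _)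
      (hu.integrable_weight (by fun_prop)) fun p => ?_
    simp only
    have h1 : 1 / 2 * ‖p‖ ≤ Real.sqrt (3 / 4 * ‖p‖ ^ 2 + lam) := by
      apply Real.le_sqrt_of_sq_le
      nlinarith [sq_nonneg ‖p‖]
    calc 1 / 2 * (‖p‖ ^ 3 * ‖u p‖ ^ 2) = (‖p‖ ^ 2 * (1 / 2 * ‖p‖)) * ‖u p‖ ^ 2 := by ring
      _ ≤ _ := by gcongr
  have e3 := norm_integral_norm_sq_le (hθ.measurable_boundedPart β γ) hB hL0 hL hu
  have e4 := (abs_le.1 ((Complex.abs_re_le_norm _).trans e3)).1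
  have e5 := re_neg_pi_mul (γ * (2 * Real.pi ^ 2)⁻¹)
    (∫ z : E3 × E3, conj (((‖z.1‖ ^ 2 : ℝ) : ℂ) * u z.1) * u z.2
        * (((denom lam z.1 z.2)⁻¹ : ℝ) : ℂ))
    (∫ z : E3 × E3, conj (((‖z.1‖ ^ 2 : ℝ) : ℂ) * u z.1) * u z.2
        * (((‖z.1 - z.2‖ ^ 2)⁻¹ : ℝ) : ℂ))
  rw [re_offDiag_laplacian hl hu, re_coulomb_laplacian hu, Complex.add_re] at e5
  rw [Complex.add_re, Complex.add_re, Complex.add_re, e1, Complex.ofReal_re]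
  have e6 : 0 ≤ ∑ i : Fin 3, ((offDiagEnergy lam fun p => ((p i : ℝ) : ℂ) * u p).re
      + γ * (coulombEnergy fun p => ((p i : ℝ) : ℂ) * u p).re) := by
    refine Finset.sum_nonneg fun i _ => ?_
    have h1 := abs_re_offDiagEnergy_le hl (ti i)
    have h2 := (abs_nonneg _).trans h1
    have h3 := (abs_le.1 h1).1
    nlinarith
  rw [Finset.sum_add_distrib, ← Finset.mul_sum] at e6
  have e7 : -(22 * sphereArea * ∫ p, (1 + ‖p‖ ^ 2) * ‖u p‖ ^ 2) ≤ (offDiagEnergy lam u).re := by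
    have h1 := (abs_le.1 (abs_re_offDiagEnergy_le hl hu)).1
    have h2 := re_coulombEnergy_le hu
    have h3 : ∫ p, ‖p‖ * ‖u p‖ ^ 2 ≤ ∫ p, (1 + ‖p‖ ^ 2) * ‖u p‖ ^ 2 := by
      refine integral_mono hu.integrable_norm_weight (hu.integrable_weight (by fun_prop)) fun p => ?_
      simp only
      gcongr
      nlinarith [sq_nonneg (‖p‖ - 1)]
    have h4 := mul_le_mul_of_nonneg_left h3 (by positivity : 0 ≤ 22 * sphereArea)
    linarith
  set S₁ := ∑ i : Fin 3, (offDiagEnergy lam fun p => ((p i : ℝ) : ℂ) * u p).re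
  set S₂ := ∑ i : Fin 3, (coulombEnergy fun p => ((p i : ℝ) : ℂ) * u p).re
  set I := ∫ p, (1 + ‖p‖ ^ 2) * ‖u p‖ ^ 2
  have e8 : -(Real.pi ^ 2)⁻¹ * (2⁻¹ * (‖∫ p, u p‖ ^ 2 - S₁ - lam * (offDiagEnergy lam u).re))
      + γ * (2 * Real.pi ^ 2)⁻¹ * (2⁻¹ * (‖∫ p, u p‖ ^ 2 + 2 * S₂))
      = (2 * Real.pi ^ 2)⁻¹ * ((γ - 2) / 2 * ‖∫ p, u p‖ ^ 2 + (S₁ + γ * S₂)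
          + lam * (offDiagEnergy lam u).re) := by
    rw [mul_inv]; ring
  rw [e8] at e5
  have hc : 0 < (2 * Real.pi ^ 2)⁻¹ := by positivity
  have e9 : (2 * Real.pi ^ 2)⁻¹ * (lam * -(22 * sphereArea * I))
      ≤ (2 * Real.pi ^ 2)⁻¹ * ((γ - 2) / 2 * ‖∫ p, u p‖ ^ 2 + (S₁ + γ * S₂)
          + lam * (offDiagEnergy lam u).re) := by
    refine mul_le_mul_of_nonneg_left ?_ hc.le
    have h1 := mul_le_mul_of_nonneg_left e7 hl.le
    have h2 : 0 ≤ (γ - 2) / 2 * ‖∫ p, u p‖ ^ 2 := mul_nonneg (by linarith) (by positivity)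
    linarith
  linarith

/-! ### Lions' representation theorem -/

/-- **Lions' representation theorem.** A linear system `⟪k u, g⟫ = ⟪ψ u, F⟫` is solvable with a bound
on the solution when `k` dominates `ψ`. -/
lemma exists_inner_eq_of_norm_le {V E : Type*} [AddCommGroup V] [Module ℂ V]
    [NormedAddCommGroup E] [InnerProductSpace ℂ E] [CompleteSpace E] (k ψ : V →ₗ[ℂ] E) {α : ℝ}
    (hα : 0 < α) (h : ∀ u, α * ‖ψ u‖ ≤ ‖k u‖) (F : E) :
    ∃ g : E, (∀ u, inner ℂ (k u) g = inner ℂ (ψ u) F) ∧ ‖g‖ ≤ α⁻¹ * ‖F‖ := by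
  obtain ⟨s, hs⟩ := k.rangeRestrict.exists_rightInverse_of_surjective k.range_rangeRestrict
  have hks : ∀ x : LinearMap.range k, k (s x) = x := fun x =>
    congrArg Subtype.val (LinearMap.congr_fun hs x)
  have hle : ∀ u, ‖ψ u‖ ≤ α⁻¹ * ‖k u‖ := fun u => by
    rw [← div_eq_inv_mul, le_div_iff₀ hα, mul_comm]
    exact h u
  set l : LinearMap.range k →L[ℂ] ℂ := LinearMap.mkContinuous
    ((innerSL ℂ F).toLinearMap ∘ₗ ψ ∘ₗ s) (α⁻¹ * ‖F‖) (fun x => by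
      have h1 := hle (s x)
      rw [hks] at h1
      calc ‖inner ℂ F (ψ (s x))‖ ≤ ‖F‖ * ‖ψ (s x)‖ := norm_inner_le_norm _ _
        _ ≤ ‖F‖ * (α⁻¹ * ‖(x : E)‖) := by gcongr
        _ = α⁻¹ * ‖F‖ * ‖x‖ := by rw [Submodule.coe_norm]; ring) with hl
  obtain ⟨L, hL, hLn⟩ := exists_extension_norm_eq (LinearMap.range k) l
  refine ⟨(InnerProductSpace.toDual ℂ E).symm L, fun u => ?_, ?_⟩
  · have h1 : k (s ⟨k u, u, rfl⟩ - u) = 0 := by rw [map_sub, hks, sub_self]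
    have h2 : ψ (s ⟨k u, u, rfl⟩) = ψ u := by
      have h3 := hle (s ⟨k u, u, rfl⟩ - u)
      rw [h1, norm_zero, mul_zero, map_sub] at h3
      exact sub_eq_zero.1 (norm_le_zero_iff.1 h3)
    have h4 : L (k u) = inner ℂ F (ψ u) := by
      rw [← h2]
      exact hL ⟨k u, u, rfl⟩
    rw [← inner_conj_symm, InnerProductSpace.toDual_symm_apply, h4, inner_conj_symm]
  · rw [LinearIsometryEquiv.norm_map, hLn]
    exact LinearMap.mkContinuous_norm_le _ (by positivity) _

lemma IsTest.add {u v : E3 → ℂ} (hu : IsTest u) (hv : IsTest v) : IsTest (u + v) :=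
  ⟨hu.cont.add hv.cont, hu.supp.add hv.supp⟩

/-- The space of test functions. -/
def testSubmodule : Submodule ℂ (E3 → ℂ) where
  carrier := {u | IsTest u}
  add_mem' hu hv := hu.add hv
  zero_mem' := ⟨continuous_zero, HasCompactSupport.zero⟩
  smul_mem' c _ hu := hu.continuous_mul (continuous_const (y := c))

lemma isTest_weight_mul {w : E3 → ℝ} (hw : Continuous w) (u : testSubmodule) :
    IsTest fun p => (w p : ℂ) * (u : E3 → ℂ) p :=
  IsTest.continuous_mul u.2 (Complex.continuous_ofReal.comp hw)

/-- Multiplication of test functions by a continuous weight, with values in `L²`. -/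
def weighted (w : E3 → ℝ) (hw : Continuous w) : testSubmodule →ₗ[ℂ] L2 where
  toFun u := (isTest_weight_mul hw u).toL2
  map_add' u v := by
    rw [IsTest.toL2, IsTest.toL2, IsTest.toL2, ← MemLp.toLp_add]
    congr 1
    funext p
    simp only [Submodule.coe_add, Pi.add_apply, mul_add]
  map_smul' c u := by
    rw [IsTest.toL2, IsTest.toL2, RingHom.id_apply, ← MemLp.toLp_const_smul]
    congr 1
    funext p
    simp only [SetLike.val_smul, Pi.smul_apply, smul_eq_mul]
    ring

lemma weighted_ae {w : E3 → ℝ} (hw : Continuous w) (u : testSubmodule) :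
    ∀ᵐ p, weighted w hw u p = (w p : ℂ) * (u : E3 → ℂ) p :=
  ((isTest_weight_mul hw u).memLp 2).coeFn_toLp

lemma norm_weighted_sq {w : E3 → ℝ} (hw : Continuous w) (u : testSubmodule) :
    ‖weighted w hw u‖ ^ 2 = ∫ p, w p ^ 2 * ‖(u : E3 → ℂ) p‖ ^ 2 := by
  rw [← integral_norm_sq_eq]
  refine integral_congr_ae ?_
  filter_upwards [weighted_ae hw u] with p hp
  rw [hp, norm_mul, Complex.norm_real, mul_pow, Real.norm_eq_abs, sq_abs]

/-- A bounded sesquilinear form, in its first argument, is represented by a linear map. -/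
lemma exists_linearMap_inner_eq {E : Type*} [NormedAddCommGroup E] [InnerProductSpace ℂ E]
    [CompleteSpace E] (a : E →L⋆[ℂ] E →L[ℂ] ℂ) (W : E →L[ℂ] E) :
    ∃ K : E →ₗ[ℂ] E, ∀ η g, inner ℂ (K η) g = a η (W g) := by
  refine ⟨{ toFun := fun η => (InnerProductSpace.toDual ℂ E).symm ((a η).comp W)
            map_add' := fun x y => ?_
            map_smul' := fun c x => ?_ }, fun η g => ?_⟩
  · rw [map_add, ContinuousLinearMap.add_comp, map_add]
  · rw [map_smulₛₗ, ContinuousLinearMap.smul_comp, map_smulₛₗ]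
    simp
  · exact InnerProductSpace.toDual_symm_apply

/-- The lower order terms are absorbed by a multiple of `(1 + p²)^(1/2)`. -/
lemma absorb_lower_order {r ρ C N : ℝ} (hr : 0 ≤ r) (hρ : 0 ≤ ρ) (h : ρ ^ 2 = 1 + r ^ 2)
    (hN : 4 * C ^ 2 + 1 / 2 ≤ N) : 1 / 16 * ρ ^ 3 ≤ N * ρ + 1 / 2 * r ^ 3 - C * ρ ^ 2 := by
  have h1 : 1 ≤ ρ := by nlinarith [sq_nonneg r]
  have h2 : ρ ≤ 1 + r := by nlinarith
  have h3 : ρ ^ 3 ≤ (1 + r) ^ 3 := by gcongr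
  have h4 : (1 + r) ^ 3 ≤ 4 * (1 + r ^ 3) := by
    nlinarith [mul_nonneg (by linarith : 0 ≤ 1 + r) (sq_nonneg (1 - r))]
  have h5 : 0 ≤ ρ * (ρ / 4 - 2 * C) ^ 2 := by positivity
  have h6 : (4 * C ^ 2 + 1 / 2) * ρ ≤ N * ρ := by gcongr
  nlinarith

/-! ### Regularity of the weak solution -/

lemma coe_quarter : ((1 / 4 : NNReal) : ℝ) = 1 / 4 := by norm_num

lemma coe_half : ((1 / 2 : NNReal) : ℝ) = 1 / 2 := by norm_num

lemma coe_three_quarter : ((3 / 4 : NNReal) : ℝ) = 3 / 4 := by norm_num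

lemma ofReal_bracket_mul {s t : ℝ} (p : E3) (z : ℂ) :
    (((1 + ‖p‖ ^ 2) ^ s : ℝ) : ℂ) * ((((1 + ‖p‖ ^ 2) ^ t : ℝ) : ℂ) * z)
      = (((1 + ‖p‖ ^ 2) ^ (s + t) : ℝ) : ℂ) * z := by
  rw [← mul_assoc, ← Complex.ofReal_mul, bracket_add]

lemma bracketCLM_ae (s : NNReal) (g : L2) :
    ∀ᵐ p, bracketCLM s g p = (((1 + ‖p‖ ^ 2) ^ (-(s : ℝ)) : ℝ) : ℂ) * g p :=
  mulCLM_ae g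

lemma continuous_shifted (M s : ℝ) :
    Continuous fun p : E3 => (M + ‖p‖ ^ 2) * (1 + ‖p‖ ^ 2) ^ s :=
  (by fun_prop : Continuous fun p : E3 => M + ‖p‖ ^ 2).mul (continuous_bracket s)

/-- Testing the equation with `(M - Δ)φ`, `M` large, controls the `H^(3/2)` norm of `φ`. -/
lemma exists_shifted_coercive {β γ : ℝ} {θ : ℝ → ℝ} (hθ : SmoothCutoff θ) (hγ : 2 < γ) {lam : ℝ}
    (hl : 0 < lam) (hco : FormCoercive β γ θ lam) {a : L2 →L⋆[ℂ] L2 →L[ℂ] ℂ}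
    (ha : ∀ g h, a g h = form β γ θ lam (bessel (1 / 4) g) (bessel (1 / 4) h)) :
    ∃ M : ℝ, 1 ≤ M ∧ ∀ u : testSubmodule,
      1 / 16 * ‖weighted (fun p => (1 + ‖p‖ ^ 2) ^ (3 / 4 : ℝ)) (continuous_bracket _) u‖ ^ 2
        ≤ (a (weighted (fun p => (M + ‖p‖ ^ 2) * (1 + ‖p‖ ^ 2) ^ (1 / 4 : ℝ))
              (continuous_shifted M _) u)
            (weighted (fun p => (1 + ‖p‖ ^ 2) ^ (1 / 4 : ℝ)) (continuous_bracket _) u)).re := by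
  obtain ⟨c₀, hc₀, hc⟩ := hco
  obtain ⟨C, hC0, hC⟩ := exists_form_laplacian_bound (β := β) hθ hγ hl
  refine ⟨1 + (4 * C ^ 2 + 1 / 2) / c₀, by rw [le_add_iff_nonneg_right]; positivity, fun u => ?_⟩
  -- `M` is the size needed in `absorb_lower_order`, and at least one
  set M : ℝ := 1 + (4 * C ^ 2 + 1 / 2) / c₀ with hM
  have hMc : 4 * C ^ 2 + 1 / 2 ≤ M * c₀ := by
    rw [hM, add_mul, div_mul_cancel₀ _ hc₀.ne']
    linarith
  have hM0 : 0 ≤ M := by positivity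
  set φ := weighted (fun p => (1 + ‖p‖ ^ 2) ^ (1 / 4 : ℝ)) (continuous_bracket _) u with hφ
  set χ := weighted (fun p => (0 + ‖p‖ ^ 2) * (1 + ‖p‖ ^ 2) ^ (1 / 4 : ℝ)) (continuous_shifted 0 _) u
    with hχ
  have hη : weighted (fun p => (M + ‖p‖ ^ 2) * (1 + ‖p‖ ^ 2) ^ (1 / 4 : ℝ))
      (continuous_shifted M _) u = (M : ℂ) • φ + χ := by
    refine Lp.ext ?_
    filter_upwards [weighted_ae (continuous_shifted M (1 / 4)) u,
      weighted_ae (continuous_shifted 0 (1 / 4)) u, weighted_ae (continuous_bracket (1 / 4)) u,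
      Lp.coeFn_add ((M : ℂ) • φ) χ, Lp.coeFn_smul (M : ℂ) φ] with p h1 h2 h3 h4 h5
    rw [h4, Pi.add_apply, h5, Pi.smul_apply, h1, hχ, h2, hφ, h3, smul_eq_mul]
    push_cast
    ring
  have f1 : ∀ᵐ p, fhat (bessel (1 / 4) φ) p = (u : E3 → ℂ) p := by
    filter_upwards [fhat_bessel (1 / 4) φ, weighted_ae (continuous_bracket (1 / 4)) u] with p h1 h2
    rw [h1, hφ, h2, ofReal_bracket_mul, coe_quarter, neg_add_cancel, Real.rpow_zero,
      Complex.ofReal_one, one_mul]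
  have f2 : ∀ᵐ p, fhat (bessel (1 / 4) χ) p = ((‖p‖ ^ 2 : ℝ) : ℂ) * (u : E3 → ℂ) p := by
    filter_upwards [fhat_bessel (1 / 4) χ, weighted_ae (continuous_shifted 0 (1 / 4)) u]
      with p h1 h2
    rw [h1, hχ, h2, zero_add, mul_comm (‖p‖ ^ 2), Complex.ofReal_mul, mul_assoc,
      ofReal_bracket_mul, coe_quarter, neg_add_cancel, Real.rpow_zero, Complex.ofReal_one, one_mul]
  have b1 : c₀ * ‖φ‖ ^ 2 ≤ (a φ φ).re := by
    have h := hc (bessel (1 / 4) φ) (two_mul_quarter ▸ memH_bessel (1 / 4) φ)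
    rwa [← two_mul_quarter, normH_bessel, ← ha] at h
  have b2 := hC _ u.2 _ _ f2 f1
  rw [← ha] at b2
  have n1 : ‖φ‖ ^ 2 = ∫ p, (1 + ‖p‖ ^ 2) ^ (1 / 2 : ℝ) * ‖(u : E3 → ℂ) p‖ ^ 2 := by
    rw [hφ, norm_weighted_sq]
    refine integral_congr_ae (Filter.Eventually.of_forall fun p => ?_)
    simp only
    rw [bracket_sq]
    norm_num
  have i1 : Integrable fun p => (1 + ‖p‖ ^ 2) ^ (1 / 2 : ℝ) * ‖(u : E3 → ℂ) p‖ ^ 2 :=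
    IsTest.integrable_weight u.2 (continuous_bracket _)
  have i2 : Integrable fun p => ‖p‖ ^ 3 * ‖(u : E3 → ℂ) p‖ ^ 2 :=
    IsTest.integrable_weight u.2 (by fun_prop)
  have i3 : Integrable fun p => (1 + ‖p‖ ^ 2) * ‖(u : E3 → ℂ) p‖ ^ 2 :=
    IsTest.integrable_weight u.2 (by fun_prop)
  have i4 : Integrable fun p => ((1 + ‖p‖ ^ 2) ^ (3 / 4 : ℝ)) ^ 2 * ‖(u : E3 → ℂ) p‖ ^ 2 :=
    IsTest.integrable_weight u.2 ((continuous_bracket _).pow 2)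
  have main : 1 / 16 * (∫ p, ((1 + ‖p‖ ^ 2) ^ (3 / 4 : ℝ)) ^ 2 * ‖(u : E3 → ℂ) p‖ ^ 2)
      ≤ M * c₀ * (∫ p, (1 + ‖p‖ ^ 2) ^ (1 / 2 : ℝ) * ‖(u : E3 → ℂ) p‖ ^ 2)
        + 1 / 2 * (∫ p, ‖p‖ ^ 3 * ‖(u : E3 → ℂ) p‖ ^ 2)
        - C * ∫ p, (1 + ‖p‖ ^ 2) * ‖(u : E3 → ℂ) p‖ ^ 2 := by
    have j1 := i1.const_mul (M * c₀)
    have j2 := i2.const_mul (1 / 2)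
    have j3 := i3.const_mul C
    have j12 : Integrable fun p => M * c₀ * ((1 + ‖p‖ ^ 2) ^ (1 / 2 : ℝ) * ‖(u : E3 → ℂ) p‖ ^ 2)
        + 1 / 2 * (‖p‖ ^ 3 * ‖(u : E3 → ℂ) p‖ ^ 2) := j1.add j2
    rw [← integral_const_mul, ← integral_const_mul, ← integral_const_mul, ← integral_const_mul,
      ← integral_add j1 j2, ← integral_sub j12 j3]
    refine integral_mono (i4.const_mul _) (j12.sub j3) fun p => ?_
    have h1 : ((1 + ‖p‖ ^ 2) ^ (3 / 4 : ℝ)) ^ 2 = ((1 + ‖p‖ ^ 2) ^ (1 / 2 : ℝ)) ^ 3 := by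
      rw [← Real.rpow_mul_natCast (by positivity), ← Real.rpow_mul_natCast (by positivity)]
      norm_num
    have h2 : ((1 + ‖p‖ ^ 2) ^ (1 / 2 : ℝ)) ^ 2 = 1 + ‖p‖ ^ 2 := by
      rw [← Real.sqrt_eq_rpow, Real.sq_sqrt (by positivity)]
    have h3 := mul_le_mul_of_nonneg_right
      (absorb_lower_order (norm_nonneg p) (bracket_pos (1 / 2) p).le h2 hMc)
      (sq_nonneg ‖(u : E3 → ℂ) p‖)
    rw [h2] at h3
    simp only [h1]
    linarith
  have e : (a ((M : ℂ) • φ + χ) φ).re = M * (a φ φ).re + (a χ φ).re := by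
    rw [map_add, map_smulₛₗ, add_apply, smul_apply, smul_eq_mul, Complex.conj_ofReal, Complex.add_re,
      Complex.re_ofReal_mul]
  rw [hη, e, norm_weighted_sq]
  have h1 := mul_le_mul_of_nonneg_left b1 hM0
  rw [n1] at h1
  linarith

/-- The weak equation has a solution in `H^(3/2)`, with a bound. -/
lemma exists_regular_solution {β γ : ℝ} {θ : ℝ → ℝ} (hθ : SmoothCutoff θ) (hγ : 2 < γ) {lam : ℝ}
    (hl : 0 < lam) (hco : FormCoercive β γ θ lam) {a : L2 →L⋆[ℂ] L2 →L[ℂ] ℂ}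
    (ha : ∀ g h, a g h = form β γ θ lam (bessel (1 / 4) g) (bessel (1 / 4) h)) :
    ∃ c : ℝ, 0 < c ∧ ∀ f : L2, ∃ g : L2, ‖g‖ ≤ c * ‖f‖ ∧
      ∀ η : L2, a η (bracketCLM (1 / 2) g) = inner ℂ (bessel (1 / 4) η) (bessel (1 / 4) f) := by
  obtain ⟨M, hM, hcoer⟩ := exists_shifted_coercive hθ hγ hl hco ha
  refine ⟨16 * M, by positivity, fun f => ?_⟩
  obtain ⟨K, hK⟩ := exists_linearMap_inner_eq a (bracketCLM (1 / 2))
  set ψ := weighted (fun p => (1 + ‖p‖ ^ 2) ^ (3 / 4 : ℝ)) (continuous_bracket _) with hψ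
  set H := weighted (fun p => (M + ‖p‖ ^ 2) * (1 + ‖p‖ ^ 2) ^ (1 / 4 : ℝ))
    (continuous_shifted M _) with hH
  have hWψ : ∀ u, bracketCLM (1 / 2) (ψ u)
      = weighted (fun p => (1 + ‖p‖ ^ 2) ^ (1 / 4 : ℝ)) (continuous_bracket _) u := fun u => by
    refine Lp.ext ?_
    filter_upwards [bracketCLM_ae (1 / 2) (ψ u), weighted_ae (continuous_bracket (3 / 4)) u,
      weighted_ae (continuous_bracket (1 / 4)) u] with p h1 h2 h3
    rw [h1, hψ, h2, h3, ofReal_bracket_mul, coe_half]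
    norm_num
  have hk : ∀ u, 1 / 16 * ‖ψ u‖ ≤ ‖(K ∘ₗ H) u‖ := fun u => by
    have h1 := hcoer u
    rw [← hWψ, ← hK] at h1
    have h2 := h1.trans ((Complex.re_le_norm _).trans (norm_inner_le_norm _ _))
    rcases (norm_nonneg (ψ u)).eq_or_lt with h | h
    · rw [← h, mul_zero]
      exact norm_nonneg _
    · rw [pow_two, ← mul_assoc] at h2
      exact le_of_mul_le_mul_right h2 h
  have hm : ∀ p : E3, |(M + ‖p‖ ^ 2) * (1 + ‖p‖ ^ 2) ^ (-1 : ℝ)| ≤ M := fun p => by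
    have h0 : 0 < 1 + ‖p‖ ^ 2 := by positivity
    rw [abs_of_nonneg (by positivity), Real.rpow_neg_one, ← div_eq_mul_inv, div_le_iff₀ h0]
    nlinarith [sq_nonneg ‖p‖]
  set F := mulCLM _ (continuous_shifted M (-1)) M hm f with hF
  obtain ⟨g, hg, hgn⟩ := exists_inner_eq_of_norm_le (K ∘ₗ H) ψ (by norm_num) hk F
  refine ⟨g, ?_, fun η => ?_⟩
  · have h1 : ‖F‖ ≤ M * ‖f‖ := norm_mulCLM_le f
    calc ‖g‖ ≤ (1 / 16)⁻¹ * ‖F‖ := hgn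
      _ ≤ (1 / 16)⁻¹ * (M * ‖f‖) := by gcongr
      _ = 16 * M * ‖f‖ := by ring
  have hinner : ∀ η : L2, inner ℂ (bessel (1 / 4) η) (bessel (1 / 4) f)
      = inner ℂ (bracketCLM (1 / 4) η) (bracketCLM (1 / 4) f) := fun η =>
    invFhat.inner_map_map _ _
  have test : ∀ u, a (H u) (bracketCLM (1 / 2) g)
      = inner ℂ (bessel (1 / 4) (H u)) (bessel (1 / 4) f) := fun u => by
    rw [← hK, hinner]
    refine (hg u).trans ?_
    rw [L2.inner_def, L2.inner_def]
    refine integral_congr_ae ?_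
    filter_upwards [weighted_ae (continuous_bracket (3 / 4)) u,
      mulCLM_ae f (hm := continuous_shifted M (-1)) (hC := hm),
      bracketCLM_ae (1 / 4) (H u), bracketCLM_ae (1 / 4) f,
      weighted_ae (continuous_shifted M (1 / 4)) u] with p h1 h2 h3 h4 h5
    rw [hψ, h1, hF, h2, h3, h4, hH, h5, coe_quarter, RCLike.inner_apply, RCLike.inner_apply]
    simp only [map_mul, Complex.conj_ofReal]
    have e1 : (1 + ‖p‖ ^ 2) ^ (-1 : ℝ) * (1 + ‖p‖ ^ 2) ^ (3 / 4 : ℝ)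
        = (1 + ‖p‖ ^ 2) ^ (-(1 / 4) : ℝ) := by rw [bracket_add]; norm_num
    have e2 : (1 + ‖p‖ ^ 2) ^ (-(1 / 4) : ℝ) * (1 + ‖p‖ ^ 2) ^ (1 / 4 : ℝ) = 1 := by
      rw [bracket_add, neg_add_cancel, Real.rpow_zero]
    have e3 : ((M + ‖p‖ ^ 2) * (1 + ‖p‖ ^ 2) ^ (-1 : ℝ)) * (1 + ‖p‖ ^ 2) ^ (3 / 4 : ℝ)
        = (1 + ‖p‖ ^ 2) ^ (-(1 / 4) : ℝ) * ((1 + ‖p‖ ^ 2) ^ (-(1 / 4) : ℝ)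
          * ((M + ‖p‖ ^ 2) * (1 + ‖p‖ ^ 2) ^ (1 / 4 : ℝ))) := by
      rw [mul_assoc, e1, mul_left_comm _ (M + ‖p‖ ^ 2), e2]
      ring
    have e4 := congrArg (fun x : ℝ => (x : ℂ)) e3
    simp only [Complex.ofReal_mul] at e4
    rw [Complex.ofReal_mul, Complex.ofReal_mul]
    linear_combination (f p * conj ((u : E3 → ℂ) p)) * e4
  have hcl : IsClosed {η : L2 | a η (bracketCLM (1 / 2) g)
      = inner ℂ (bessel (1 / 4) η) (bessel (1 / 4) f)} :=
    isClosed_eq (a.continuous.clm_apply continuous_const)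
      ((bessel (1 / 4)).continuous.inner continuous_const)
  refine closure_minimal ?_ hcl (dense_isTest η)
  rintro _ ⟨v, hv, rfl⟩
  -- every test function is of the form `(M + p²) (1 + p²)^(1/4) u` since the weight does not vanish
  have hw : ∀ p : E3, (M + ‖p‖ ^ 2) * (1 + ‖p‖ ^ 2) ^ (1 / 4 : ℝ) ≠ 0 := fun p => by positivity
  have hu : IsTest fun p =>
      ((((M + ‖p‖ ^ 2) * (1 + ‖p‖ ^ 2) ^ (1 / 4 : ℝ))⁻¹ : ℝ) : ℂ) * v p :=
    hv.continuous_mul (Complex.continuous_ofReal.comp ((continuous_shifted M _).inv₀ hw))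
  have e : H ⟨_, hu⟩ = hv.toL2 := by
    refine Lp.ext ?_
    filter_upwards [weighted_ae (continuous_shifted M (1 / 4)) ⟨_, hu⟩,
      (hv.memLp 2).coeFn_toLp] with p h1 h2
    rw [hH, h1, IsTest.toL2, h2, ← mul_assoc, ← Complex.ofReal_mul, mul_inv_cancel₀ (hw p),
      Complex.ofReal_one, one_mul]
  exact e ▸ test ⟨_, hu⟩

lemma bessel_quarter_bracketCLM_half (g : L2) :
    bessel (1 / 4) (bracketCLM (1 / 2) g) = bessel (3 / 4) g := by
  refine eq_of_fhat_ae_eq ?_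
  filter_upwards [fhat_bessel (1 / 4) (bracketCLM (1 / 2) g), fhat_bessel (3 / 4) g,
    bracketCLM_ae (1 / 2) g] with p h1 h2 h3
  rw [h1, h2, h3, ofReal_bracket_mul, coe_quarter, coe_half, coe_three_quarter]
  norm_num

end ThreeBoson

end

theorem propositionA2 (β γ : ℝ) (θ : ℝ → ℝ) (hθ : ThreeBoson.SmoothCutoff θ) (hγ : 2 < γ) :
    (∃ lam₀ : ℝ, 0 < lam₀ ∧ ∀ lam : ℝ, lam₀ < lam → ThreeBoson.FormCoercive β γ θ lam) ∧
    ∀ lam : ℝ, 0 < lam → ThreeBoson.FormCoercive β γ θ lam →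
      ∃ c : ℝ, 0 < c ∧ ∀ f ξ : ThreeBoson.L2,
        ThreeBoson.MemH (1 / 2) f → ThreeBoson.GammaEq β γ θ lam ξ f →
          ThreeBoson.MemH (3 / 2) ξ ∧
            ThreeBoson.normH (3 / 2) ξ ≤ c * ThreeBoson.normH (1 / 2) f := by
  refine ⟨ThreeBoson.exists_formCoercive hθ hγ, fun lam hl hco => ?_⟩
  obtain ⟨a, ha⟩ := ThreeBoson.exists_form hθ β γ hl
  obtain ⟨c, hc0, hc⟩ := ThreeBoson.exists_regular_solution hθ hγ hl hco ha
  refine ⟨c, hc0, fun f ξ hf ⟨hξ, heq⟩ => ?_⟩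
  have t := ThreeBoson.two_mul_quarter
  rw [← t] at hf hξ
  obtain ⟨f, rfl⟩ := ThreeBoson.exists_eq_bessel (1 / 4) hf
  obtain ⟨ξ, rfl⟩ := ThreeBoson.exists_eq_bessel (1 / 4) hξ
  obtain ⟨g, hgn, hg⟩ := hc f
  -- the two solutions agree by coercivity
  have huniq : ξ = ThreeBoson.bracketCLM (1 / 2) g := by
    set d := ξ - ThreeBoson.bracketCLM (1 / 2) g with hd
    have h0 : a d d = 0 := by
      nth_rewrite 2 [hd]
      rw [map_sub, ha d ξ, heq _ (t ▸ ThreeBoson.memH_bessel (1 / 4) d), hg, sub_self]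
    obtain ⟨c₀, hc₀, hcoer⟩ := hco
    have h1 := hcoer _ (t ▸ ThreeBoson.memH_bessel (1 / 4) d)
    rw [← ha, h0, Complex.zero_re, ← t, ThreeBoson.normH_bessel] at h1
    have h2 : ‖d‖ ^ 2 ≤ 0 := nonpos_of_mul_nonpos_right h1 hc₀
    have h3 : d = 0 := norm_eq_zero.1 (pow_eq_zero_iff two_ne_zero |>.1 (h2.antisymm (sq_nonneg _)))
    exact sub_eq_zero.1 h3
  have s : (3 / 2 : ℝ) = 2 * ((3 / 4 : NNReal) : ℝ) := by norm_num
  rw [huniq, ThreeBoson.bessel_quarter_bracketCLM_half, s, ← t, ThreeBoson.normH_bessel,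
    ThreeBoson.normH_bessel]
  exact ⟨ThreeBoson.memH_bessel _ _, hgn⟩
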